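/- Let $0\le q<p\le 1$ with $p+q=1$, let $0<\rho<1$, $z\in\mathbb Z$, $t>0$. The $(p,q)$-ASEP is the exclusion process on $\{0,1\}^{\mathbb Z}$ given by the graphical construction: independent Poisson clocks $N^{i\to i+1}$ (rate $p$) and $N^{i\to i-1}$ (rate $q$), $i\in\mathbb Z$, are independent of the initial configuration $\eta(0)$; when $N^{i\to i\pm1}$ rings, a particle at $i$ moves to $i\pm1$ if that site is vacant, and otherwise nothing happens. Under $P^\rho$ (the stationary process of density $\rho$) the variables $\eta_i(0)$, $i\in\mathbb Z$, are i.i.d. Bernoulli with mean $\rho$. The current $J_x(t)$ is the number of particles that lie in $(-\infty,0]$ at time $0$ and in $[x+1,\infty)$ at time $t$, minus the number of particles that lie in $[1,\infty)$ at time $0$ and in $(-\infty,x]$ at time $t$. Under $\mathbf P^\rho$ two processes $\eta,\eta^+$ obey the same clocks, $\eta_i(0)=\eta_i^+(0)$, $i\ne0$, are i.i.d. Bernoulli with mean $\rho$, and $\eta_0(0)=0$, $\eta^+_0(0)=1$; the second class particle is the position $Q(t)$ of the discrepancy, $\eta^+(t)=\eta(t)+\delta_{Q(t)}$, so that $Q(0)=0$.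 Let $H(\rho)=(p-q)\rho(1-\rho)$ and $V^\rho=H'(\rho)$. Theorem. Almost surely the graphical construction determines these processes uniquely, and there is exactly one discrepancy $Q(s)$ at every time $s\ge0$. The configuration at each fixed time is measurable (up to null sets), $J_z(t)$ is square integrable, $Q(t)$ is integrable, and $$\mathrm{Var}^\rho[J_z(t)]=\sum_{j\in\mathbb Z}|j-z|\,\mathrm{Cov}^\rho[\eta_j(t),\eta_0(0)]\quad\text{(a convergent sum)},$$ $$\mathrm{Cov}^\rho[\eta_j(t),\eta_0(0)]=\rho(1-\rho)\,\mathbf P^\rho\{Q(t)=j\}\qquad(j\in\mathbb Z),$$ $$\mathbf E^\rho[Q(t)]=V^\rho t=H'(\rho)\,t,\qquad V^\rho=(p-q)(1-2\rho),$$ where $H$ is the flux, that is, $E^\rho[J_0(t)]=H(\rho)\,t$. Hence $$\mathrm{Var}^\rho[J_z(t)]=\rho(1-\rho)\,\mathbf E^\rho|Q(t)-z|.$$ -/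

import Mathlib

open MeasureTheory ProbabilityTheory Filter Topology
open scoped NNReal

namespace ASEP

/-- Configurations in `{0,1}^ℤ`; `true` means that the site is occupied. -/
abbrev Config := ℤ → Bool

/-- Configurations of labelled particles: the label of the particle at each site, `none` at the
vacant sites. Labels identify individual particles; they do not influence the motion. -/
abbrev Labelled := ℤ → Option ℤ

/-- The two clocks at each site `i`: `(i, true)` is the clock `N^{i → i+1}`,
`(i, false)` is the clock `N^{i → i-1}`. -/
abbrev ClockIndex := ℤ × Bool

/-- The site towards which a clock prompts the particle at its site to jump. -/
def target (e : ClockIndex) : ℤ := if e.2 then e.1 + 1 else e.1 - 1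

/-- A realization of all the clocks: `n e s` is the number of rings of the clock `e` in `(0, s]`. -/
abbrev Clocks := ClockIndex → ℝ≥0 → ℕ

/-- The time `t` is a jump time (ring) of the clock with counting function `f`. -/
def RingsAt (f : ℝ≥0 → ℕ) (t : ℝ≥0) : Prop := 0 < t ∧ ∀ s < t, f s < f t

/-- The effect of a ring of the clock `e`: if the site of `e` is occupied and the target site is
vacant, the particle moves to the target; otherwise nothing happens. -/
def move (e : ClockIndex) (S : Labelled) : Labelled :=
  if (S e.1).isSome ∧ S (target e) = none then
    Function.update (Function.update S (target e) (S e.1)) e.1 none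
  else S

/-- The graphical (Harris) construction, for one realization `n` of the clocks: `S` starts from
`S₀`, each site is constant just after each time and has a left limit at each positive time, the
state changes only when a clock rings, and then according to the exclusion rule. -/
structure IsGraphicalPath (n : Clocks) (S₀ : Labelled) (S : ℝ≥0 → Labelled) : Prop where
  init : S 0 = S₀
  right : ∀ t i, ∀ᶠ s in 𝓝[>] t, S s i = S t i
  left : ∀ t, 0 < t → ∃ L : Labelled, (∀ i, ∀ᶠ s in 𝓝[<] t, S s i = L i) ∧
    (∀ e, RingsAt (n e) t → S t = move e L) ∧ ((∀ e, ¬ RingsAt (n e) t) → S t = L)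

/-- Each particle is labelled by its initial site. -/
def labelled (η₀ : Config) : Labelled := fun i => if η₀ i then some i else none

/-- The labelled process produced by the graphical construction from the initial configuration
`η₀`. For almost every realization of Poisson clocks there is exactly one such path. -/
noncomputable def path (n : Clocks) (η₀ : Config) : ℝ≥0 → Labelled :=
  Classical.epsilon (IsGraphicalPath n (labelled η₀))

/-- The exclusion process `η(t)` with initial configuration `η₀` driven by the clocks `n`. -/
noncomputable def process (n : Clocks) (η₀ : Config) (t : ℝ≥0) : Config :=
  fun i => (path n η₀ t i).isSome

/-- The occupation variable as a real number. -/
def occ (η : Config) (i : ℤ) : ℝ := if η i then 1 else 0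

/-- The current `J_x(t)`: the number of particles in `(-∞, 0]` at time `0` and in `[x+1, ∞)` at time
`t`, minus the number of particles in `[1, ∞)` at time `0` and in `(-∞, x]` at time `t`. The
particle with label `k` is the one that starts at `k`. -/
noncomputable def current (n : Clocks) (η₀ : Config) (x : ℤ) (t : ℝ≥0) : ℤ :=
  ({k : ℤ | k ≤ 0 ∧ ∃ i, x + 1 ≤ i ∧ path n η₀ t i = some k}.ncard : ℤ) -
    ({k : ℤ | 1 ≤ k ∧ ∃ i, i ≤ x ∧ path n η₀ t i = some k}.ncard : ℤ)

/-- `ζ = η + δ_j`. -/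
def IsAddParticle (η ζ : Config) (j : ℤ) : Prop :=
  η j = false ∧ ζ = Function.update η j true

/-- The initial configuration `η₀ + δ₀`. -/
def plus (η₀ : Config) : Config := Function.update η₀ 0 true

/-- The second class particle `Q(t)` started at the origin: the site of the discrepancy,
`η⁺(t) = η(t) + δ_{Q(t)}`, between the processes `η` and `η⁺` which start from `η₀` (with site `0`
vacant) and `η₀ + δ₀` and obey the same clocks. -/
noncomputable def secondClass (n : Clocks) (η₀ : Config) (t : ℝ≥0) : ℤ :=
  Classical.epsilon (IsAddParticle (process n η₀ t) (process n (plus η₀) t))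

/-- A Poisson process on `[0, ∞)` of rate `r`, through its counting process. -/
structure IsPoissonProcess {Ω : Type*} [MeasurableSpace Ω] (P : Measure Ω)
    (r : ℝ≥0) (X : ℝ≥0 → Ω → ℕ) : Prop where
  measurable : ∀ t, Measurable (X t)
  zero : ∀ᵐ ω ∂P, X 0 ω = 0
  monotone : ∀ᵐ ω ∂P, Monotone fun t => X t ω
  right_continuous : ∀ᵐ ω ∂P, ∀ t, ∀ᶠ s in 𝓝[>] t, X s ω = X t ω
  increments : ∀ s t, s ≤ t → P.map (fun ω => X t ω - X s ω) = poissonMeasure (r * (t - s))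
  indep : HasIndepIncrements X P

/-- The random input of the graphical construction of the `(p,q)`-ASEP: independent Poisson clocks
`N`, of rate `p` for the jumps to the right and `q` for the jumps to the left, and, independent of
them, a random initial configuration `η₀` whose occupation variables at the sites of `A` are i.i.d.
Bernoulli with mean `ρ`. -/
structure IsInput {Ω : Type*} [MeasurableSpace Ω] (P : Measure Ω) (p q : ℝ≥0) (ρ : ℝ) (A : Set ℤ)
    (N : Ω → Clocks) (η₀ : Ω → Config) : Prop where
  poisson : ∀ e : ClockIndex, IsPoissonProcess P (if e.2 then p else q) fun t ω => N ω e t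
  indep_clocks : iIndepFun (fun e ω => N ω e) P
  measurable_init : Measurable η₀
  mean_init : ∀ i ∈ A, P {ω | η₀ ω i = true} = ENNReal.ofReal ρ
  indep_init : iIndepFun (fun (i : A) ω => η₀ ω i) P
  indep : IndepFun N η₀ P

/-- The flux `H(ρ)`. -/
def flux (p q : ℝ≥0) (ρ : ℝ) : ℝ := ((p : ℝ) - q) * (ρ * (1 - ρ))

/-- The characteristic speed `V^ρ = H'(ρ)`. -/
noncomputable def speed (p q : ℝ≥0) (ρ : ℝ) : ℝ := deriv (flux p q) ρ

end ASEP

namespace ASEP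

/-! ### Jumps towards arbitrary targets -/

/-! The proof has four ingredients: a finite description of the infinite system, exact stationarity,
the effect of one added particle, and decay of correlations.

Finite description. Call `b` a barrier up to time `T` if no clock prompts a jump across the bond
`b|b + 1` before `T`. Since `p + q = 1`, each bond is a barrier with probability `exp (-T)`,
independently of the others, so almost surely there are barriers arbitrarily far out on both sides.
Between two barriers the system is finite and its evolution is determined by the ordered list of
rings. Every sufficiently large ring of sites produces the same evolution there. This yields
existence and uniqueness of the graphical path, conservation of labels, and a formula for the
current as a difference of particle numbers up to a barrier.

Stationarity. On a ring of sites, time is cut into `m` intervals and a move is made only if exactly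
one clock rings in an interval. One such step preserves the Bernoulli law exactly: an allowed jump
exchanges two sites, so the expected change of `f` is a sum of terms `E[(η_target - η_source) f]`,
which cancel around the ring (`IsInput.integral_gridConfig`). On a fine grid the list of rings is
recovered, so dominated convergence, first in `m` and then in the ring size, transfers stationarity
to the line. No generator is needed. The currents are dominated throughout by `bondRings`, the
square integrable number of rings at the bond `0|1`.

One added particle. As `η_k(0)` is Bernoulli and independent of everything else, the covariance of a
functional `F` with `η_k(0)` equals `ρ(1 - ρ)` times the mean change of `F` when site `k` is
switched from vacant to occupied (`IsInput.integral_mul_occ_sub`). For `F = η_j(t)` and `k = 0` that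
change is the indicator of `Q(t) = j`, which is the space-time covariance formula. For `F` the
current through `0|1` and general `k`, a translation turns the change into `bondGain k Q`, and these
add up over `k` to `Q`. Hence `ρ(1 - ρ) E[Q]` is the sum over `k` of the covariances of the current
with `η_k(0)`. On a ring this sum is the covariance with the total particle number, which is
conserved; stationarity evaluates it as `t` times that of the instantaneous rate of crossing, namely
`(p - q) ρ(1 - ρ)(1 - 2ρ) t`. A bound that decays geometrically in `|k|`, uniformly in the ring
size, carries the value to the line. The sign of `bondGain k` depends on `k` alone, so the same sum
also gives integrability of `Q`.

Variance. Let `R_M` be the current through `M|M + 1`. Counting particles gives `J = R_M + X = Y +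
R_{-M}`, where `X` and `Y` involve only occupation variables, at times `0` and `t`, in windows to
the right and to the left. Bilinearity writes `Var J` as `Cov(X, Y)` plus covariances that contain
`R_M` or `R_{-M}`. In `Cov(X, Y)` the equal-time terms vanish by stationarity, and the space-time
terms give `ρ(1 - ρ) E[pairCount z M Q]`, where `pairCount z M Q` increases to `|Q - z|`. The
remaining covariances tend to `0`, because distant bonds are approximately driven by disjoint, hence
independent, sets of clocks and sites (`IsInput.tendsto_covariance_bondCurrent`). -/

/-- The effect of a ring of the clock `e` when its target site is `v e`. -/
def jump (v : ClockIndex → ℤ) (e : ClockIndex) (S : Labelled) : Labelled :=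
  if (S e.1).isSome ∧ S (v e) = none then
    Function.update (Function.update S (v e) (S e.1)) e.1 none
  else S

/-- The state after the rings of the clocks in the list, the latest ring first. -/
def run (v : ClockIndex → ℤ) (l : List ClockIndex) (S : Labelled) : Labelled :=
  l.foldr (jump v) S

@[simp] lemma run_nil (v : ClockIndex → ℤ) (S : Labelled) : run v [] S = S := rfl

@[simp] lemma run_cons (v : ClockIndex → ℤ) (e : ClockIndex) (l : List ClockIndex) (S : Labelled) :
    run v (e :: l) S = jump v e (run v l S) := rfl

lemma jump_congr {v w : ClockIndex → ℤ} {e : ClockIndex} {S S' : Labelled} {i : ℤ}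
    (hv : v e = w e) (h1 : S e.1 = S' e.1) (h2 : S (v e) = S' (v e)) (hi : S i = S' i) :
    jump v e S i = jump w e S' i := by
  unfold jump
  rw [← hv, ← h1, ← h2]
  split_ifs
  · simp only [Function.update_apply, hi, h1]
  · exact hi

lemma jump_of_ne {v : ClockIndex → ℤ} {e : ClockIndex} {S : Labelled} {i : ℤ}
    (h1 : i ≠ e.1) (h2 : i ≠ v e) : jump v e S i = S i := by
  unfold jump
  split_ifs
  · simp [h1, h2]
  · rfl

/-! ### Regular realizations of the clocks -/

/-- Up to time `T` no clock prompts a jump between `b` and `b + 1`. -/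
def Barrier (n : Clocks) (T : ℝ≥0) (b : ℤ) : Prop := n (b, true) T = 0 ∧ n (b + 1, false) T = 0

/-- The properties of the clocks, valid almost surely, on which the graphical construction rests. -/
structure Good (n : Clocks) : Prop where
  zero : ∀ e, n e 0 = 0
  mono : ∀ e, Monotone (n e)
  right_cont : ∀ e t, ∀ᶠ s in 𝓝[>] t, n e s = n e t
  disjoint : ∀ e e', e ≠ e' → ∀ t, RingsAt (n e) t → ¬ RingsAt (n e') t
  right_barrier : ∀ (T : ℝ≥0) (x : ℤ), ∃ b ≥ x, Barrier n T b
  left_barrier : ∀ (T : ℝ≥0) (x : ℤ), ∃ b ≤ x, Barrier n T b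

lemma not_ringsAt_of_eq_zero {n : Clocks} (hn : Good n) {T : ℝ≥0} {e : ClockIndex}
    (h : n e T = 0) {t : ℝ≥0} (ht : t ≤ T) : ¬ RingsAt (n e) t := by
  intro hr
  have h1 := hr.2 0 hr.1
  have h2 := hn.mono e ht
  omega

/-- A ringing clock does not prompt a jump across a barrier. -/
lemma side_of_barriers {n : Clocks} (hn : Good n) {T t : ℝ≥0} (ht : t ≤ T) {a b : ℤ}
    (ha : Barrier n T (a - 1)) (hb : Barrier n T b) {e : ClockIndex} (he : RingsAt (n e) t) :
    (a ≤ e.1 ∧ e.1 ≤ b) ↔ (a ≤ target e ∧ target e ≤ b) := by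
  obtain ⟨i, d⟩ := e
  have h1 : (i, d) ≠ (a - 1, true) := fun h =>
    not_ringsAt_of_eq_zero hn ha.1 ht (h ▸ he)
  have h2 : (i, d) ≠ (a - 1 + 1, false) := fun h =>
    not_ringsAt_of_eq_zero hn ha.2 ht (h ▸ he)
  have h3 : (i, d) ≠ (b, true) := fun h => not_ringsAt_of_eq_zero hn hb.1 ht (h ▸ he)
  have h4 : (i, d) ≠ (b + 1, false) := fun h => not_ringsAt_of_eq_zero hn hb.2 ht (h ▸ he)
  cases d <;> simp [target] at * <;> omega

/-- The left barrier sits at `a - 1`, that is on the bond `a - 1|a`, so that the protected block is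
exactly `[a, b]`. -/
lemma exists_block {n : Clocks} (hn : Good n) (T : ℝ≥0) (x y : ℤ) :
    ∃ a b, a ≤ x ∧ y ≤ b ∧ Barrier n T (a - 1) ∧ Barrier n T b := by
  obtain ⟨a, ha, ha'⟩ := hn.left_barrier T (x - 1)
  obtain ⟨b, hb, hb'⟩ := hn.right_barrier T y
  exact ⟨a + 1, b, by omega, hb, by simpa using ha', hb'⟩

/-! ### The list of rings -/

/-- The times in `(0, s]` at which a clock of `E` rings. -/
def ringTimes (E : Finset ClockIndex) (n : Clocks) (s : ℝ≥0) : Set ℝ≥0 :=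
  {τ | τ ≤ s ∧ ∃ e ∈ E, RingsAt (n e) τ}

/-- A clock's count strictly increases at each of its rings, so its ring times up to `s` inject into
the integers up to `n e s`. -/
lemma ringTimes_finite {n : Clocks} (hn : Good n) (E : Finset ClockIndex) (s : ℝ≥0) :
    (ringTimes E n s).Finite := by
  have : ringTimes E n s = ⋃ e ∈ E, {τ | τ ≤ s ∧ RingsAt (n e) τ} := by
    ext τ; simp only [ringTimes, Set.mem_ofPred_eq, Set.mem_iUnion, exists_prop]; tauto
  rw [this]
  refine E.finite_toSet.biUnion fun e _ => ?_
  refine Set.Finite.of_finite_image (f := n e) ((Set.finite_Iic (n e s)).subset ?_) ?_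
  · rintro _ ⟨τ, hτ, rfl⟩
    exact hn.mono e hτ.1
  · intro x hx y hy hxy
    rcases lt_trichotomy x y with h | h | h
    · exact absurd hxy (hy.2.2 x h).ne
    · exact h
    · exact absurd hxy (hx.2.2 y h).ne'

/-- A clock of `E` that rings at time `τ`. -/
noncomputable def clockAt (E : Finset ClockIndex) (n : Clocks) (τ : ℝ≥0) : ClockIndex :=
  Classical.epsilon fun e => e ∈ E ∧ RingsAt (n e) τ

lemma clockAt_eq {n : Clocks} (hn : Good n) {E : Finset ClockIndex} {τ : ℝ≥0} {e : ClockIndex}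
    (he : e ∈ E) (hr : RingsAt (n e) τ) : clockAt E n τ = e := by
  have h : clockAt E n τ ∈ E ∧ RingsAt (n (clockAt E n τ)) τ :=
    Classical.epsilon_spec (p := fun e => e ∈ E ∧ RingsAt (n e) τ) ⟨e, he, hr⟩
  by_contra hne
  exact hn.disjoint _ _ hne τ h.2 hr

open Classical in
/-- The clocks of `E` that ring in `(0, s]`, the latest ring first. -/
noncomputable def ringList (E : Finset ClockIndex) (n : Clocks) (s : ℝ≥0) : List ClockIndex :=
  if h : (ringTimes E n s).Finite then (h.toFinset.sort (· ≥ ·)).map (clockAt E n) else []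

lemma ringList_congr {n : Clocks} {E : Finset ClockIndex} {s s' : ℝ≥0}
    (h : ringTimes E n s = ringTimes E n s') : ringList E n s = ringList E n s' := by
  unfold ringList
  generalize ringTimes E n s = A at h ⊢
  subst h
  rfl

lemma ringList_zero (n : Clocks) (E : Finset ClockIndex) : ringList E n 0 = [] := by
  have : ringTimes E n 0 = ∅ := by
    ext τ
    simp only [ringTimes, Set.mem_ofPred_eq, Set.mem_empty_iff_false, iff_false, not_and]
    rintro h ⟨e, _, hr⟩
    exact absurd hr.1 (by simpa using h)
  unfold ringList
  simp [this]

lemma ringList_eq_of_forall {n : Clocks} {E : Finset ClockIndex} {s s' : ℝ≥0} (hs : s ≤ s')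
    (h : ∀ τ, s < τ → τ ≤ s' → ∀ e ∈ E, ¬ RingsAt (n e) τ) : ringList E n s' = ringList E n s := by
  refine ringList_congr (Set.ext fun τ => ⟨fun hτ => ⟨?_, hτ.2⟩, fun hτ => ⟨hτ.1.trans hs, hτ.2⟩⟩)
  by_contra hlt
  obtain ⟨e, he, hr⟩ := hτ.2
  exact h τ (not_le.1 hlt) hτ.1 e he hr

/-- A ring after `s` is the new maximum of the set of ring times, hence the head of the decreasing
list. -/
lemma ringList_cons {n : Clocks} (hn : Good n) {E : Finset ClockIndex} {s s' τ : ℝ≥0}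
    (h1 : s < τ) (h2 : τ ≤ s') {e : ClockIndex} (he : e ∈ E) (hr : RingsAt (n e) τ)
    (h : ∀ τ', s < τ' → τ' ≤ s' → ∀ e ∈ E, RingsAt (n e) τ' → τ' = τ) :
    ringList E n s' = e :: ringList E n s := by
  have hf := ringTimes_finite hn E s
  have hf' := ringTimes_finite hn E s'
  have hins : hf'.toFinset = insert τ hf.toFinset := by
    ext τ'
    simp only [Set.Finite.mem_toFinset, Finset.mem_insert]
    constructor
    · intro hτ
      by_cases hle : τ' ≤ s
      · exact Or.inr ⟨hle, hτ.2⟩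
      · obtain ⟨e', he', hr'⟩ := hτ.2
        exact Or.inl (h τ' (not_le.1 hle) hτ.1 e' he' hr')
    · rintro (rfl | hτ)
      · exact ⟨h2, e, he, hr⟩
      · exact ⟨hτ.1.trans (h1.le.trans h2), hτ.2⟩
  unfold ringList
  rw [dif_pos hf, dif_pos hf', hins, Finset.sort_insert, List.map_cons, clockAt_eq hn he hr]
  · intro b hb
    exact ((hf.mem_toFinset.1 hb).1.trans h1.le)
  · intro hb
    exact absurd (hf.mem_toFinset.1 hb).1 (not_le.2 h1)

lemma eventually_right_not_ringsAt {n : Clocks} (hn : Good n) (E : Finset ClockIndex) (t : ℝ≥0) :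
    ∀ᶠ s in 𝓝[>] t, ∀ τ, t < τ → τ ≤ s → ∀ e ∈ E, ¬ RingsAt (n e) τ := by
  have hf := ringTimes_finite hn E (t + 1)
  have h1 : ∀ᶠ s in 𝓝[>] t, ∀ τ ∈ {τ ∈ ringTimes E n (t + 1) | t < τ}, s < τ := by
    rw [Filter.eventually_all_finite (hf.subset fun _ h => h.1)]
    intro τ hτ
    exact mem_of_superset (Ioo_mem_nhdsGT hτ.2) fun s hs => hs.2
  have h2 : ∀ᶠ s in 𝓝[>] t, s < t + 1 :=
    mem_of_superset (Ioo_mem_nhdsGT (lt_add_one t)) fun s hs => hs.2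
  filter_upwards [h1, h2] with s hs1 hs2 τ hτ hτs e he hr
  exact absurd (hs1 τ ⟨⟨hτs.trans hs2.le, e, he, hr⟩, hτ⟩) (not_lt.2 hτs)

lemma eventually_left_not_ringsAt {n : Clocks} (hn : Good n) (E : Finset ClockIndex) (t : ℝ≥0) :
    ∀ᶠ s in 𝓝[<] t, ∀ τ, s < τ → τ < t → ∀ e ∈ E, ¬ RingsAt (n e) τ := by
  have hf := ringTimes_finite hn E t
  have h1 : ∀ᶠ s in 𝓝[<] t, ∀ τ ∈ {τ ∈ ringTimes E n t | τ < t}, τ < s := by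
    rw [Filter.eventually_all_finite (hf.subset fun _ h => h.1)]
    intro τ hτ
    exact mem_of_superset (Ioo_mem_nhdsLT hτ.2) fun s hs => hs.1
  filter_upwards [h1] with s hs1 τ hτ hτs e he hr
  exact absurd (hs1 τ ⟨⟨hτs.le, e, he, hr⟩, hτs⟩) (not_lt.2 hτ.le)

lemma eventually_right_ringList {n : Clocks} (hn : Good n) (E : Finset ClockIndex) (t : ℝ≥0) :
    ∀ᶠ s in 𝓝[>] t, ringList E n s = ringList E n t := by
  filter_upwards [eventually_right_not_ringsAt hn E t, self_mem_nhdsWithin] with s hs hts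
  exact ringList_eq_of_forall (le_of_lt hts) hs

/-- The list of rings has a left limit at each time, and a ring adds its clock to the list. -/
lemma exists_left_ringList {n : Clocks} (hn : Good n) (E : Finset ClockIndex) {t : ℝ≥0}
    (ht : 0 < t) : ∃ l, (∀ᶠ s in 𝓝[<] t, ringList E n s = l) ∧
      (∀ e ∈ E, RingsAt (n e) t → ringList E n t = e :: l) ∧
      ((∀ e ∈ E, ¬ RingsAt (n e) t) → ringList E n t = l) := by
  have : (𝓝[<] t).NeBot := nhdsLT_neBot_of_exists_lt ⟨0, ht⟩
  have hev := eventually_left_not_ringsAt hn E t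
  obtain ⟨s₀, hs₀, hs₀t : s₀ < t⟩ := (hev.and self_mem_nhdsWithin).exists
  refine ⟨ringList E n s₀, ?_, ?_, ?_⟩
  · have : ∀ᶠ s in 𝓝[<] t, s₀ < s ∧ s < t := Ioo_mem_nhdsLT hs₀t
    filter_upwards [this] with s hs
    exact ringList_eq_of_forall hs.1.le fun τ h1 h2 e he =>
      hs₀ τ h1 (h2.trans_lt hs.2) e he
  · intro e he hr
    refine ringList_cons hn hs₀t le_rfl he hr fun τ h1 h2 e' he' hr' => ?_
    by_contra hne
    exact hs₀ τ h1 (lt_of_le_of_ne h2 hne) e' he' hr'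
  · intro h
    refine ringList_eq_of_forall hs₀t.le fun τ h1 h2 e he hr => ?_
    rcases h2.lt_or_eq with h2 | rfl
    · exact hs₀ τ h1 h2 e he hr
    · exact h e he hr

lemma ringsAt_of_mem_ringList {n : Clocks} {E : Finset ClockIndex} {s : ℝ≥0}
    {e : ClockIndex} (he : e ∈ ringList E n s) : e ∈ E ∧ ∃ τ ≤ s, RingsAt (n e) τ := by
  unfold ringList at he
  split_ifs at he with h
  · obtain ⟨τ, hτ, rfl⟩ := List.mem_map.1 he
    have hτ' := h.mem_toFinset.1 ((Finset.mem_sort _).1 hτ)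
    have := Classical.epsilon_spec (p := fun e => e ∈ E ∧ RingsAt (n e) τ) hτ'.2
    exact ⟨this.1, τ, hτ'.1, this.2⟩
  · simp at he

/-! ### Paths in a block -/

/-- A path that obeys, on the sites of `[a, b]` and up to time `T`, the clocks that act within
`[a, b]`. -/
structure IsBlockPath (n : Clocks) (T : ℝ≥0) (a b : ℤ) (S : ℝ≥0 → Labelled) : Prop where
  right : ∀ t < T, ∀ i, a ≤ i → i ≤ b → ∀ᶠ s in 𝓝[>] t, S s i = S t i
  left : ∀ t, 0 < t → t ≤ T → ∃ L : Labelled,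
    (∀ i, a ≤ i → i ≤ b → ∀ᶠ s in 𝓝[<] t, S s i = L i) ∧
    ∀ i, a ≤ i → i ≤ b →
      (∀ e : ClockIndex, (a ≤ e.1 ∧ e.1 ≤ b) → (a ≤ target e ∧ target e ≤ b) →
        RingsAt (n e) t → S t i = move e L i) ∧
      ((∀ e : ClockIndex, (a ≤ e.1 ∧ e.1 ≤ b) → (a ≤ target e ∧ target e ≤ b) →
        ¬ RingsAt (n e) t) → S t i = L i)

/-- Consider the infimum `τ` of the times at which the two paths differ in the block. They agree
before `τ`, so their left limits agree and the same ring acts on both; hence they agree at `τ`.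
Being constant for a while after `τ` on the finitely many sites of the block, they also agree
shortly after `τ`, contrary to its choice. -/
lemma IsBlockPath.unique {n : Clocks} {T : ℝ≥0} {a b : ℤ} {S S' : ℝ≥0 → Labelled}
    (h : IsBlockPath n T a b S) (h' : IsBlockPath n T a b S')
    (h0 : ∀ i, a ≤ i → i ≤ b → S 0 i = S' 0 i) {s : ℝ≥0} (hs : s ≤ T) {i : ℤ} (hai : a ≤ i)
    (hib : i ≤ b) : S s i = S' s i := by
  by_contra hne
  set A : Set ℝ≥0 := {s | s ≤ T ∧ ∃ i, a ≤ i ∧ i ≤ b ∧ S s i ≠ S' s i} with hA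
  have hAne : A.Nonempty := ⟨s, hs, i, hai, hib, hne⟩
  have hbdd : BddBelow A := ⟨0, fun _ _ => zero_le⟩
  set τ := sInf A with hτ
  have hτs : τ ≤ s := csInf_le hbdd ⟨hs, i, hai, hib, hne⟩
  have hτT : τ ≤ T := hτs.trans hs
  have hbefore : ∀ r < τ, ∀ j, a ≤ j → j ≤ b → S r j = S' r j := by
    intro r hr j hj1 hj2
    by_contra hc
    exact absurd (csInf_le hbdd (show r ∈ A from ⟨hr.le.trans hτT, j, hj1, hj2, hc⟩)) (not_le.2 hr)
  have hat : ∀ j, a ≤ j → j ≤ b → S τ j = S' τ j := by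
    rcases (zero_le (a := τ)).eq_or_lt with h00 | hpos
    · rw [← h00]; exact h0
    intro j hj1 hj2
    have : (𝓝[<] τ).NeBot := nhdsLT_neBot_of_exists_lt ⟨0, hpos⟩
    obtain ⟨L, hL, hLj⟩ := h.left τ hpos hτT
    obtain ⟨L', hL', hLj'⟩ := h'.left τ hpos hτT
    have hLL : ∀ k, a ≤ k → k ≤ b → L k = L' k := by
      intro k hk1 hk2
      obtain ⟨r, ⟨hr1, hr2⟩, hr3 : r < τ⟩ :=
        (((hL k hk1 hk2).and (hL' k hk1 hk2)).and self_mem_nhdsWithin).exists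
      rw [← hr1, ← hr2, hbefore r hr3 k hk1 hk2]
    by_cases hex : ∃ e : ClockIndex, (a ≤ e.1 ∧ e.1 ≤ b) ∧ (a ≤ target e ∧ target e ≤ b) ∧
        RingsAt (n e) τ
    · obtain ⟨e, he1, he2, he3⟩ := hex
      rw [(hLj j hj1 hj2).1 e he1 he2 he3, (hLj' j hj1 hj2).1 e he1 he2 he3]
      -- `move e` is `jump target e` by definition.
      exact jump_congr rfl (hLL _ he1.1 he1.2) (hLL _ he2.1 he2.2) (hLL _ hj1 hj2)
    · have hno : ∀ e : ClockIndex, (a ≤ e.1 ∧ e.1 ≤ b) → (a ≤ target e ∧ target e ≤ b) →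
          ¬ RingsAt (n e) τ := fun e h1 h2 h3 => hex ⟨e, h1, h2, h3⟩
      rw [(hLj j hj1 hj2).2 hno, (hLj' j hj1 hj2).2 hno, hLL j hj1 hj2]
  -- Right-constancy is only available strictly before `T`; if `τ = T` then `s = τ`, where the paths
  -- agree.
  have hτlt : τ < T := by
    refine lt_of_le_of_ne hτT fun hEq => ?_
    have : s = τ := le_antisymm (hEq ▸ hs) hτs
    exact hne (this ▸ hat i hai hib)
  have hev : ∀ᶠ r in 𝓝[>] τ, ∀ j ∈ Finset.Icc a b, S r j = S' r j := by
    rw [Filter.eventually_all_finset]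
    intro j hj
    obtain ⟨hj1, hj2⟩ := Finset.mem_Icc.1 hj
    filter_upwards [h.right τ hτlt j hj1 hj2, h'.right τ hτlt j hj1 hj2] with r h1 h2
    rw [h1, h2, hat j hj1 hj2]
  obtain ⟨u, hu, hu'⟩ := (mem_nhdsGT_iff_exists_Ioo_subset' hτlt).1 hev
  obtain ⟨r, hrA, hru⟩ := exists_lt_of_csInf_lt hAne (show sInf A < u from hu)
  obtain ⟨_, j, hj1, hj2, hj3⟩ := hrA
  have hτr : τ ≤ r := csInf_le hbdd ⟨‹_›, j, hj1, hj2, hj3⟩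
  rcases hτr.lt_or_eq with hlt | heq
  · exact hj3 (hu' ⟨hlt, hru⟩ j (Finset.mem_Icc.2 ⟨hj1, hj2⟩))
  · exact hj3 (heq ▸ hat j hj1 hj2)

/-- Barriers keep each ring on one side, so a ring that is not inside the block touches no site of
the block. -/
lemma IsGraphicalPath.isBlockPath {n : Clocks} (hn : Good n) {S₀ : Labelled} {S : ℝ≥0 → Labelled}
    (h : IsGraphicalPath n S₀ S) {T : ℝ≥0} {a b : ℤ} (ha : Barrier n T (a - 1))
    (hb : Barrier n T b) : IsBlockPath n T a b S where
  right t _ i _ _ := h.right t i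
  left t ht htT := by
    obtain ⟨L, hL, h1, h2⟩ := h.left t ht
    refine ⟨L, fun i _ _ => hL i, fun i hi1 hi2 => ⟨fun e _ _ he => by rw [h1 e he], fun hno => ?_⟩⟩
    by_cases hex : ∃ e, RingsAt (n e) t
    · obtain ⟨e, he⟩ := hex
      have hside := side_of_barriers hn htT ha hb he
      rw [h1 e he]
      refine jump_of_ne (fun hi => ?_) (fun hi => ?_)
      · exact hno e (hi ▸ ⟨hi1, hi2⟩) (hside.1 (hi ▸ ⟨hi1, hi2⟩)) he
      · exact hno e (hside.2 (hi ▸ ⟨hi1, hi2⟩)) (hi ▸ ⟨hi1, hi2⟩) he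
    · rw [h2 fun e he => hex ⟨e, he⟩]

/-! ### The dynamics on a ring of sites -/

/-- The target on the ring of the sites `-K, …, K`. -/
def ringTarget (K : ℕ) (e : ClockIndex) : ℤ :=
  if e = ((K : ℤ), true) then -K else if e = (-(K : ℤ), false) then K else target e

/-- The clocks at the sites `-K, …, K`. -/
noncomputable def ringClocks (K : ℕ) : Finset ClockIndex := Finset.Icc (-(K : ℤ)) K ×ˢ Finset.univ

lemma mem_ringClocks {K : ℕ} {e : ClockIndex} : e ∈ ringClocks K ↔ -(K : ℤ) ≤ e.1 ∧ e.1 ≤ K := by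
  simp [ringClocks]

/-- The process on the ring of the sites `-K, …, K`; the other sites do not change. -/
noncomputable def ringPath (K : ℕ) (n : Clocks) (S₀ : Labelled) (s : ℝ≥0) : Labelled :=
  run (ringTarget K) (ringList (ringClocks K) n s) S₀

lemma ringTarget_eq {K : ℕ} {e : ClockIndex} (h1 : e.1 ≠ K) (h2 : e.1 ≠ -K) :
    ringTarget K e = target e := by
  unfold ringTarget
  rw [if_neg (fun h => h1 (by rw [h])), if_neg (fun h => h2 (by rw [h]))]

/-- Within a block that is smaller than the ring, the ring does not matter. -/
lemma ringTarget_side {K : ℕ} {a b : ℤ} (ha : -(K : ℤ) < a) (hb : b < K) {e : ClockIndex} {j : ℤ}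
    (hj1 : a ≤ j) (hj2 : j ≤ b) (hside : (a ≤ e.1 ∧ e.1 ≤ b) ↔ (a ≤ target e ∧ target e ≤ b))
    (hj : j = e.1 ∨ j = ringTarget K e) :
    (a ≤ e.1 ∧ e.1 ≤ b) ∧ (a ≤ target e ∧ target e ≤ b) := by
  rcases hj with rfl | hj
  · exact ⟨⟨hj1, hj2⟩, hside.1 ⟨hj1, hj2⟩⟩
  · unfold ringTarget at hj
    split_ifs at hj
    · omega
    · omega
    · subst hj; exact ⟨hside.2 ⟨hj1, hj2⟩, ⟨hj1, hj2⟩⟩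

/-- The bond that closes the ring joins `K` to `-K`. Both are outside the block by the strict
bounds, so the ring follows the rules of the line inside it. -/
lemma ringPath_isBlockPath {n : Clocks} (hn : Good n) (S₀ : Labelled) {K : ℕ} {T : ℝ≥0} {a b : ℤ}
    (ha : Barrier n T (a - 1)) (hb : Barrier n T b) (haK : -(K : ℤ) < a) (hbK : b < K) :
    IsBlockPath n T a b (ringPath K n S₀) where
  right t _ i _ _ := by
    filter_upwards [eventually_right_ringList hn (ringClocks K) t] with s hs
    rw [ringPath, hs, ringPath]
  left t ht htT := by
    obtain ⟨l, hl, h1, h2⟩ := exists_left_ringList hn (ringClocks K) ht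
    refine ⟨run (ringTarget K) l S₀, fun i _ _ => ?_, fun i hi1 hi2 => ⟨fun e he1 he2 he => ?_,
      fun hno => ?_⟩⟩
    · filter_upwards [hl] with s hs
      rw [ringPath, hs]
    · rw [ringPath, h1 e (mem_ringClocks.2 (by omega)) he, run_cons]
      exact jump_congr (ringTarget_eq (by omega) (by omega)) rfl rfl rfl
    · by_cases hex : ∃ e ∈ ringClocks K, RingsAt (n e) t
      · obtain ⟨e, heE, he⟩ := hex
        have hside := side_of_barriers hn htT ha hb he
        rw [ringPath, h1 e heE he, run_cons]
        refine jump_of_ne (fun hi => ?_) (fun hi => ?_)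
        · have := ringTarget_side haK hbK hi1 hi2 hside (Or.inl hi)
          exact hno e this.1 this.2 he
        · have := ringTarget_side haK hbK hi1 hi2 hside (Or.inr hi)
          exact hno e this.1 this.2 he
      · rw [ringPath, h2 fun e he1 he2 => hex ⟨e, he1, he2⟩]

lemma ringPath_zero (K : ℕ) (n : Clocks) (S₀ : Labelled) : ringPath K n S₀ 0 = S₀ := by
  rw [ringPath, ringList_zero, run_nil]

/-- By uniqueness in the block, neither the ring size nor the initial state beyond the barriers is
felt between them. -/
lemma ringPath_eq_ringPath {n : Clocks} (hn : Good n) {S₀ S₀' : Labelled} {K K' : ℕ} {T : ℝ≥0}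
    {a b : ℤ} (ha : Barrier n T (a - 1)) (hb : Barrier n T b) (haK : -(K : ℤ) < a) (hbK : b < K)
    (haK' : -(K' : ℤ) < a) (hbK' : b < K') (h0 : ∀ i, a ≤ i → i ≤ b → S₀ i = S₀' i)
    {s : ℝ≥0} (hs : s ≤ T) {i : ℤ} (hai : a ≤ i) (hib : i ≤ b) :
    ringPath K n S₀ s i = ringPath K' n S₀' s i :=
  (ringPath_isBlockPath hn S₀ ha hb haK hbK).unique (ringPath_isBlockPath hn S₀' ha hb haK' hbK')
    (fun i h1 h2 => by rw [ringPath_zero, ringPath_zero, h0 i h1 h2]) hs hai hib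

/-! ### Existence and uniqueness of the graphical construction -/

/-- Any time interval and finite set of sites has a range beyond which ring sizes are irrelevant. -/
lemma exists_ringPath_stable {n : Clocks} (hn : Good n) (T : ℝ≥0) (N : ℕ) :
    ∃ K₀ : ℕ, N < K₀ ∧ ∀ S₀ : Labelled, ∀ K ≥ K₀, ∀ K' ≥ K₀, ∀ s ≤ T, ∀ i : ℤ, |i| ≤ N →
      ringPath K n S₀ s i = ringPath K' n S₀ s i := by
  obtain ⟨a, b, ha, hb, ha', hb'⟩ := exists_block hn T (-N) N
  refine ⟨a.natAbs + b.natAbs + N + 1, by omega, fun S₀ K hK K' hK' s hs i hi => ?_⟩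
  rw [abs_le] at hi
  exact ringPath_eq_ringPath hn ha' hb' (by omega) (by omega) (by omega) (by omega)
    (fun _ _ _ => rfl) hs (by omega) (by omega)

open Classical in
/-- The limit of the processes on growing rings. -/
noncomputable def limitPath (n : Clocks) (S₀ : Labelled) (s : ℝ≥0) (i : ℤ) : Option ℤ :=
  Classical.epsilon fun o => ∀ᶠ K in atTop, ringPath K n S₀ s i = o

lemma limitPath_eq {n : Clocks} {S₀ : Labelled} {s : ℝ≥0} {i : ℤ} {K₀ K : ℕ}
    (h : ∀ K ≥ K₀, ∀ K' ≥ K₀, ringPath K n S₀ s i = ringPath K' n S₀ s i) (hK : K₀ ≤ K) :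
    limitPath n S₀ s i = ringPath K n S₀ s i := by
  have hex : ∃ o, ∀ᶠ K in atTop, ringPath K n S₀ s i = o :=
    ⟨ringPath K n S₀ s i, eventually_atTop.2 ⟨K₀, fun K' hK' => h K' hK' K hK⟩⟩
  have := Classical.epsilon_spec hex
  obtain ⟨K', h1, h2⟩ := (this.and (eventually_ge_atTop K₀)).exists
  rw [limitPath, ← h1]
  exact h K' h2 K hK

/-- At each site the limit over rings is attained for large `K`, uniformly in a bounded time
interval. Each clause of the definition involves only finitely many sites at a time, and so can be
read off a single large ring. -/
lemma limitPath_isGraphicalPath {n : Clocks} (hn : Good n) (S₀ : Labelled) :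
    IsGraphicalPath n S₀ (limitPath n S₀) where
  init := by
    funext i
    rw [limitPath_eq (K₀ := 0) (K := 0) (fun _ _ _ _ => by simp [ringPath_zero]) le_rfl,
      ringPath_zero]
  right t i := by
    obtain ⟨K, _, hK⟩ := exists_ringPath_stable hn (t + 1) i.natAbs
    have h2 : ∀ᶠ s in 𝓝[>] t, s < t + 1 :=
      mem_of_superset (Ioo_mem_nhdsGT (lt_add_one t)) fun s hs => hs.2
    filter_upwards [eventually_right_ringList hn (ringClocks K) t, h2] with s hs hs2
    rw [limitPath_eq (fun K₁ h1 K₂ h2 => hK S₀ K₁ h1 K₂ h2 s hs2.le i (by simp)) le_rfl,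
      limitPath_eq (fun K₁ h1 K₂ h2 => hK S₀ K₁ h1 K₂ h2 t (by simp) i (by simp)) le_rfl,
      ringPath, ringPath, hs]
  left t ht := by
    have : (𝓝[<] t).NeBot := nhdsLT_neBot_of_exists_lt ⟨0, ht⟩
    choose l hl h1 h2 using fun K => exists_left_ringList hn (ringClocks K) ht
    -- One threshold serves all sites in `[-N, N]` and all times up to `t`, so the same ring gives
    -- both the value at `t` and the left limit.
    have key : ∀ N : ℕ, ∃ K₀ : ℕ, N < K₀ ∧ (∀ K ≥ K₀, ∀ i : ℤ, |i| ≤ N →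
        limitPath n S₀ t i = ringPath K n S₀ t i ∧
        ∀ᶠ s in 𝓝[<] t, limitPath n S₀ s i = run (ringTarget K) (l K) S₀ i) := by
      intro N
      obtain ⟨K₀, hN, hK₀⟩ := exists_ringPath_stable hn t N
      refine ⟨K₀, hN, fun K hK i hi => ⟨limitPath_eq (fun K₁ h1 K₂ h2 =>
        hK₀ S₀ K₁ h1 K₂ h2 t le_rfl i hi) hK, ?_⟩⟩
      filter_upwards [hl K, self_mem_nhdsWithin] with s hs hst
      rw [limitPath_eq (fun K₁ h1 K₂ h2 => hK₀ S₀ K₁ h1 K₂ h2 s (le_of_lt hst) i hi) hK, ringPath,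
        hs]
    choose κ hκ1 hκ2 using key
    set L : Labelled := fun i => run (ringTarget (κ i.natAbs)) (l (κ i.natAbs)) S₀ i with hLdef
    have hL : ∀ i, ∀ᶠ s in 𝓝[<] t, limitPath n S₀ s i = L i := fun i =>
      (hκ2 i.natAbs (κ i.natAbs) le_rfl i (by simp)).2
    have hLK : ∀ N : ℕ, ∀ i : ℤ, |i| ≤ N → ∀ K ≥ κ N, run (ringTarget K) (l K) S₀ i = L i := by
      intro N i hi K hK
      obtain ⟨s, hs1, hs2⟩ := ((hL i).and (hκ2 N K hK i hi).2).exists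
      rw [← hs1, ← hs2]
    refine ⟨L, hL, fun e he => funext fun i => ?_, fun hno => funext fun i => ?_⟩
    -- The window contains the site, the ringing clock and its target; since the ring is larger
    -- still, the jump on it is the jump on the line.
    · set N := i.natAbs + e.1.natAbs + (target e).natAbs with hN
      have hκN := hκ1 N
      rw [(hκ2 N (κ N) le_rfl i (by rw [abs_le]; omega)).1, ringPath,
        h1 (κ N) e (mem_ringClocks.2 (by omega)) he, run_cons]
      have hT := ringTarget_eq (K := κ N) (e := e) (by omega) (by omega)
      exact jump_congr hT (hLK N _ (by rw [abs_le]; omega) _ le_rfl)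
        (hLK N _ (by rw [hT, abs_le]; omega) _ le_rfl) (hLK N _ (by rw [abs_le]; omega) _ le_rfl)
    · rw [(hκ2 i.natAbs _ le_rfl i (by simp)).1, ringPath, h2 _ fun e _ => hno e]

/-- Any site lies in a block between barriers up to the time in question, and there every graphical
path is a block path. -/
theorem existsUnique_isGraphicalPath {n : Clocks} (hn : Good n) (S₀ : Labelled) :
    ∃! S, IsGraphicalPath n S₀ S := by
  refine ⟨limitPath n S₀, limitPath_isGraphicalPath hn S₀, fun S hS => ?_⟩
  funext s i
  obtain ⟨a, b, ha, hb, ha', hb'⟩ := exists_block hn s i i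
  refine (hS.isBlockPath hn ha' hb').unique
    ((limitPath_isGraphicalPath hn S₀).isBlockPath hn ha' hb') (fun j _ _ => ?_) le_rfl ha hb
  rw [hS.init, (limitPath_isGraphicalPath hn S₀).init]

lemma path_spec {n : Clocks} (hn : Good n) (η₀ : Config) :
    IsGraphicalPath n (labelled η₀) (path n η₀) :=
  Classical.epsilon_spec (existsUnique_isGraphicalPath hn _).exists

lemma path_eq_ringPath {n : Clocks} (hn : Good n) (η₀ : Config) {K : ℕ} {T : ℝ≥0} {a b : ℤ}
    (ha : Barrier n T (a - 1)) (hb : Barrier n T b) (haK : -(K : ℤ) < a) (hbK : b < K)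
    {s : ℝ≥0} (hs : s ≤ T) {i : ℤ} (hai : a ≤ i) (hib : i ≤ b) :
    path n η₀ s i = ringPath K n (labelled η₀) s i :=
  ((path_spec hn η₀).isBlockPath hn ha hb).unique (ringPath_isBlockPath hn _ ha hb haK hbK)
    (fun i _ _ => by rw [ringPath_zero, (path_spec hn η₀).init]) hs hai hib

/-! ### The dynamics of the occupation variables -/

/-- The effect of a ring of `e` on the occupation variables when its target site is `v e`. -/
def configJump (v : ClockIndex → ℤ) (e : ClockIndex) (η : Config) : Config :=
  if η e.1 = true ∧ η (v e) = false then
    Function.update (Function.update η (v e) true) e.1 false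
  else η

/-- The configuration after the rings of the clocks in the list, the latest ring first. -/
def configRun (v : ClockIndex → ℤ) (l : List ClockIndex) (η : Config) : Config :=
  l.foldr (configJump v) η

@[simp] lemma configRun_nil (v : ClockIndex → ℤ) (η : Config) : configRun v [] η = η := rfl

@[simp] lemma configRun_cons (v : ClockIndex → ℤ) (e : ClockIndex) (l : List ClockIndex)
    (η : Config) : configRun v (e :: l) η = configJump v e (configRun v l η) := rfl

/-- The configuration of the occupied sites. -/
def occupied (S : Labelled) : Config := fun i => (S i).isSome

lemma occupied_labelled (η : Config) : occupied (labelled η) = η := by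
  funext i
  cases h : η i <;> simp [occupied, labelled, h]

/-- A jump only tests whether sites are vacant, so forgetting the labels commutes with it. -/
lemma occupied_jump (v : ClockIndex → ℤ) (e : ClockIndex) (S : Labelled) :
    occupied (jump v e S) = configJump v e (occupied S) := by
  funext i
  unfold occupied jump configJump
  by_cases h : (S e.1).isSome = true ∧ S (v e) = none
  · have h' : (S e.1).isSome = true ∧ (S (v e)).isSome = false := ⟨h.1, by simp [h.2]⟩
    rw [if_pos h, if_pos h']
    simp only [Function.update_apply]
    split_ifs <;> simp_all
  · have h' : ¬ ((S e.1).isSome = true ∧ (S (v e)).isSome = false) := by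
      simpa using h
    rw [if_neg h, if_neg h']

lemma occupied_run (v : ClockIndex → ℤ) (l : List ClockIndex) (S : Labelled) :
    occupied (run v l S) = configRun v l (occupied S) := by
  induction l with
  | nil => rfl
  | cons e l ih => rw [run_cons, configRun_cons, occupied_jump, ih]

/-- The exclusion process on the ring of the sites `-K, …, K`. -/
noncomputable def ringConfig (K : ℕ) (n : Clocks) (η : Config) (s : ℝ≥0) : Config :=
  configRun (ringTarget K) (ringList (ringClocks K) n s) η

lemma occupied_ringPath (K : ℕ) (n : Clocks) (η : Config) (s : ℝ≥0) :
    occupied (ringPath K n (labelled η) s) = ringConfig K n η s := by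
  rw [ringPath, occupied_run, occupied_labelled, ringConfig]

lemma process_eq_ringConfig {n : Clocks} (hn : Good n) (η₀ : Config) {K : ℕ} {T : ℝ≥0} {a b : ℤ}
    (ha : Barrier n T (a - 1)) (hb : Barrier n T b) (haK : -(K : ℤ) < a) (hbK : b < K)
    {s : ℝ≥0} (hs : s ≤ T) {i : ℤ} (hai : a ≤ i) (hib : i ≤ b) :
    process n η₀ s i = ringConfig K n η₀ s i := by
  rw [← occupied_ringPath, occupied, ← path_eq_ringPath hn η₀ ha hb haK hbK hs hai hib, process]

lemma ringConfig_congr {n : Clocks} (hn : Good n) {η ζ : Config} {K : ℕ} {T : ℝ≥0}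
    {a b : ℤ} (ha : Barrier n T (a - 1)) (hb : Barrier n T b) (haK : -(K : ℤ) < a) (hbK : b < K)
    (h0 : ∀ i, a ≤ i → i ≤ b → η i = ζ i)
    {s : ℝ≥0} (hs : s ≤ T) {i : ℤ} (hai : a ≤ i) (hib : i ≤ b) :
    ringConfig K n η s i = ringConfig K n ζ s i := by
  rw [← occupied_ringPath, ← occupied_ringPath, occupied, occupied,
    ringPath_eq_ringPath hn ha hb haK hbK haK hbK (fun i h1 h2 => ?_) hs hai hib]
  simp only [labelled, h0 i h1 h2]

lemma process_zero {n : Clocks} (hn : Good n) (η₀ : Config) : process n η₀ 0 = η₀ := by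
  funext i
  have := congrFun (path_spec hn η₀).init i
  rw [process, this]
  exact congrFun (occupied_labelled η₀) i

/-- A ring clock whose jump is allowed moves within a block between barriers or outside of it. -/
lemma ringList_side {n : Clocks} (hn : Good n) {T : ℝ≥0} {a b : ℤ} {K : ℕ}
    (ha : Barrier n T (a - 1)) (hb : Barrier n T b) (haK : -(K : ℤ) < a) (hbK : b < K)
    {s : ℝ≥0} (hs : s ≤ T) {e : ClockIndex} (he : e ∈ ringList (ringClocks K) n s) :
    e.1 ∈ Set.Icc a b ↔ ringTarget K e ∈ Set.Icc a b := by
  obtain ⟨_, τ, hτ, hr⟩ := ringsAt_of_mem_ringList he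
  have hside := side_of_barriers hn (hτ.trans hs) ha hb hr
  constructor
  · intro h
    rw [ringTarget_eq (by have := h.1; have := h.2; omega) (by have := h.1; have := h.2; omega)]
    exact hside.1 h
  · intro h
    exact (ringTarget_side haK hbK h.1 h.2 hside (Or.inr rfl)).1

lemma not_mem_ringList {n : Clocks} (hn : Good n) {E : Finset ClockIndex} {s : ℝ≥0}
    {e : ClockIndex} (h : n e s = 0) : e ∉ ringList E n s := fun he => by
  obtain ⟨_, τ, hτ, hr⟩ := ringsAt_of_mem_ringList he
  exact not_ringsAt_of_eq_zero hn h hτ hr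

/-! ### Labels -/

/-- An effective jump exchanges an occupied site with a vacant one, hence acts as a transposition of
the sites. The composed permutation preserves every set that each ring in the list respects. It
replaces the tracking of individual particles. -/
lemma exists_perm_run (v : ClockIndex → ℤ) (l : List ClockIndex) (S : Labelled) :
    ∃ π : Equiv.Perm ℤ, (∀ i, run v l S i = S (π i)) ∧
      ∀ B : Set ℤ, (∀ e ∈ l, e.1 ∈ B ↔ v e ∈ B) → ∀ i, π i ∈ B ↔ i ∈ B := by
  induction l with
  | nil => exact ⟨1, fun _ => rfl, fun _ _ _ => Iff.rfl⟩
  | cons e l ih =>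
    obtain ⟨π, h1, h2⟩ := ih
    rw [run_cons]
    by_cases hc : (run v l S e.1).isSome ∧ run v l S (v e) = none
    · refine ⟨(Equiv.swap e.1 (v e)).trans π, fun i => ?_, fun B hB i => ?_⟩
      · rw [jump, if_pos hc, Equiv.trans_apply, ← h1, Equiv.swap_apply_def]
        have hne : e.1 ≠ v e := fun h => by rw [h, hc.2] at hc; simp at hc
        simp only [Function.update_apply]
        split_ifs <;> simp_all
      · rw [Equiv.trans_apply, h2 B fun e' he' => hB e' (List.mem_cons_of_mem _ he')]
        have := hB e List.mem_cons_self
        rw [Equiv.swap_apply_def]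
        split_ifs with h3 h4
        · rw [h3, this]
        · rw [h4, this]
        · rfl
    · refine ⟨π, fun i => ?_, fun B hB => h2 B fun e' he' => hB e' (List.mem_cons_of_mem _ he')⟩
      rw [jump, if_neg hc, h1]

/-- Within a large range, the labelled state is a rearrangement of the initial state that respects
every block between barriers. -/
lemma exists_perm_path {n : Clocks} (hn : Good n) (η₀ : Config) (t : ℝ≥0) (N : ℕ) :
    ∃ π : Equiv.Perm ℤ, (∀ i : ℤ, |i| ≤ N → path n η₀ t i = labelled η₀ (π i)) ∧
      ∀ a b : ℤ, -N ≤ a → b ≤ N → Barrier n t (a - 1) → Barrier n t b →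
        ∀ i, π i ∈ Set.Icc a b ↔ i ∈ Set.Icc a b := by
  obtain ⟨a, b, ha, hb, ha', hb'⟩ := exists_block hn t (-N) N
  set K := a.natAbs + b.natAbs + N + 1 with hK
  obtain ⟨π, h1, h2⟩ := exists_perm_run (ringTarget K) (ringList (ringClocks K) n t) (labelled η₀)
  refine ⟨π, fun i hi => ?_, fun c d hc hd hc' hd' => h2 _ fun e he =>
    ringList_side hn hc' hd' (by omega) (by omega) le_rfl he⟩
  rw [abs_le] at hi
  rw [path_eq_ringPath hn η₀ ha' hb' (K := K) (by omega) (by omega) le_rfl (by omega) (by omega)]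
  exact h1 i

lemma labelled_eq_some {η₀ : Config} {i k : ℤ} :
    labelled η₀ i = some k ↔ η₀ k = true ∧ i = k := by
  unfold labelled
  split_ifs with h
  · rw [Option.some_inj]
    exact ⟨fun hik => ⟨hik ▸ h, hik⟩, fun hik => hik.2⟩
  · simp only [false_iff, not_and]
    rintro h1 rfl
    exact h h1

lemma path_label_mem_block {n : Clocks} (hn : Good n) {η₀ : Config} {t : ℝ≥0} {a b : ℤ}
    (ha : Barrier n t (a - 1)) (hb : Barrier n t b) {i k : ℤ} (h : path n η₀ t i = some k) :
    η₀ k = true ∧ (k ∈ Set.Icc a b ↔ i ∈ Set.Icc a b) := by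
  obtain ⟨π, h1, h2⟩ := exists_perm_path hn η₀ t (i.natAbs + a.natAbs + b.natAbs)
  rw [h1 i (by rw [abs_le]; omega), labelled_eq_some] at h
  refine ⟨h.1, ?_⟩
  rw [← h.2, h2 a b (by omega) (by omega) ha hb i]

lemma path_label_injective {n : Clocks} (hn : Good n) {η₀ : Config} {t : ℝ≥0} {i j k : ℤ}
    (hi : path n η₀ t i = some k) (hj : path n η₀ t j = some k) : i = j := by
  obtain ⟨π, h1, -⟩ := exists_perm_path hn η₀ t (i.natAbs + j.natAbs)
  rw [h1 i (by rw [abs_le]; omega), labelled_eq_some] at hi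
  rw [h1 j (by rw [abs_le]; omega), labelled_eq_some] at hj
  exact π.injective (hi.2.trans hj.2.symm)

lemma exists_path_label {n : Clocks} (hn : Good n) {η₀ : Config} {t : ℝ≥0} {a b : ℤ}
    (ha : Barrier n t (a - 1)) (hb : Barrier n t b) {k : ℤ} (hk : k ∈ Set.Icc a b)
    (h : η₀ k = true) : ∃ i ∈ Set.Icc a b, path n η₀ t i = some k := by
  obtain ⟨π, h1, h2⟩ := exists_perm_path hn η₀ t (a.natAbs + b.natAbs)
  have hmem : π.symm k ∈ Set.Icc a b := by
    rw [← h2 a b (by omega) (by omega) ha hb, Equiv.apply_symm_apply]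
    exact hk
  refine ⟨π.symm k, hmem, ?_⟩
  have := hmem.1
  have := hmem.2
  rw [h1 _ (by rw [abs_le]; omega), labelled_eq_some, Equiv.apply_symm_apply]
  exact ⟨h, rfl⟩

lemma sum_occ_eq_card (η : Config) (I : Finset ℤ) :
    ∑ i ∈ I, occ η i = ((I.filter fun i => η i = true).card : ℝ) := by
  simp only [occ, Finset.sum_boole]

/-- The current through the numbers of particles to the left of a barrier. -/
lemma current_eq {n : Clocks} (hn : Good n) (η₀ : Config) {t : ℝ≥0} {x b : ℤ} (hb : Barrier n t b)
    (hb0 : 0 ≤ b) (hxb : x ≤ b) :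
    (current n η₀ x t : ℝ) =
      ∑ i ∈ Finset.Ioc x b, occ (process n η₀ t) i - ∑ i ∈ Finset.Ioc 0 b, occ η₀ i := by
  classical
  obtain ⟨a', ha'le, ha⟩ := hn.left_barrier t (min 0 x - 1)
  obtain ⟨a, rfl⟩ : ∃ a, a' = a - 1 := ⟨a' + 1, by ring⟩
  have ha0 : a ≤ 0 := by omega
  have hax : a ≤ x := by omega
  obtain ⟨π, h1, h2⟩ := exists_perm_path hn η₀ t (a.natAbs + b.natAbs)
  -- `F` holds the labels that start at or left of `0` and end in `(x, b]`, `G` those from `(0, b]`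
  -- that end in `(x, b]`, and `H` those from `(0, b]` that end at or left of `x`. Then `F + G` is
  -- the final and `G + H` the initial particle number, and the current is `F - H`.
  set F : Finset ℤ := (Finset.Icc a 0).filter fun k => ∃ i ∈ Finset.Ioc x b, path n η₀ t i = some k
  set G : Finset ℤ := (Finset.Icc 1 b).filter fun k => ∃ i ∈ Finset.Ioc x b, path n η₀ t i = some k
  set H : Finset ℤ := (Finset.Icc 1 b).filter fun k => ∃ i ∈ Finset.Icc a x, path n η₀ t i = some k
  have hset1 : {k : ℤ | k ≤ 0 ∧ ∃ i, x + 1 ≤ i ∧ path n η₀ t i = some k} = F := by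
    ext k
    simp only [F, Set.mem_ofPred_eq, Finset.coe_filter, Finset.mem_Icc, Finset.mem_Ioc]
    constructor
    · rintro ⟨hk, i, hi, hp⟩
      have hib : i ≤ b := by
        by_contra hlt
        -- A particle found beyond `b` lies in the block between `b` and a further barrier, so it
        -- started there and not at `k ≤ 0`.
        obtain ⟨d, hd, hd'⟩ := hn.right_barrier t i
        have := (path_label_mem_block hn (a := b + 1) (by simpa using hb) hd' hp).2.2
          ⟨by omega, hd⟩
        have := this.1
        omega
      have := (path_label_mem_block hn ha hb hp).2.2 ⟨by omega, hib⟩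
      exact ⟨⟨this.1, hk⟩, i, ⟨by omega, hib⟩, hp⟩
    · rintro ⟨⟨_, hk⟩, i, hi, hp⟩
      exact ⟨hk, i, by omega, hp⟩
  have hset2 : {k : ℤ | 1 ≤ k ∧ ∃ i, i ≤ x ∧ path n η₀ t i = some k} = H := by
    ext k
    simp only [H, Set.mem_ofPred_eq, Finset.coe_filter, Finset.mem_Icc]
    constructor
    · rintro ⟨hk, i, hi, hp⟩
      have hai : a ≤ i := by
        by_contra hlt
        obtain ⟨d, hd, hd'⟩ := hn.left_barrier t (i - 1)
        have := (path_label_mem_block hn (a := d + 1) (by simpa using hd') ha hp).2.2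
          ⟨by omega, by omega⟩
        have := this.2
        omega
      have := (path_label_mem_block hn ha hb hp).2.2 ⟨hai, by omega⟩
      exact ⟨⟨hk, this.2⟩, i, ⟨hai, hi⟩, hp⟩
    · rintro ⟨⟨hk, _⟩, i, hi, hp⟩
      exact ⟨hk, i, hi.2, hp⟩
  have hcard1 : (F.card + G.card : ℤ) = ((Finset.Ioc x b).filter
      fun i => process n η₀ t i = true).card := by
    have hdis : Disjoint F G := by
      rw [Finset.disjoint_left]
      intro k hk hk'
      simp only [F, G, Finset.mem_filter, Finset.mem_Icc] at hk hk'
      omega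
    rw [← Nat.cast_add, ← Finset.card_union_of_disjoint hdis, Nat.cast_inj]
    symm
    -- Occupied sites are matched with the labels found on them; the default `0` is never used.
    refine Finset.card_bij (fun i _ => (path n η₀ t i).getD 0) ?_ ?_ ?_
    · intro i hi
      simp only [Finset.mem_filter, process, Option.isSome_iff_exists] at hi
      obtain ⟨hi, k, hk⟩ := hi
      have hi' := Finset.mem_Ioc.1 hi
      have := (path_label_mem_block hn ha hb hk).2.2 ⟨by omega, hi'.2⟩
      have h3 := this.1
      have h4 := this.2
      simp only [hk, Option.getD_some, Finset.mem_union, F, G, Finset.mem_filter, Finset.mem_Icc]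
      rcases le_or_gt k 0 with h | h
      · exact Or.inl ⟨⟨h3, h⟩, i, hi, hk⟩
      · exact Or.inr ⟨⟨h, h4⟩, i, hi, hk⟩
    · intro i hi j hj hij
      simp only [Finset.mem_filter, process, Option.isSome_iff_exists] at hi hj
      obtain ⟨hi, k, hk⟩ := hi
      obtain ⟨hj, k', hk'⟩ := hj
      simp only [hk, hk', Option.getD_some] at hij
      subst hij
      exact path_label_injective hn hk hk'
    · intro k hk
      simp only [Finset.mem_union, F, G, Finset.mem_filter] at hk
      obtain ⟨i, hi, hp⟩ : ∃ i ∈ Finset.Ioc x b, path n η₀ t i = some k := by tauto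
      exact ⟨i, Finset.mem_filter.2 ⟨hi, by simp [process, hp]⟩, by simp [hp]⟩
  have hcard2 : (G.card + H.card : ℤ) = ((Finset.Ioc 0 b).filter fun i => η₀ i = true).card := by
    have hdis : Disjoint G H := by
      rw [Finset.disjoint_left]
      intro k hk hk'
      simp only [G, H, Finset.mem_filter, Finset.mem_Ioc, Finset.mem_Icc] at hk hk'
      obtain ⟨_, i, hi, hp⟩ := hk
      obtain ⟨_, j, hj, hp'⟩ := hk'
      have := path_label_injective hn hp hp'
      omega
    rw [← Nat.cast_add, ← Finset.card_union_of_disjoint hdis, Nat.cast_inj]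
    congr 1
    ext k
    simp only [G, H, Finset.mem_union, Finset.mem_filter, Finset.mem_Ioc, Finset.mem_Icc]
    constructor
    · rintro (⟨hk, i, hi, hp⟩ | ⟨hk, i, hi, hp⟩)
      · exact ⟨by omega, (path_label_mem_block hn ha hb hp).1⟩
      · exact ⟨by omega, (path_label_mem_block hn ha hb hp).1⟩
    · rintro ⟨hk, hη⟩
      obtain ⟨i, hi, hp⟩ := exists_path_label hn ha hb (k := k) ⟨by omega, by omega⟩ hη
      rcases le_or_gt i x with h | h
      · exact Or.inr ⟨by omega, i, ⟨hi.1, h⟩, hp⟩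
      · exact Or.inl ⟨by omega, i, ⟨h, hi.2⟩, hp⟩
  rw [current, hset1, hset2, Set.ncard_coe_finset, Set.ncard_coe_finset, sum_occ_eq_card,
    sum_occ_eq_card]
  have h5 : (F.card - H.card : ℤ) = ((Finset.Ioc x b).filter
      fun i => process n η₀ t i = true).card - ((Finset.Ioc 0 b).filter
      fun i => η₀ i = true).card := by omega
  exact_mod_cast congrArg (Int.cast : ℤ → ℝ) h5

/-! ### Crossings of the bond between `0` and `1` -/

/-- The product `occ η e.1 * (1 - occ η (v e))` is the indicator that the jump takes place; it
vanishes when a clock points at its own site, so that case needs no exception. -/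
lemma occ_configJump (v : ClockIndex → ℤ) (e : ClockIndex) (η : Config) (i : ℤ) :
    occ (configJump v e η) i = occ η i + occ η e.1 * (1 - occ η (v e)) *
      ((if i = v e then 1 else 0) - (if i = e.1 then 1 else 0)) := by
  unfold configJump
  by_cases h : η e.1 = true ∧ η (v e) = false
  · have hne : e.1 ≠ v e := fun hc => by rw [hc] at h; simp [h.2] at h
    rw [if_pos h]
    simp only [occ, Function.update_apply]
    split_ifs <;> simp_all
  · rw [if_neg h]
    have : occ η e.1 * (1 - occ η (v e)) = 0 := by
      simp only [occ]
      cases h1 : η e.1 <;> cases h2 : η (v e) <;> simp_all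
    rw [this]; ring

lemma sum_occ_configJump (v : ClockIndex → ℤ) (e : ClockIndex) (η : Config) (I : Finset ℤ) :
    ∑ i ∈ I, occ (configJump v e η) i = ∑ i ∈ I, occ η i + occ η e.1 * (1 - occ η (v e)) *
      ((if v e ∈ I then 1 else 0) - (if e.1 ∈ I then 1 else 0)) := by
  simp only [occ_configJump, Finset.sum_add_distrib, ← Finset.mul_sum, Finset.sum_sub_distrib,
    Finset.sum_ite_eq']

/-- The signed number of particles that cross from `0` to `1` when the clock `e` rings. -/
noncomputable def crossing (e : ClockIndex) (η : Config) : ℝ :=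
  if e = (0, true) then occ η 0 * (1 - occ η 1)
  else if e = (1, false) then -(occ η 1 * (1 - occ η 0)) else 0

/-- The signed number of particles that cross from `0` to `1` while the clocks in the list ring. -/
noncomputable def crossings (v : ClockIndex → ℤ) : List ClockIndex → Config → ℝ
  | [], _ => 0
  | e :: l, η => crossing e (configRun v l η) + crossings v l η

/-- The particle number in `(0, b]` changes only through jumps across its boundary. The bond `b|b +
1` is silent and the bond that closes the ring has both ends outside, which leaves the bond `0|1`.
-/
lemma crossings_eq {K : ℕ} {b : ℤ} (hb0 : 0 ≤ b) (hbK : b < K) (l : List ClockIndex)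
    (hl : ∀ e ∈ l, e ≠ (b, true) ∧ e ≠ (b + 1, false)) (η : Config) :
    crossings (ringTarget K) l η =
      ∑ i ∈ Finset.Ioc 0 b, occ (configRun (ringTarget K) l η) i - ∑ i ∈ Finset.Ioc 0 b, occ η i := by
  induction l with
  | nil => simp [crossings]
  | cons e l ih =>
    rw [crossings, ih fun e' he' => hl e' (List.mem_cons_of_mem _ he'), configRun_cons,
      sum_occ_configJump]
    set ξ := configRun (ringTarget K) l η
    have key : crossing e ξ = occ ξ e.1 * (1 - occ ξ (ringTarget K e)) *
        ((if ringTarget K e ∈ Finset.Ioc 0 b then 1 else 0) -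
          (if e.1 ∈ Finset.Ioc 0 b then 1 else 0)) := by
      obtain ⟨h1, h2⟩ := hl e List.mem_cons_self
      obtain ⟨i, d⟩ := e
      by_cases h3 : (i, d) = ((K : ℤ), true)
      · obtain ⟨rfl, rfl⟩ := Prod.mk.inj h3
        have : ((K : ℤ), true) ≠ (0, true) := fun h => by
          have := (Prod.mk.inj h).1; omega
        rw [crossing, if_neg this, if_neg (by simp), ringTarget, if_pos rfl, if_neg (by simp),
          if_neg (by rw [Finset.mem_Ioc]; omega)]
        ring
      by_cases h4 : (i, d) = (-(K : ℤ), false)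
      · obtain ⟨rfl, rfl⟩ := Prod.mk.inj h4
        have : (-(K : ℤ), false) ≠ (1, false) := fun h => by
          have := (Prod.mk.inj h).1; omega
        rw [crossing, if_neg (by simp), if_neg this, ringTarget, if_neg h3, if_pos rfl,
          if_neg (by rw [Finset.mem_Ioc]; omega), if_neg (by rw [Finset.mem_Ioc]; omega)]
        ring
      rw [ringTarget, if_neg h3, if_neg h4, crossing]
      cases d
      · simp only [target, Prod.mk.injEq, Bool.false_eq_true, and_false, if_false, and_true,
          Finset.mem_Ioc, ne_eq] at h1 h2 ⊢
        by_cases hi : i = 1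
        · subst hi
          have : (1 : ℤ) ≤ b := by omega
          simp [this]
        · rw [if_neg hi]
          by_cases hc : 0 < i ∧ i ≤ b
          · rw [if_pos hc, if_pos (by omega)]; ring
          · rw [if_neg hc, if_neg (by omega)]; ring
      · simp only [target, Prod.mk.injEq, Bool.true_eq_false, and_false, if_false, and_true,
          Finset.mem_Ioc, ne_eq, if_true] at h1 h2 ⊢
        by_cases hi : i = 0
        · subst hi
          have : (1 : ℤ) ≤ b := by omega
          simp [this]
        · rw [if_neg hi]
          by_cases hc : 0 < i ∧ i ≤ b
          · rw [if_pos hc, if_pos (by omega)]; ring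
          · rw [if_neg hc, if_neg (by omega)]; ring
    rw [key]; ring

/-- The number of particles on the ring is conserved. -/
lemma sum_occ_configRun {K : ℕ} (l : List ClockIndex) (hl : ∀ e ∈ l, e ∈ ringClocks K)
    (η : Config) : ∑ i ∈ Finset.Icc (-(K : ℤ)) K, occ (configRun (ringTarget K) l η) i =
      ∑ i ∈ Finset.Icc (-(K : ℤ)) K, occ η i := by
  induction l with
  | nil => simp
  | cons e l ih =>
    have he := mem_ringClocks.1 (hl e List.mem_cons_self)
    have ht : ringTarget K e ∈ Finset.Icc (-(K : ℤ)) K := by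
      obtain ⟨i, d⟩ := e
      rw [ringTarget, Finset.mem_Icc]
      split_ifs with h1 h2
      · omega
      · omega
      · cases d <;> simp [target] at * <;> omega
    rw [configRun_cons, sum_occ_configJump, if_pos ht, if_pos (Finset.mem_Icc.2 he),
      ih fun e' he' => hl e' (List.mem_cons_of_mem _ he')]
    ring

/-- The signed number of crossings from `0` to `1` on the ring of the sites `-K, …, K`. -/
noncomputable def ringCurrent (K : ℕ) (n : Clocks) (η : Config) (t : ℝ≥0) : ℝ :=
  crossings (ringTarget K) (ringList (ringClocks K) n t) η

lemma ringCurrent_eq {n : Clocks} (hn : Good n) (η : Config) {t : ℝ≥0} {b : ℤ} {K : ℕ}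
    (hb : Barrier n t b) (hb0 : 0 ≤ b) (hbK : b < K) :
    ringCurrent K n η t =
      ∑ i ∈ Finset.Ioc 0 b, occ (ringConfig K n η t) i - ∑ i ∈ Finset.Ioc 0 b, occ η i :=
  crossings_eq hb0 hbK _ (fun _ he => ⟨fun h => not_mem_ringList hn hb.1 (h ▸ he),
    fun h => not_mem_ringList hn hb.2 (h ▸ he)⟩) η

/-- The current of the ring agrees with the current of the process on large rings. -/
lemma ringCurrent_eq_current {n : Clocks} (hn : Good n) (t : ℝ≥0) :
    ∃ K₀ : ℕ, ∀ K ≥ K₀, ∀ η, ringCurrent K n η t = current n η 0 t := by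
  obtain ⟨a, b, ha, hb, ha', hb'⟩ := exists_block hn t 0 0
  refine ⟨a.natAbs + b.natAbs + 1, fun K hK η => ?_⟩
  rw [ringCurrent_eq hn η hb' hb (by omega), current_eq hn η hb' hb hb]
  congr 1
  refine Finset.sum_congr rfl fun i hi => ?_
  have hi := Finset.mem_Ioc.1 hi
  simp only [occ]
  rw [process_eq_ringConfig hn η ha' hb' (K := K) (by omega) (by omega) le_rfl (by omega) hi.2]

/-- The current of the ring does not depend on the initial state beyond barriers. -/
lemma ringCurrent_congr {n : Clocks} (hn : Good n) {η ζ : Config} {K : ℕ} {t : ℝ≥0}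
    {a b : ℤ} (ha : Barrier n t (a - 1)) (hb : Barrier n t b) (ha1 : a ≤ 1) (hb0 : 0 ≤ b)
    (haK : -(K : ℤ) < a) (hbK : b < K) (h0 : ∀ i, a ≤ i → i ≤ b → η i = ζ i) :
    ringCurrent K n η t = ringCurrent K n ζ t := by
  rw [ringCurrent_eq hn η hb hb0 hbK, ringCurrent_eq hn ζ hb hb0 hbK]
  refine congrArg₂ _ (Finset.sum_congr rfl fun i hi => ?_) (Finset.sum_congr rfl fun i hi => ?_)
  · have hi := Finset.mem_Ioc.1 hi
    simp only [occ]
    rw [ringConfig_congr hn ha hb haK hbK h0 le_rfl (by omega) hi.2]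
  · have hi := Finset.mem_Ioc.1 hi
    simp only [occ]
    rw [h0 i (by omega) hi.2]

/-! ### The second class particle -/

lemma IsAddParticle.ne_iff {η ζ : Config} {j : ℤ} (h : IsAddParticle η ζ j) (i : ℤ) :
    η i ≠ ζ i ↔ i = j := by
  obtain ⟨h1, rfl⟩ := h
  by_cases hi : i = j
  · subst hi; simp [h1]
  · simp [hi]

lemma IsAddParticle.occ_sub {η ζ : Config} {j : ℤ} (h : IsAddParticle η ζ j) (i : ℤ) :
    occ ζ i - occ η i = if j = i then 1 else 0 := by
  obtain ⟨h1, rfl⟩ := h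
  by_cases hi : j = i
  · subst hi; simp [occ, h1]
  · simp [occ, hi, Ne.symm hi]

/-- The coupling never creates or destroys a discrepancy: a ring whose bond does not touch the
discrepancy acts identically on both configurations, and one that does can only carry it to the
other end. -/
lemma isAddParticle_configJump (v : ClockIndex → ℤ) (e : ClockIndex) {η ζ : Config} {j : ℤ}
    (h : IsAddParticle η ζ j) : ∃ j', IsAddParticle (configJump v e η) (configJump v e ζ) j' ∧
      (j' = j ∨ (j = e.1 ∧ j' = v e) ∨ (j = v e ∧ j' = e.1)) := by
  obtain ⟨h1, rfl⟩ := h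
  -- On the ring with a single site a clock points at its own site.
  by_cases he : e.1 = v e
  · refine ⟨j, ?_, Or.inl rfl⟩
    unfold configJump
    rw [he, if_neg (by simp), if_neg (by simp)]
    exact ⟨h1, rfl⟩
  by_cases hj : j = e.1
  -- Only the larger configuration has a particle at the source; it jumps, taking the discrepancy
  -- with it, exactly if the target is vacant.
  · subst hj
    have hη : configJump v e η = η := by simp [configJump, h1]
    rw [hη]
    unfold configJump
    rw [Function.update_self, Function.update_of_ne (Ne.symm he)]
    by_cases hv : η (v e) = false
    · refine ⟨v e, ⟨hv, funext fun i => ?_⟩, Or.inr (Or.inl ⟨rfl, rfl⟩)⟩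
      rw [if_pos ⟨rfl, hv⟩]
      by_cases hi : i = e.1
      · rw [hi, Function.update_self, Function.update_of_ne he, h1]
      · simp only [Function.update_apply, hi, if_false]
    · refine ⟨e.1, ?_, Or.inl rfl⟩
      rw [if_neg fun h => hv h.2]
      exact ⟨h1, rfl⟩
  by_cases hj' : j = v e
  -- In the larger configuration the target is blocked. If the source is occupied, only the smaller
  -- configuration moves, and the discrepancy goes to the source.
  · subst hj'
    have hζ : configJump v e (Function.update η (v e) true) = Function.update η (v e) true := by
      simp [configJump]
    rw [hζ]
    by_cases hv : η e.1 = true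
    · refine ⟨e.1, ⟨by simp [configJump, h1, hv], funext fun i => ?_⟩, Or.inr (Or.inr ⟨rfl, rfl⟩)⟩
      rw [configJump, if_pos ⟨hv, h1⟩]
      by_cases hi : i = e.1
      · rw [hi, Function.update_of_ne he, Function.update_self, hv]
      · rw [Function.update_of_ne hi, Function.update_of_ne hi]
    · refine ⟨v e, ?_, Or.inl rfl⟩
      rw [configJump, if_neg fun h => hv h.1]
      exact ⟨h1, rfl⟩
  · refine ⟨j, ?_, Or.inl rfl⟩
    unfold configJump
    rw [Function.update_of_ne (Ne.symm hj), Function.update_of_ne (Ne.symm hj')]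
    split_ifs
    · refine ⟨by rw [Function.update_of_ne hj, Function.update_of_ne hj', h1], ?_⟩
      rw [Function.update_comm hj', Function.update_comm hj]
    · exact ⟨h1, rfl⟩

lemma isAddParticle_configRun (v : ClockIndex → ℤ) (l : List ClockIndex) {η ζ : Config} {j : ℤ}
    (h : IsAddParticle η ζ j) : ∃ j', IsAddParticle (configRun v l η) (configRun v l ζ) j' ∧
      ∀ B : Set ℤ, (∀ e ∈ l, e.1 ∈ B ↔ v e ∈ B) → j ∈ B → j' ∈ B := by
  induction l with
  | nil => exact ⟨j, h, fun _ _ hj => hj⟩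
  | cons e l ih =>
    obtain ⟨j₁, h1, h2⟩ := ih
    obtain ⟨j₂, h3, h4⟩ := isAddParticle_configJump v e h1
    refine ⟨j₂, h3, fun B hB hj => ?_⟩
    have hj₁ := h2 B (fun e' he' => hB e' (List.mem_cons_of_mem _ he')) hj
    have := hB e List.mem_cons_self
    rcases h4 with h | ⟨h, h'⟩ | ⟨h, h'⟩
    · rwa [h]
    · rw [h', ← this, ← h]; exact hj₁
    · rw [h', this, ← h]; exact hj₁

/-- On every large ring there is exactly one discrepancy, and it cannot leave the block around the
origin. Its position has to be shown not to depend on the ring; then any site of the line can be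
compared with a suitable ring. -/
lemma exists_isAddParticle_process {n : Clocks} (hn : Good n) {η₀ : Config} (h0 : η₀ 0 = false)
    (s : ℝ≥0) : ∃ j, IsAddParticle (process n η₀ s) (process n (plus η₀) s) j := by
  have hadd : IsAddParticle η₀ (plus η₀) 0 := ⟨h0, rfl⟩
  obtain ⟨a, b, ha, hb, ha', hb'⟩ := exists_block hn s 0 0
  have key : ∀ i : ℤ, ∃ K : ℕ, a.natAbs + b.natAbs < K ∧
      process n η₀ s i = ringConfig K n η₀ s i ∧
      process n (plus η₀) s i = ringConfig K n (plus η₀) s i := by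
    intro i
    obtain ⟨c, d, hc, hd, hc', hd'⟩ := exists_block hn s i i
    refine ⟨a.natAbs + b.natAbs + c.natAbs + d.natAbs + 1, by omega, ?_, ?_⟩ <;>
    exact process_eq_ringConfig hn _ hc' hd' (by omega) (by omega) le_rfl hc hd
  have hK : ∀ K : ℕ, a.natAbs + b.natAbs < K → ∃ j, j ∈ Set.Icc a b ∧
      IsAddParticle (ringConfig K n η₀ s) (ringConfig K n (plus η₀) s) j := by
    intro K hK
    obtain ⟨j, h1, h2⟩ := isAddParticle_configRun (ringTarget K) (ringList (ringClocks K) n s) hadd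
    exact ⟨j, h2 (Set.Icc a b) (fun e he => ringList_side hn ha' hb' (by omega) (by omega) le_rfl he)
      ⟨ha, hb⟩, h1⟩
  obtain ⟨j, hj, hadj⟩ := hK (a.natAbs + b.natAbs + 1) (by omega)
  -- Inside the block all large rings coincide with the line, so a discrepancy at `j` on one of them
  -- is a discrepancy at `j` on all.
  have hjK : ∀ K : ℕ, a.natAbs + b.natAbs < K →
      IsAddParticle (ringConfig K n η₀ s) (ringConfig K n (plus η₀) s) j := by
    intro K hK'
    obtain ⟨j', hj', hadj'⟩ := hK K hK'
    have := (hadj.ne_iff j).2 rfl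
    rw [← process_eq_ringConfig hn _ ha' hb' (by omega) (by omega) le_rfl hj.1 hj.2,
      ← process_eq_ringConfig hn _ ha' hb' (by omega) (by omega) le_rfl hj.1 hj.2,
      process_eq_ringConfig hn _ ha' hb' (K := K) (by omega) (by omega) le_rfl hj.1 hj.2,
      process_eq_ringConfig hn _ ha' hb' (K := K) (by omega) (by omega) le_rfl hj.1 hj.2,
      hadj'.ne_iff] at this
    exact this ▸ hadj'
  refine ⟨j, ?_, funext fun i => ?_⟩
  · obtain ⟨K, hK1, hK2, -⟩ := key j
    rw [hK2]
    exact (hjK K hK1).1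
  · obtain ⟨K, hK1, hK2, hK3⟩ := key i
    rw [hK3, congrFun (hjK K hK1).2 i, Function.update_apply, Function.update_apply, hK2]

lemma isAddParticle_secondClass {n : Clocks} (hn : Good n) {η₀ : Config} (h0 : η₀ 0 = false)
    (s : ℝ≥0) : IsAddParticle (process n η₀ s) (process n (plus η₀) s) (secondClass n η₀ s) :=
  Classical.epsilon_spec (exists_isAddParticle_process hn h0 s)

/-! ### Discretization of time -/

/-- Between two times with different counts there is a ring. -/
lemma exists_ringsAt {n : Clocks} (hn : Good n) {e : ClockIndex} {s s' : ℝ≥0}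
    (h : n e s < n e s') : ∃ τ, s < τ ∧ τ ≤ s' ∧ RingsAt (n e) τ := by
  set A : Set ℝ≥0 := {u | n e s' ≤ n e u} with hA
  have hne : A.Nonempty := ⟨s', le_refl (n e s')⟩
  have hbdd : BddBelow A := ⟨0, fun _ _ => zero_le⟩
  set τ := sInf A with hτ
  -- The infimum is attained because the count is right-continuous.
  have hτA : n e s' ≤ n e τ := by
    by_contra hlt
    obtain ⟨u, hu, hu'⟩ := (mem_nhdsGT_iff_exists_Ioo_subset' (lt_add_one τ)).1
      (hn.right_cont e τ)
    obtain ⟨r, hrA, hru⟩ := exists_lt_of_csInf_lt hne (show sInf A < u from hu)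
    rcases (csInf_le hbdd hrA).lt_or_eq with h1 | h1
    · have : n e r = n e τ := hu' ⟨h1, hru⟩
      exact hlt (this ▸ hrA)
    · exact hlt ((show τ = r from h1) ▸ hrA)
  have hsτ : s < τ := by
    by_contra hle
    have h1 := hn.mono e (not_lt.1 hle)
    omega
  refine ⟨τ, hsτ, csInf_le hbdd (le_refl (n e s')), zero_le.trans_lt hsτ, fun u hu => ?_⟩
  have : ¬ n e s' ≤ n e u := fun hc => absurd (csInf_le hbdd hc) (not_le.2 hu)
  omega

lemma lt_of_ringsAt {n : Clocks} (hn : Good n) {e : ClockIndex} {s s' τ : ℝ≥0} (h1 : s < τ)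
    (h2 : τ ≤ s') (hr : RingsAt (n e) τ) : n e s < n e s' :=
  (hr.2 s h1).trans_le (hn.mono e h2)

/-- Among the counts `f` of the clocks of `E`, only that of `e` is positive. -/
def Only (E : Finset ClockIndex) (f : ClockIndex → ℕ) (e : ClockIndex) : Prop :=
  e ∈ E ∧ 0 < f e ∧ ∀ e' ∈ E, e' ≠ e → f e' = 0

lemma Only.unique {E : Finset ClockIndex} {f : ClockIndex → ℕ} {e e' : ClockIndex}
    (h : Only E f e) (h' : Only E f e') : e = e' := by
  by_contra hne
  have := h'.2.2 e h.1 hne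
  have := h.2.1
  omega

open Classical in
/-- The only clock of `E` with a positive count, if there is exactly one. -/
noncomputable def onlyClock (E : Finset ClockIndex) (f : ClockIndex → ℕ) : Option ClockIndex :=
  if h : ∃ e, Only E f e then some h.choose else none

lemma onlyClock_eq_some {E : Finset ClockIndex} {f : ClockIndex → ℕ} {e : ClockIndex} :
    onlyClock E f = some e ↔ Only E f e := by
  unfold onlyClock
  split_ifs with h
  · rw [Option.some_inj]
    exact ⟨fun he => he ▸ h.choose_spec, fun he => h.choose_spec.unique he⟩
  · simp only [false_iff]
    exact fun he => h ⟨e, he⟩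

lemma onlyClock_eq_none {E : Finset ClockIndex} {f : ClockIndex → ℕ} :
    onlyClock E f = none ↔ ∀ e, ¬ Only E f e := by
  unfold onlyClock
  split_ifs with h
  · exact iff_of_false (by simp) fun hno => h.elim hno
  · exact iff_of_true rfl (not_exists.1 h)

lemma onlyClock_congr {E : Finset ClockIndex} {f g : ClockIndex → ℕ} (h : ∀ e ∈ E, f e = g e) :
    onlyClock E f = onlyClock E g := by
  have : ∀ e, Only E f e ↔ Only E g e := fun e => by
    unfold Only
    constructor
    · rintro ⟨h1, h2, h3⟩
      exact ⟨h1, h e h1 ▸ h2, fun e' he' hne => h e' he' ▸ h3 e' he' hne⟩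
    · rintro ⟨h1, h2, h3⟩
      exact ⟨h1, (h e h1).symm ▸ h2, fun e' he' hne => (h e' he').symm ▸ h3 e' he' hne⟩
  exact Option.ext fun e => by rw [onlyClock_eq_some, onlyClock_eq_some, this]

/-- The list of the clocks that ring alone in one of the first time intervals, the latest first;
`d e k` is the number of rings of `e` in the `k`th interval. -/
noncomputable def gridList (E : Finset ClockIndex) (d : ClockIndex → ℕ → ℕ) :
    ℕ → List ClockIndex
  | 0 => []
  | k + 1 => (onlyClock E fun e => d e k).toList ++ gridList E d k

lemma gridList_congr {E : Finset ClockIndex} {d d' : ClockIndex → ℕ → ℕ} {k : ℕ}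
    (h : ∀ e ∈ E, ∀ j < k, d e j = d' e j) : gridList E d k = gridList E d' k := by
  induction k with
  | zero => rfl
  | succ k ih =>
    rw [gridList, gridList, ih fun e he j hj => h e he j (by omega),
      onlyClock_congr fun e he => h e he k (by omega)]

lemma mem_of_mem_gridList {E : Finset ClockIndex} {d : ClockIndex → ℕ → ℕ} {k : ℕ}
    {e : ClockIndex} (he : e ∈ gridList E d k) : e ∈ E := by
  induction k with
  | zero => simp [gridList] at he
  | succ k ih =>
    rw [gridList, List.mem_append] at he
    rcases he with he | he
    · rw [Option.mem_toList, onlyClock_eq_some] at he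
      exact he.1
    · exact ih he

/-- The points that divide `[0, t]` into `m` intervals. -/
noncomputable def grid (t : ℝ≥0) (m k : ℕ) : ℝ≥0 := t * k / m

/-- The numbers of rings in the intervals of the grid. -/
noncomputable def increment (n : Clocks) (t : ℝ≥0) (m : ℕ) (e : ClockIndex) (k : ℕ) : ℕ :=
  n e (grid t m (k + 1)) - n e (grid t m k)

lemma grid_mono (t : ℝ≥0) (m : ℕ) : Monotone (grid t m) := fun i j h => by
  unfold grid; gcongr

lemma grid_self (t : ℝ≥0) {m : ℕ} (hm : m ≠ 0) : grid t m m = t := by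
  unfold grid
  exact mul_div_cancel_right₀ t (Nat.cast_ne_zero.2 hm)

lemma grid_zero (t : ℝ≥0) (m : ℕ) : grid t m 0 = 0 := by simp [grid]

lemma coe_grid_succ (t : ℝ≥0) (m k : ℕ) : (grid t m (k + 1) : ℝ) = grid t m k + t / m := by
  simp only [grid]; push_cast; ring

lemma increment_pos_iff {n : Clocks} (hn : Good n) {t : ℝ≥0} {m k : ℕ} {e : ClockIndex} :
    0 < increment n t m e k ↔
      ∃ τ, grid t m k < τ ∧ τ ≤ grid t m (k + 1) ∧ RingsAt (n e) τ := by
  rw [increment, Nat.sub_pos_iff_lt]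
  exact ⟨exists_ringsAt hn, fun ⟨τ, h1, h2, h3⟩ => lt_of_ringsAt hn h1 h2 h3⟩

/-- On a fine grid the rings are recovered from the increments. -/
lemma eventually_gridList_eq {n : Clocks} (hn : Good n) (E : Finset ClockIndex) (t : ℝ≥0) :
    ∀ᶠ m in atTop, gridList E (increment n t m) m = ringList E n t := by
  have hf := ringTimes_finite hn E t
  have hlim : Tendsto (fun m : ℕ => (t : ℝ) / m) atTop (𝓝 0) := tendsto_const_div_atTop_nhds_zero_nat _
  -- Eventually the mesh is smaller than all gaps between ring times, so no interval contains two of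
  -- them.
  have hev : ∀ᶠ m : ℕ in atTop, ∀ x ∈ ringTimes E n t, ∀ y ∈ ringTimes E n t, x < y →
      (t : ℝ) / m < (y : ℝ) - x := by
    rw [Filter.eventually_all_finite hf]
    intro x _
    rw [Filter.eventually_all_finite hf]
    intro y _
    by_cases hxy : x < y
    · filter_upwards [hlim.eventually (gt_mem_nhds (sub_pos.2 (NNReal.coe_lt_coe.2 hxy)))] with m hm _
      exact hm
    · exact Eventually.of_forall fun m h => absurd h hxy
  filter_upwards [hev, eventually_ge_atTop 1] with m hm hm1
  have key : ∀ k ≤ m, gridList E (increment n t m) k = ringList E n (grid t m k) := by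
    intro k
    induction k with
    | zero => intro _; rw [grid_zero, ringList_zero, gridList]
    | succ k ih =>
      intro hk
      have hgt : grid t m (k + 1) ≤ t := by
        have := grid_mono t m hk
        rwa [grid_self t (by omega)] at this
      have hone : ∀ τ τ', grid t m k < τ → τ ≤ grid t m (k + 1) → grid t m k < τ' →
          τ' ≤ grid t m (k + 1) → ∀ e ∈ E, ∀ e' ∈ E, RingsAt (n e) τ → RingsAt (n e') τ' →
          τ' ≤ τ := by
        intro τ τ' h1 h2 h3 h4 e he e' he' hr hr'
        by_contra hlt
        have := hm τ ⟨h2.trans hgt, e, he, hr⟩ τ' ⟨h4.trans hgt, e', he', hr'⟩ (not_le.1 hlt)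
        have h5 : (τ' : ℝ) ≤ grid t m (k + 1) := NNReal.coe_le_coe.2 h4
        have h6 : (grid t m k : ℝ) < τ := NNReal.coe_lt_coe.2 h1
        rw [coe_grid_succ] at h5
        linarith
      rw [gridList, ih (by omega)]
      by_cases hex : ∃ e ∈ E, ∃ τ, grid t m k < τ ∧ τ ≤ grid t m (k + 1) ∧ RingsAt (n e) τ
      · obtain ⟨e, he, τ, h1, h2, hr⟩ := hex
        have honly : Only E (fun e => increment n t m e k) e := by
          refine ⟨he, (increment_pos_iff hn).2 ⟨τ, h1, h2, hr⟩, fun e' he' hne => ?_⟩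
          by_contra hpos
          obtain ⟨τ', h3, h4, hr'⟩ := (increment_pos_iff hn).1 (Nat.pos_of_ne_zero hpos)
          have h5 := hone τ τ' h1 h2 h3 h4 e he e' he' hr hr'
          have h6 := hone τ' τ h3 h4 h1 h2 e' he' e he hr' hr
          have : τ = τ' := le_antisymm h6 h5
          subst this
          exact hn.disjoint e' e hne τ hr' hr
        rw [onlyClock_eq_some.2 honly, ringList_cons hn h1 h2 he hr]
        · rfl
        · intro τ' h3 h4 e' he' hr'
          exact le_antisymm (hone τ τ' h1 h2 h3 h4 e he e' he' hr hr')
            (hone τ' τ h3 h4 h1 h2 e' he' e he hr' hr)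
      · have hnone : onlyClock E (fun e => increment n t m e k) = none :=
          onlyClock_eq_none.2 fun e he => hex ⟨e, he.1, (increment_pos_iff hn).1 he.2.1⟩
        rw [hnone, ringList_eq_of_forall (grid_mono t m (Nat.le_succ k))]
        · rfl
        · intro τ h1 h2 e he hr
          exact hex ⟨e, he, τ, h1, h2, hr⟩
  rw [key m le_rfl, grid_self t (by omega)]

/-- The exclusion process on the ring in discretized time. -/
noncomputable def gridConfig (K : ℕ) (d : ClockIndex → ℕ → ℕ) (k : ℕ) (η : Config) : Config :=
  configRun (ringTarget K) (gridList (ringClocks K) d k) η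

/-- The number of crossings from `0` to `1` on the ring in discretized time. -/
noncomputable def gridCurrent (K : ℕ) (d : ClockIndex → ℕ → ℕ) (k : ℕ) (η : Config) : ℝ :=
  crossings (ringTarget K) (gridList (ringClocks K) d k) η

lemma eventually_gridConfig_eq {n : Clocks} (hn : Good n) (K : ℕ) (t : ℝ≥0) (η : Config) :
    ∀ᶠ m in atTop, gridConfig K (increment n t m) m η = ringConfig K n η t := by
  filter_upwards [eventually_gridList_eq hn (ringClocks K) t] with m hm
  rw [gridConfig, hm, ringConfig]

lemma eventually_gridCurrent_eq {n : Clocks} (hn : Good n) (K : ℕ) (t : ℝ≥0) (η : Config) :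
    ∀ᶠ m in atTop, gridCurrent K (increment n t m) m η = ringCurrent K n η t := by
  filter_upwards [eventually_gridList_eq hn (ringClocks K) t] with m hm
  rw [gridCurrent, hm, ringCurrent]

lemma sum_occ_gridConfig (K : ℕ) (d : ClockIndex → ℕ → ℕ) (k : ℕ) (η : Config) :
    ∑ i ∈ Finset.Icc (-(K : ℤ)) K, occ (gridConfig K d k η) i =
      ∑ i ∈ Finset.Icc (-(K : ℤ)) K, occ η i :=
  sum_occ_configRun _ (fun _ he => mem_of_mem_gridList he) η

open Classical in
/-- One time step: nothing happens unless exactly one clock rings. -/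
lemma gridConfig_succ (K : ℕ) (d : ClockIndex → ℕ → ℕ) (k : ℕ) (η : Config) (h : Config → ℝ) :
    h (gridConfig K d (k + 1) η) = h (gridConfig K d k η) + ∑ e ∈ ringClocks K,
      (if Only (ringClocks K) (fun e => d e k) e then 1 else 0) *
        (h (configJump (ringTarget K) e (gridConfig K d k η)) - h (gridConfig K d k η)) := by
  simp only [gridConfig, gridList]
  cases ho : onlyClock (ringClocks K) fun e => d e k with
  | none =>
    rw [onlyClock_eq_none] at ho
    simp [ho]
  | some e =>
    rw [onlyClock_eq_some] at ho
    rw [Finset.sum_eq_single e]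
    · simp [ho]
    · intro e' _ hne
      rw [if_neg fun h' => hne (h'.unique ho), zero_mul]
    · exact fun he => absurd ho.1 he

open Classical in
lemma gridCurrent_succ (K : ℕ) (d : ClockIndex → ℕ → ℕ) (k : ℕ) (η : Config) :
    gridCurrent K d (k + 1) η = gridCurrent K d k η + ∑ e ∈ ringClocks K,
      (if Only (ringClocks K) (fun e => d e k) e then 1 else 0) *
        crossing e (gridConfig K d k η) := by
  simp only [gridCurrent, gridConfig, gridList]
  cases ho : onlyClock (ringClocks K) fun e => d e k with
  | none =>
    rw [onlyClock_eq_none] at ho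
    simp [ho]
  | some e =>
    rw [onlyClock_eq_some] at ho
    rw [Finset.sum_eq_single e]
    · simp [ho, crossings, add_comm]
    · intro e' _ hne
      rw [if_neg fun h' => hne (h'.unique ho), zero_mul]
    · exact fun he => absurd ho.1 he

lemma occ_nonneg (η : Config) (i : ℤ) : 0 ≤ occ η i := by unfold occ; split_ifs <;> norm_num

lemma occ_le_one (η : Config) (i : ℤ) : occ η i ≤ 1 := by unfold occ; split_ifs <;> norm_num

lemma abs_crossing_le (e : ClockIndex) (η : Config) : |crossing e η| ≤ 1 := by
  unfold crossing occ
  split_ifs <;> norm_num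

/-- An interval contributes at most one crossing, and only if a clock of the bond `0|1` rings in it.
After summation the bound depends neither on `K` nor on the grid, so it can serve as dominating
function in both limits. -/
lemma abs_gridCurrent_le_sum (K : ℕ) (d : ClockIndex → ℕ → ℕ) (k : ℕ) (η : Config) :
    |gridCurrent K d k η| ≤ ∑ j ∈ Finset.range k, ((d (0, true) j : ℝ) + d (1, false) j) := by
  induction k with
  | zero => simp [gridCurrent, gridList, crossings]
  | succ k ih =>
    rw [Finset.sum_range_succ]
    simp only [gridCurrent, gridList]
    cases ho : onlyClock (ringClocks K) fun e => d e k with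
    | none =>
      simp only [Option.toList_none, List.nil_append]
      exact ih.trans (le_add_of_nonneg_right (by positivity))
    | some e =>
      rw [onlyClock_eq_some] at ho
      have hpos : (1 : ℝ) ≤ d e k := by exact_mod_cast ho.2.1
      simp only [Option.toList_some, List.singleton_append, crossings]
      rw [add_comm]
      refine (abs_add_le _ _).trans (add_le_add ih ?_)
      set ξ := configRun (ringTarget K) (gridList (ringClocks K) d k) η
      by_cases h1 : e = (0, true)
      · subst h1
        have : (0 : ℝ) ≤ d (1, false) k := by positivity
        linarith [abs_crossing_le (0, true) ξ]
      by_cases h2 : e = (1, false)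
      · subst h2
        have : (0 : ℝ) ≤ d (0, true) k := by positivity
        linarith [abs_crossing_le (1, false) ξ]
      rw [crossing, if_neg h1, if_neg h2, abs_zero]
      positivity

lemma sum_increment {n : Clocks} (hn : Good n) (t : ℝ≥0) {m : ℕ} (hm : m ≠ 0) (e : ClockIndex) :
    ∑ j ∈ Finset.range m, (increment n t m e j : ℝ) = n e t := by
  have : ∀ k, ∑ j ∈ Finset.range k, (increment n t m e j : ℝ) = n e (grid t m k) := by
    intro k
    induction k with
    | zero => simp [grid_zero, hn.zero]
    | succ k ih =>
      rw [Finset.sum_range_succ, ih, increment, Nat.cast_sub (hn.mono e (grid_mono t m k.le_succ))]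
      ring
  rw [this m, grid_self t hm]

/-- The number of rings that may cause crossings between `0` and `1`. -/
noncomputable def bondRings (n : Clocks) (t : ℝ≥0) : ℝ := n (0, true) t + n (1, false) t

lemma bondRings_nonneg (n : Clocks) (t : ℝ≥0) : 0 ≤ bondRings n t := by
  unfold bondRings; positivity

lemma abs_gridCurrent_le {n : Clocks} (hn : Good n) (K : ℕ) (t : ℝ≥0) {m : ℕ} (hm : m ≠ 0)
    (η : Config) : |gridCurrent K (increment n t m) m η| ≤ bondRings n t := by
  refine (abs_gridCurrent_le_sum K _ m η).trans ?_
  rw [Finset.sum_add_distrib, sum_increment hn t hm, sum_increment hn t hm, bondRings]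

lemma abs_ringCurrent_le {n : Clocks} (hn : Good n) (K : ℕ) (t : ℝ≥0) (η : Config) :
    |ringCurrent K n η t| ≤ bondRings n t := by
  obtain ⟨m, h1, h2⟩ := ((eventually_gridCurrent_eq hn K t η).and (eventually_ge_atTop 1)).exists
  rw [← h1]
  exact abs_gridCurrent_le hn K t (by omega) η

lemma abs_current_le {n : Clocks} (hn : Good n) (t : ℝ≥0) (η : Config) :
    |(current n η 0 t : ℝ)| ≤ bondRings n t := by
  obtain ⟨K, hK⟩ := ringCurrent_eq_current hn t
  rw [← hK K le_rfl]
  exact abs_ringCurrent_le hn K t η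

/-! ### Independence -/

section Independence

variable {Ω ι κ β γ δ : Type*} [MeasurableSpace Ω] {P : Measure Ω} [MeasurableSpace β]
  [MeasurableSpace γ] [MeasurableSpace δ]

/-- The subfamilies of an independent family over disjoint sets are independent. -/
lemma indepFun_subfamilies [IsProbabilityMeasure P] {f : ι → Ω → β} (h : iIndepFun f P)
    (hf : ∀ i, Measurable (f i)) {S T : Set ι} (hST : Disjoint S T) :
    IndepFun (fun ω (i : S) => f i ω) (fun ω (j : T) => f j ω) P := by
  refine IndepFun.process_indepFun_process (fun i => hf i) (fun j => hf j) fun I J => ?_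
  have hd : Disjoint (I.map (Function.Embedding.subtype _)) (J.map (Function.Embedding.subtype _)) := by
    rw [Finset.disjoint_left]
    intro x hx hx'
    obtain ⟨a, _, rfl⟩ := Finset.mem_map.1 hx
    obtain ⟨b, _, hab⟩ := Finset.mem_map.1 hx'
    exact Set.disjoint_left.1 hST a.2 ((show (b : ι) = a from hab) ▸ b.2)
  have := h.indepFun_finset _ _ hd hf
  exact this.comp
    (φ := fun g (i : I) => g ⟨i.1.1, Finset.mem_map.2 ⟨i.1, i.2, rfl⟩⟩)
    (ψ := fun g (j : J) => g ⟨j.1.1, Finset.mem_map.2 ⟨j.1, j.2, rfl⟩⟩)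
    (measurable_pi_lambda _ fun _ => measurable_pi_apply _)
    (measurable_pi_lambda _ fun _ => measurable_pi_apply _)

/-- Functions of disjoint parts of an independent family are independent. -/
lemma indepFun_of_dependsOn [IsProbabilityMeasure P] [Inhabited β] {f : ι → Ω → β}
    (h : iIndepFun f P) (hf : ∀ i, Measurable (f i)) {Φ : (ι → β) → γ} {Ψ : (ι → β) → δ}
    (hΦ : Measurable Φ) (hΨ : Measurable Ψ) {S T : Set ι} (hΦS : DependsOn Φ S)
    (hΨT : DependsOn Ψ T) (hST : Disjoint S T) :
    IndepFun (fun ω => Φ fun i => f i ω) (fun ω => Ψ fun i => f i ω) P := by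
  classical
  -- Values on `S` are completed by a default, which a functional that depends only on `S` does not
  -- notice.
  set ext : ∀ S : Set ι, (S → β) → ι → β := fun S z i => if hi : i ∈ S then z ⟨i, hi⟩ else default
  have hext : ∀ S, Measurable (ext S) := fun S => measurable_pi_lambda _ fun i => by
    by_cases hi : i ∈ S
    · simpa only [ext, hi, dif_pos] using measurable_pi_apply _
    · simpa only [ext, hi, dif_neg, not_false_eq_true] using measurable_const
  have := (indepFun_subfamilies h hf hST).comp (hΦ.comp (hext S)) (hΨ.comp (hext T))
  convert this using 1
  · funext ω
    refine hΦS fun i hi => ?_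
    simp [ext, hi]
  · funext ω
    refine hΨT fun i hi => ?_
    simp [ext, hi]

/-- Two independent families that are independent of each other form an independent family. -/
lemma iIndepFun_sumElim {f : ι → Ω → β} {g : κ → Ω → β} (hf : iIndepFun f P)
    (hg : iIndepFun g P) (hfg : IndepFun (fun ω i => f i ω) (fun ω j => g j ω) P) :
    iIndepFun (Sum.elim f g) P := by
  classical
  rw [iIndepFun_iff_measure_inter_preimage_eq_mul]
  intro S sets hsets
  have hset : ⋂ i ∈ S, Sum.elim f g i ⁻¹' sets i =
      ((fun ω i => f i ω) ⁻¹' ⋂ i ∈ S.toLeft, (fun x => x i) ⁻¹' sets (Sum.inl i)) ∩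
      ((fun ω j => g j ω) ⁻¹' ⋂ j ∈ S.toRight, (fun x => x j) ⁻¹' sets (Sum.inr j)) := by
    ext ω
    simp only [Set.mem_iInter, Set.mem_preimage, Set.mem_inter_iff, Finset.mem_toLeft,
      Finset.mem_toRight]
    constructor
    · exact fun h => ⟨fun i hi => h _ hi, fun j hj => h _ hj⟩
    · rintro ⟨h1, h2⟩ (i | j) hi
      · exact h1 i hi
      · exact h2 j hi
  have hm1 : MeasurableSet (⋂ i ∈ S.toLeft, (fun x : ι → β => x i) ⁻¹' sets (Sum.inl i)) :=
    Finset.measurableSet_biInter _ fun i hi =>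
      measurable_pi_apply i (hsets _ (Finset.mem_toLeft.1 hi))
  have hm2 : MeasurableSet (⋂ j ∈ S.toRight, (fun x : κ → β => x j) ⁻¹' sets (Sum.inr j)) :=
    Finset.measurableSet_biInter _ fun j hj =>
      measurable_pi_apply j (hsets _ (Finset.mem_toRight.1 hj))
  rw [hset, hfg.measure_inter_preimage_eq_mul _ _ hm1 hm2]
  have hl : P ((fun ω i => f i ω) ⁻¹' ⋂ i ∈ S.toLeft, (fun x => x i) ⁻¹' sets (Sum.inl i)) =
      ∏ i ∈ S.toLeft, P (f i ⁻¹' sets (Sum.inl i)) := by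
    rw [← hf.measure_inter_preimage_eq_mul S.toLeft fun i hi => hsets _ (Finset.mem_toLeft.1 hi)]
    congr 1
    ext ω
    simp
  have hr : P ((fun ω j => g j ω) ⁻¹' ⋂ j ∈ S.toRight, (fun x => x j) ⁻¹' sets (Sum.inr j)) =
      ∏ j ∈ S.toRight, P (g j ⁻¹' sets (Sum.inr j)) := by
    rw [← hg.measure_inter_preimage_eq_mul S.toRight fun i hi => hsets _ (Finset.mem_toRight.1 hi)]
    congr 1
    ext ω
    simp
  rw [hl, hr]
  conv_rhs => rw [← S.toLeft_disjSum_toRight]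
  rw [Finset.prod_disjSum]
  rfl

/-- If `X` and `Y` are independent and `(X, Y)` is independent of `Z`, then `X` is independent of
`(Z, Y)`. -/
lemma indepFun_prod_of_indepFun [IsProbabilityMeasure P] {X : Ω → β} {Y : Ω → γ} {Z : Ω → δ}
    (hX : Measurable X) (hY : Measurable Y) (hZ : Measurable Z) (h : IndepFun X Y P)
    (h' : IndepFun Z (fun ω => (X ω, Y ω)) P) : IndepFun X (fun ω => (Z ω, Y ω)) P := by
  have hZY : IndepFun Z Y P := h'.comp measurable_id measurable_snd
  rw [indepFun_iff_map_prod_eq_prod_map_map hX.aemeasurable (hZ.prodMk hY).aemeasurable,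
    (indepFun_iff_map_prod_eq_prod_map_map hZ.aemeasurable hY.aemeasurable).1 hZY]
  have h3 := (indepFun_iff_map_prod_eq_prod_map_map hZ.aemeasurable
    (hX.prodMk hY).aemeasurable).1 h'
  rw [(indepFun_iff_map_prod_eq_prod_map_map hX.aemeasurable hY.aemeasurable).1 h] at h3
  have := Measure.isProbabilityMeasure_map (μ := P) hX.aemeasurable
  have := Measure.isProbabilityMeasure_map (μ := P) hY.aemeasurable
  have := Measure.isProbabilityMeasure_map (μ := P) hZ.aemeasurable
  have hmap : P.map (fun ω => (X ω, Z ω, Y ω)) =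
      (P.map fun ω => (Z ω, X ω, Y ω)).map fun z => (z.2.1, z.1, z.2.2) := by
    rw [Measure.map_map (by fun_prop) (by fun_prop)]; rfl
  rw [hmap, h3]
  -- Products of measurable sets generate the product σ-algebra, and on them both measures
  -- factorize.
  refine (Measure.prod_eq_generateFrom MeasurableSpace.generateFrom_measurableSet ?_ MeasurableSpace.isPiSystem_measurableSet
    isPiSystem_prod ?_ ?_ ?_).symm
  · exact generateFrom_prod
  · exact (Measure.FiniteSpanningSetsIn.mk (fun _ => Set.univ) (fun _ => MeasurableSet.univ)
      (fun _ => measure_lt_top _ _) (Set.iUnion_const _))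
  · exact (Measure.FiniteSpanningSetsIn.mk (fun _ => Set.univ)
      (fun _ => ⟨Set.univ, MeasurableSet.univ, Set.univ, MeasurableSet.univ, Set.univ_prod_univ⟩)
      (fun _ => measure_lt_top _ _) (Set.iUnion_const _))
  · rintro s hs _ ⟨u, hu, v, hv, rfl⟩
    simp only [Set.mem_ofPred_eq] at hs hu hv
    rw [Measure.map_apply (by fun_prop) (hs.prod (hu.prod hv)), Measure.prod_prod]
    have : (fun z : δ × β × γ => (z.2.1, z.1, z.2.2)) ⁻¹' s ×ˢ u ×ˢ v = u ×ˢ s ×ˢ v := by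
      ext z; simp only [Set.mem_preimage, Set.mem_prod]; tauto
    rw [this, Measure.prod_prod, Measure.prod_prod]
    ring

end Independence

/-! ### The laws of the counts -/

lemma exists_grid_interval {t : ℝ≥0} {m : ℕ} (hm : m ≠ 0) {τ : ℝ≥0} (h0 : 0 < τ) (hτ : τ ≤ t) :
    ∃ k < m, grid t m k < τ ∧ τ ≤ grid t m (k + 1) := by
  have hex : ∃ k, τ ≤ grid t m k := ⟨m, by rwa [grid_self t hm]⟩
  classical
  have hspec := Nat.find_spec hex
  have hpos : Nat.find hex ≠ 0 := fun h => by
    rw [h, grid_zero] at hspec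
    exact absurd h0 (not_lt.2 hspec)
  obtain ⟨k, hk⟩ := Nat.exists_eq_succ_of_ne_zero hpos
  have hle : Nat.find hex ≤ m := Nat.find_min' hex (by rwa [grid_self t hm])
  refine ⟨k, by omega, not_le.1 (Nat.find_min hex (by omega)), ?_⟩
  rw [hk] at hspec
  exact hspec

section Poisson

variable {Ω : Type*} [MeasurableSpace Ω] {P : Measure Ω} {r : ℝ≥0} {X : ℝ≥0 → Ω → ℕ}

lemma IsPoissonProcess.map_eval (h : IsPoissonProcess P r X) (t : ℝ≥0) :
    P.map (X t) = poissonMeasure (r * t) := by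
  have := h.increments 0 t zero_le
  rw [tsub_zero] at this
  rw [← this]
  refine Measure.map_congr ?_
  filter_upwards [h.zero] with ω hω
  rw [hω, Nat.sub_zero]

lemma IsPoissonProcess.measurable_sub (h : IsPoissonProcess P r X) (s t : ℝ≥0) :
    Measurable fun ω => X t ω - X s ω := (h.measurable t).sub (h.measurable s)

lemma IsPoissonProcess.real_increment_eq_zero (h : IsPoissonProcess P r X) {s t : ℝ≥0}
    (hst : s ≤ t) : P.real {ω | X t ω - X s ω = 0} = Real.exp (-(r * (t - s : ℝ≥0))) := by
  have h1 : P.real {ω | X t ω - X s ω = 0} = (P.map fun ω => X t ω - X s ω).real {0} := by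
    rw [map_measureReal_apply (h.measurable_sub s t) (measurableSet_singleton 0)]
    rfl
  rw [h1, h.increments s t hst, poissonMeasure_real_singleton]
  simp

lemma IsPoissonProcess.real_eq_zero (h : IsPoissonProcess P r X) (t : ℝ≥0) :
    P.real {ω | X t ω = 0} = Real.exp (-(r * t)) := by
  have h1 : P.real {ω | X t ω = 0} = (P.map (X t)).real {0} := by
    rw [map_measureReal_apply (h.measurable t) (measurableSet_singleton 0)]
    rfl
  rw [h1, h.map_eval, poissonMeasure_real_singleton]
  simp

lemma IsPoissonProcess.memLp_two (h : IsPoissonProcess P r X) (t : ℝ≥0) :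
    MemLp (fun ω => (X t ω : ℝ)) 2 P := by
  rw [memLp_two_iff_integrable_sq (by
    exact (measurable_from_nat.comp (h.measurable t)).aestronglyMeasurable)]
  have : Integrable (fun n : ℕ => (n : ℝ) ^ 2) (P.map (X t)) := by
    rw [h.map_eval, integrable_poissonMeasure_iff]
    refine Summable.of_nonneg_of_le (fun n => by positivity) (fun n => ?_)
      ((Real.summable_pow_div_factorial (4 * ((r * t : ℝ≥0) : ℝ))).mul_left
        (Real.exp (-((r * t : ℝ≥0) : ℝ))))
    -- This compares the second moment of the Poisson law with an exponential series.
    have h4 : (n : ℝ) ^ 2 ≤ 4 ^ n := by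
      have h2 : (n : ℝ) ≤ 2 ^ n := by exact_mod_cast n.lt_two_pow_self.le
      calc (n : ℝ) ^ 2 ≤ (2 ^ n) ^ 2 := by gcongr
        _ = 4 ^ n := by rw [← pow_mul, mul_comm, pow_mul]; norm_num
    rw [Real.norm_of_nonneg (by positivity), mul_pow]
    calc Real.exp (-((r * t : ℝ≥0) : ℝ)) * ((r * t : ℝ≥0) : ℝ) ^ n / (n.factorial) * (n : ℝ) ^ 2
        ≤ Real.exp (-((r * t : ℝ≥0) : ℝ)) * ((r * t : ℝ≥0) : ℝ) ^ n / (n.factorial) * 4 ^ n := by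
          gcongr
      _ = _ := by ring
  exact this.comp_measurable (h.measurable t)

end Poisson

section Input

variable {Ω : Type*} [MeasurableSpace Ω] {P : Measure Ω} {p q : ℝ≥0} {ρ : ℝ}
  {A : Set ℤ} {N : Ω → Clocks} {η₀ : Ω → Config}

/-- The rate of a clock. -/
def rate (p q : ℝ≥0) (e : ClockIndex) : ℝ≥0 := if e.2 then p else q

lemma IsInput.poisson_clock (h : IsInput P p q ρ A N η₀) (e : ClockIndex) :
    IsPoissonProcess P (rate p q e) fun t ω => N ω e t := h.poisson e

lemma IsInput.measurable_clocks (h : IsInput P p q ρ A N η₀) : Measurable N :=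
  measurable_pi_lambda _ fun e => measurable_pi_lambda _ fun t => (h.poisson e).measurable t

lemma IsInput.measurable_clock (h : IsInput P p q ρ A N η₀) (e : ClockIndex) :
    Measurable fun ω => N ω e := measurable_pi_lambda _ fun t => (h.poisson e).measurable t

lemma grid_succ_sub (t : ℝ≥0) (m k : ℕ) : grid t m (k + 1) - grid t m k = t / m := by
  refine NNReal.coe_injective ?_
  rw [NNReal.coe_sub (grid_mono t m k.le_succ), coe_grid_succ]
  simp

lemma IsInput.real_increment_eq_zero (h : IsInput P p q ρ A N η₀) (t : ℝ≥0) (m k : ℕ)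
    (e : ClockIndex) :
    P.real {ω | increment (N ω) t m e k = 0} = Real.exp (-(rate p q e * (t / m))) := by
  have := (h.poisson_clock e).real_increment_eq_zero (grid_mono t m k.le_succ)
  rw [grid_succ_sub] at this
  push_cast at this
  exact this

/-- Two clocks almost surely do not ring at the same time. -/
lemma IsInput.ae_disjoint [IsProbabilityMeasure P] (h : IsInput P p q ρ A N η₀)
    {e e' : ClockIndex} (hne : e ≠ e') (T : ℝ≥0) :
    ∀ᵐ ω ∂P, ∀ τ ≤ T, RingsAt (N ω e) τ → ¬ RingsAt (N ω e') τ := by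
  -- Monotonicity is built into `B` so that a ring forces a positive increment of the interval
  -- around it. `B` need not be measurable: only upper bounds for its measure are used.
  set B : Set Ω := {ω | Monotone (N ω e) ∧ Monotone (N ω e') ∧
    ∃ τ ≤ T, RingsAt (N ω e) τ ∧ RingsAt (N ω e') τ} with hB
  suffices hB0 : P B = 0 by
    filter_upwards [compl_mem_ae_iff.2 hB0, (h.poisson e).monotone, (h.poisson e').monotone]
      with ω hω h1 h2 τ hτ hr hr'
    exact hω ⟨h1, h2, τ, hτ, hr, hr'⟩
  set C : ℝ := rate p q e * T * (rate p q e' * T) with hC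
  -- Both clocks ring in the same one of `m` intervals; each interval has probability at most `C / m
  -- ^ 2` by independence.
  have hbound : ∀ m : ℕ, m ≠ 0 → P.real B ≤ C / m := by
    intro m hm
    have hsub : B ⊆ ⋃ k ∈ Finset.range m,
        {ω | 0 < increment (N ω) T m e k} ∩ {ω | 0 < increment (N ω) T m e' k} := by
      rintro ω ⟨h1, h2, τ, hτ, hr, hr'⟩
      obtain ⟨k, hk, hk1, hk2⟩ := exists_grid_interval hm hr.1 hτ
      simp only [Set.mem_iUnion, Finset.mem_range]
      refine ⟨k, hk, Nat.sub_pos_of_lt ?_, Nat.sub_pos_of_lt ?_⟩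
      · exact (hr.2 _ hk1).trans_le (h1 hk2)
      · exact (hr'.2 _ hk1).trans_le (h2 hk2)
    have hpos : ∀ (e : ClockIndex) (k : ℕ),
        P.real {ω | 0 < increment (N ω) T m e k} ≤ rate p q e * (T / m) := by
      intro e k
      have hmeas : MeasurableSet {ω | increment (N ω) T m e k = 0} :=
        (h.poisson e).measurable_sub _ _ (measurableSet_singleton 0)
      have : {ω | 0 < increment (N ω) T m e k} = {ω | increment (N ω) T m e k = 0}ᶜ := by
        ext ω; simp [Nat.pos_iff_ne_zero]
      rw [this, probReal_compl_eq_one_sub hmeas, h.real_increment_eq_zero]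
      have := Real.add_one_le_exp (-(rate p q e * (T / m) : ℝ))
      linarith
    have hms : ∀ k, MeasurableSet {f : ℝ≥0 → ℕ | 0 < f (grid T m (k + 1)) - f (grid T m k)} := by
      intro k
      have hmk : Measurable fun f : ℝ≥0 → ℕ => f (grid T m (k + 1)) - f (grid T m k) :=
        (measurable_pi_apply (grid T m (k + 1))).sub (measurable_pi_apply (grid T m k))
      exact hmk measurableSet_Ioi
    have hind : ∀ k, P.real ({ω | 0 < increment (N ω) T m e k} ∩
        {ω | 0 < increment (N ω) T m e' k}) ≤ C / m / m := by
      intro k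
      have hi := (h.indep_clocks.indepFun hne).measure_inter_preimage_eq_mul
        {f | 0 < f (grid T m (k + 1)) - f (grid T m k)}
        {f | 0 < f (grid T m (k + 1)) - f (grid T m k)} (hms k) (hms k)
      have hi' : P.real ({ω | 0 < increment (N ω) T m e k} ∩
          {ω | 0 < increment (N ω) T m e' k}) = P.real {ω | 0 < increment (N ω) T m e k} *
          P.real {ω | 0 < increment (N ω) T m e' k} := by
        rw [measureReal_def, measureReal_def, measureReal_def, ← ENNReal.toReal_mul]
        exact congrArg _ hi
      rw [hi']
      calc _ ≤ rate p q e * (T / m) * (rate p q e' * (T / m) : ℝ) :=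
            mul_le_mul (hpos e k) (hpos e' k) measureReal_nonneg (by positivity)
        _ = C / m / m := by rw [hC]; ring
    calc P.real B ≤ P.real (⋃ k ∈ Finset.range m, _) := measureReal_mono hsub (measure_ne_top P _)
      _ ≤ ∑ k ∈ Finset.range m, _ := measureReal_biUnion_finset_le _ _
      _ ≤ ∑ k ∈ Finset.range m, C / m / m := Finset.sum_le_sum fun k _ => hind k
      _ = C / m := by
        rw [Finset.sum_const, Finset.card_range, nsmul_eq_mul]
        field_simp
  have hlim : Tendsto (fun m : ℕ => C / m) atTop (𝓝 0) := tendsto_const_div_atTop_nhds_zero_nat _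
  have h0 : P.real B ≤ 0 := ge_of_tendsto hlim
    (by filter_upwards [eventually_ge_atTop 1] with m hm using hbound m (by omega))
  have := le_antisymm h0 measureReal_nonneg
  rwa [measureReal_def, ENNReal.toReal_eq_zero_iff, or_iff_left (measure_ne_top P B)] at this

lemma measurableSet_barrier (T : ℝ≥0) (b : ℤ) : MeasurableSet {n : Clocks | Barrier n T b} := by
  have h1 : ∀ e : ClockIndex, MeasurableSet {n : Clocks | n e T = 0} := fun e =>
    ((measurable_pi_apply T).comp (measurable_pi_apply e)) (measurableSet_singleton 0)
  exact (h1 (b, true)).inter (h1 (b + 1, false))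

/-- The two clocks of a bond are independent and have total rate `p + q = 1`. -/
lemma IsInput.real_barrier [IsProbabilityMeasure P] (h : IsInput P p q ρ A N η₀)
    (hpq : p + q = 1) (T : ℝ≥0) (b : ℤ) : P.real {ω | Barrier (N ω) T b} = Real.exp (-T) := by
  have hm : MeasurableSet {f : ℝ≥0 → ℕ | f T = 0} := measurable_pi_apply T (measurableSet_singleton 0)
  have hi := (h.indep_clocks.indepFun (i := (b, true)) (j := (b + 1, false))
    (by simp)).measure_inter_preimage_eq_mul {f | f T = 0} {f | f T = 0} hm hm
  have hi' : P.real {ω | Barrier (N ω) T b} = P.real {ω | N ω (b, true) T = 0} *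
      P.real {ω | N ω (b + 1, false) T = 0} := by
    rw [measureReal_def, measureReal_def, measureReal_def, ← ENNReal.toReal_mul]
    exact congrArg _ hi
  rw [hi', (h.poisson_clock _).real_eq_zero, (h.poisson_clock _).real_eq_zero, ← Real.exp_add]
  congr 1
  have : (p : ℝ) + q = 1 := by exact_mod_cast congrArg NNReal.toReal hpq
  simp only [rate, if_true, Bool.false_eq_true, if_false]
  linear_combination -(T : ℝ) * this

/-- The probability that there is no barrier in a finite set. -/
lemma IsInput.real_no_barrier [IsProbabilityMeasure P] (h : IsInput P p q ρ A N η₀)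
    (hpq : p + q = 1) (T : ℝ≥0) (I : Finset ℤ) :
    P.real {ω | ∀ b ∈ I, ¬ Barrier (N ω) T b} = (1 - Real.exp (-T)) ^ I.card := by
  classical
  induction I using Finset.induction_on with
  | empty => simp
  | insert b I hb ih =>
    have hmb := measurableSet_barrier T b
    have hmI : MeasurableSet {n : Clocks | ∀ b ∈ I, ¬ Barrier n T b} := by
      have : {n : Clocks | ∀ b ∈ I, ¬ Barrier n T b} = ⋂ b ∈ I, {n | Barrier n T b}ᶜ := by
        ext n; simp
      rw [this]
      exact Finset.measurableSet_biInter _ fun b _ => (measurableSet_barrier T b).compl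
    -- The barrier at `b` involves only the clocks `(b, true)` and `(b + 1, false)`, so distinct
    -- barriers use disjoint sets of clocks.
    have hind := indepFun_of_dependsOn h.indep_clocks h.measurable_clock
      (Φ := fun n => Barrier n T b) (Ψ := fun n => ∀ b ∈ I, ¬ Barrier n T b)
      (S := {(b, true), (b + 1, false)})
      (T := {e | ∃ c ∈ I, e = (c, true) ∨ e = (c + 1, false)})
      (measurable_to_prop (by simpa using hmb)) (measurable_to_prop (by simpa using hmI))
      (fun x y hxy => by
        simp only [Barrier]
        rw [hxy (b, true) (by simp), hxy (b + 1, false) (by simp)])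
      (fun x y hxy => by
        refine propext (forall₂_congr fun c hc => not_congr ?_)
        simp only [Barrier]
        rw [hxy (c, true) ⟨c, hc, Or.inl rfl⟩, hxy (c + 1, false) ⟨c, hc, Or.inr rfl⟩])
      (by
        rw [Set.disjoint_left]
        rintro e (rfl | rfl) ⟨c, hc, hc'⟩
        · simp only [Prod.mk.injEq, and_true, Bool.true_eq_false, and_false, or_false] at hc'
          exact hb (hc' ▸ hc)
        · simp only [Prod.mk.injEq, and_true, Bool.false_eq_true, and_false, false_or,
            add_left_inj] at hc'
          exact hb (hc' ▸ hc))
    have := hind.measure_inter_preimage_eq_mul {False} {True} (measurableSet_singleton _)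
      (measurableSet_singleton _)
    have h2 : P.real {ω | ∀ c ∈ insert b I, ¬ Barrier (N ω) T c} =
        P.real {ω | ¬ Barrier (N ω) T b} * P.real {ω | ∀ c ∈ I, ¬ Barrier (N ω) T c} := by
      rw [measureReal_def, measureReal_def, measureReal_def, ← ENNReal.toReal_mul]
      refine congrArg _ (Eq.trans ?_ (this.trans ?_))
      · congr 1
        ext ω
        simp
      · congr 2 <;> (ext ω; simp)
    have h3 : {ω | ¬ Barrier (N ω) T b} = {ω | Barrier (N ω) T b}ᶜ := rfl
    have hmb' : MeasurableSet {ω | Barrier (N ω) T b} := h.measurable_clocks hmb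
    rw [h2, ih, h3, probReal_compl_eq_one_sub hmb', h.real_barrier hpq,
      Finset.card_insert_of_notMem hb, pow_succ']

/-- Any `k` bonds all fail to be barriers with probability `(1 - exp (-T)) ^ k`, which tends to `0`.
-/
lemma IsInput.ae_exists_barrier [IsProbabilityMeasure P] (h : IsInput P p q ρ A N η₀)
    (hpq : p + q = 1) (T : ℝ≥0) {I : Set ℤ} (hI : I.Infinite) :
    ∀ᵐ ω ∂P, ∃ b ∈ I, Barrier (N ω) T b := by
  have h0 : P {ω | ∀ b ∈ I, ¬ Barrier (N ω) T b} = 0 := by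
    have hle : ∀ k : ℕ, P.real {ω | ∀ b ∈ I, ¬ Barrier (N ω) T b} ≤ (1 - Real.exp (-T)) ^ k := by
      intro k
      obtain ⟨J, hJ, hJk⟩ := hI.exists_subset_card_eq k
      rw [← hJk, ← h.real_no_barrier hpq T J]
      exact measureReal_mono fun ω hω b hb => hω b (hJ hb)
    have hlim : Tendsto (fun k : ℕ => (1 - Real.exp (-T)) ^ k) atTop (𝓝 0) := by
      refine tendsto_pow_atTop_nhds_zero_of_lt_one ?_ ?_
      · simp
      · linarith [Real.exp_pos (-T : ℝ)]
    have := le_antisymm (ge_of_tendsto' hlim hle) measureReal_nonneg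
    rwa [measureReal_def, ENNReal.toReal_eq_zero_iff, or_iff_left (measure_ne_top P _)] at this
  filter_upwards [compl_mem_ae_iff.2 h0] with ω hω
  simpa using hω

theorem IsInput.ae_good [IsProbabilityMeasure P] (h : IsInput P p q ρ A N η₀)
    (hpq : p + q = 1) : ∀ᵐ ω ∂P, Good (N ω) := by
  have h1 := ae_all_iff.2 fun e => (h.poisson e).zero
  have h2 := ae_all_iff.2 fun e => (h.poisson e).monotone
  have h3 := ae_all_iff.2 fun e => (h.poisson e).right_continuous
  -- Integer time horizons keep the quantifiers countable; a barrier up to a later time is also one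
  -- up to an earlier time.
  have h4 : ∀ᵐ ω ∂P, ∀ e e' : ClockIndex, e ≠ e' → ∀ T : ℕ, ∀ τ ≤ (T : ℝ≥0),
      RingsAt (N ω e) τ → ¬ RingsAt (N ω e') τ := by
    simp only [ae_all_iff]
    exact fun e e' hne T => h.ae_disjoint hne T
  have h5 : ∀ᵐ ω ∂P, ∀ (T : ℕ) (x : ℤ), ∃ b ∈ Set.Ici x, Barrier (N ω) T b := by
    simp only [ae_all_iff]
    exact fun T x => h.ae_exists_barrier hpq T (Set.Ici_infinite x)
  have h6 : ∀ᵐ ω ∂P, ∀ (T : ℕ) (x : ℤ), ∃ b ∈ Set.Iic x, Barrier (N ω) T b := by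
    simp only [ae_all_iff]
    exact fun T x => h.ae_exists_barrier hpq T (Set.Iic_infinite x)
  filter_upwards [h1, h2, h3, h4, h5, h6] with ω g1 g2 g3 g4 g5 g6
  have hanti : ∀ (T : ℝ≥0) (b : ℤ), Barrier (N ω) (⌈T⌉₊ : ℕ) b → Barrier (N ω) T b := by
    intro T b hb
    have hT := Nat.le_ceil T
    exact ⟨Nat.le_zero.1 ((g2 (b, true) hT).trans hb.1.le),
      Nat.le_zero.1 ((g2 (b + 1, false) hT).trans hb.2.le)⟩
  refine ⟨g1, g2, g3, fun e e' hne t => g4 e e' hne ⌈t⌉₊ t (Nat.le_ceil t), fun T x => ?_,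
    fun T x => ?_⟩
  · obtain ⟨b, hb, hb'⟩ := g5 ⌈T⌉₊ x
    exact ⟨b, hb, hanti T b hb'⟩
  · obtain ⟨b, hb, hb'⟩ := g6 ⌈T⌉₊ x
    exact ⟨b, hb, hanti T b hb'⟩

lemma IsInput.memLp_bondRings [IsProbabilityMeasure P] (h : IsInput P p q ρ A N η₀) (t : ℝ≥0) :
    MemLp (fun ω => bondRings (N ω) t) 2 P :=
  ((h.poisson_clock (0, true)).memLp_two t).add ((h.poisson_clock (1, false)).memLp_two t)

end Input

/-! ### Measurability of the discretized dynamics -/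

/-- The discretized dynamics depends on the increments only through a list of clocks, which has
countably many possible values. -/
lemma measurable_of_countable_fibers {α β γ : Type*} [MeasurableSpace α] [MeasurableSpace γ]
    [Countable β] {g : α → β} (hg : ∀ b, MeasurableSet {a | g a = b}) {F : β → α → γ}
    (hF : ∀ b, Measurable (F b)) : Measurable fun a => F (g a) a := by
  intro s hs
  have : (fun a => F (g a) a) ⁻¹' s = ⋃ b, {a | g a = b} ∩ F b ⁻¹' s := by
    ext a; simp
  rw [this]
  exact MeasurableSet.iUnion fun b => (hg b).inter (hF b hs)

lemma measurable_occ (i : ℤ) : Measurable fun η : Config => occ η i :=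
  (measurable_of_countable fun b : Bool => if b then (1 : ℝ) else 0).comp (measurable_pi_apply i)

lemma measurable_configJump (v : ClockIndex → ℤ) (e : ClockIndex) :
    Measurable (configJump v e) := by
  refine measurable_pi_lambda _ fun i => ?_
  have : (fun η => configJump v e η i) = fun η : Config =>
      (fun z : Bool × Bool × Bool => if z.1 = true ∧ z.2.1 = false then
        (if i = e.1 then false else if i = v e then true else z.2.2) else z.2.2)
      (η e.1, η (v e), η i) := by
    funext η
    unfold configJump
    by_cases h : η e.1 = true ∧ η (v e) = false
    · simp [h, Function.update_apply]
    · simp only [if_neg h]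
  rw [this]
  have hm : Measurable fun η : Config => (η e.1, η (v e), η i) :=
    (measurable_pi_apply e.1).prodMk ((measurable_pi_apply (v e)).prodMk (measurable_pi_apply i))
  exact Measurable.comp (measurable_of_countable (β := Bool) fun z : Bool × Bool × Bool =>
    if z.1 = true ∧ z.2.1 = false then (if i = e.1 then false else if i = v e then true else z.2.2)
    else z.2.2) hm

lemma measurable_configRun (v : ClockIndex → ℤ) (l : List ClockIndex) :
    Measurable (configRun v l) := by
  induction l with
  | nil => exact measurable_id
  | cons e l ih => exact (measurable_configJump v e).comp ih

lemma measurable_crossing (e : ClockIndex) : Measurable (crossing e) := by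
  unfold crossing
  have h0 := measurable_occ 0
  have h1 := measurable_occ 1
  split_ifs
  · exact h0.mul (measurable_const.sub h1)
  · exact (h1.mul (measurable_const.sub h0)).neg
  · exact measurable_const

lemma measurable_crossings (v : ClockIndex → ℤ) (l : List ClockIndex) :
    Measurable (crossings v l) := by
  induction l with
  | nil => exact measurable_const
  | cons e l ih => exact ((measurable_crossing e).comp (measurable_configRun v l)).add ih

lemma measurableSet_only (E : Finset ClockIndex) (e : ClockIndex) :
    MeasurableSet {f : ClockIndex → ℕ | Only E f e} := by
  by_cases he : e ∈ E
  · have : {f : ClockIndex → ℕ | Only E f e} =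
        {f | 0 < f e} ∩ ⋂ e' ∈ E.filter (· ≠ e), {f | f e' = 0} := by
      ext f
      simp only [Only, he, true_and, Set.mem_ofPred_eq, Set.mem_inter_iff, Set.mem_iInter,
        Finset.mem_filter, and_imp]
    rw [this]
    exact (measurable_pi_apply e measurableSet_Ioi).inter (Finset.measurableSet_biInter _
      fun e' _ => measurable_pi_apply e' (measurableSet_singleton 0))
  · simp [Only, he]

lemma measurableSet_onlyClock (E : Finset ClockIndex) (o : Option ClockIndex) :
    MeasurableSet {f : ClockIndex → ℕ | onlyClock E f = o} := by
  cases o with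
  | none =>
    have : {f : ClockIndex → ℕ | onlyClock E f = none} = ⋂ e, {f | Only E f e}ᶜ := by
      ext f; simp only [Set.mem_ofPred_eq, onlyClock_eq_none, Set.mem_iInter, Set.mem_compl_iff]
    rw [this]
    exact MeasurableSet.iInter fun e => (measurableSet_only E e).compl
  | some e =>
    simp only [onlyClock_eq_some]
    exact measurableSet_only E e

lemma measurableSet_gridList (E : Finset ClockIndex) (k : ℕ) (l : List ClockIndex) :
    MeasurableSet {d : ClockIndex → ℕ → ℕ | gridList E d k = l} := by
  induction k generalizing l with
  | zero => simp [gridList]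
  | succ k ih =>
    have : {d : ClockIndex → ℕ → ℕ | gridList E d (k + 1) = l} =
        ⋃ (o : Option ClockIndex) (l' : List ClockIndex) (_ : o.toList ++ l' = l),
          {d | onlyClock E (fun e => d e k) = o} ∩ {d | gridList E d k = l'} := by
      ext d
      simp only [gridList, Set.mem_ofPred_eq, Set.mem_iUnion, Set.mem_inter_iff, exists_prop]
      constructor
      · intro h; exact ⟨_, _, h, rfl, rfl⟩
      · rintro ⟨o, l', h, rfl, rfl⟩; exact h
    rw [this]
    refine MeasurableSet.iUnion fun o => MeasurableSet.iUnion fun l' => MeasurableSet.iUnion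
      fun _ => MeasurableSet.inter ?_ (ih l')
    have hm : Measurable fun (d : ClockIndex → ℕ → ℕ) e => d e k :=
      measurable_pi_lambda _ fun e => (measurable_pi_apply k).comp (measurable_pi_apply e)
    exact hm (measurableSet_onlyClock E o)

lemma measurable_gridConfig (K k : ℕ) :
    Measurable fun x : (ClockIndex → ℕ → ℕ) × Config => gridConfig K x.1 k x.2 :=
  measurable_of_countable_fibers
    (g := fun x : (ClockIndex → ℕ → ℕ) × Config => gridList (ringClocks K) x.1 k)
    (fun l => measurable_fst (measurableSet_gridList (ringClocks K) k l))
    (F := fun l (x : (ClockIndex → ℕ → ℕ) × Config) => configRun (ringTarget K) l x.2)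
    (fun l => (measurable_configRun _ l).comp measurable_snd)

lemma measurable_gridCurrent (K k : ℕ) :
    Measurable fun x : (ClockIndex → ℕ → ℕ) × Config => gridCurrent K x.1 k x.2 :=
  measurable_of_countable_fibers
    (g := fun x : (ClockIndex → ℕ → ℕ) × Config => gridList (ringClocks K) x.1 k)
    (fun l => measurable_fst (measurableSet_gridList (ringClocks K) k l))
    (F := fun l (x : (ClockIndex → ℕ → ℕ) × Config) => crossings (ringTarget K) l x.2)
    (fun l => (measurable_crossings _ l).comp measurable_snd)

lemma measurable_increment (t : ℝ≥0) (m : ℕ) : Measurable fun n : Clocks => increment n t m := by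
  refine measurable_pi_lambda _ fun e => measurable_pi_lambda _ fun k => ?_
  have h : ∀ s, Measurable fun n : Clocks => n e s := fun s =>
    (measurable_pi_apply s).comp (measurable_pi_apply e)
  exact (h _).sub (h _)

/-! ### The discretized noise -/

/-- The increments of the clocks and the initial occupation variables, as one family. -/
noncomputable def noise (t : ℝ≥0) (m : ℕ) (n : Clocks) (η : Config) : (ClockIndex × ℕ) ⊕ ℤ → ℕ :=
  Sum.elim (fun x => increment n t m x.1 x.2) fun i => if η i then 1 else 0

/-- The increments of the clocks in the noise. -/
def noiseIncrement (y : (ClockIndex × ℕ) ⊕ ℤ → ℕ) (e : ClockIndex) (k : ℕ) : ℕ := y (Sum.inl (e, k))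

/-- The initial configuration in the noise. -/
def noiseConfig (y : (ClockIndex × ℕ) ⊕ ℤ → ℕ) : Config := fun i => decide (y (Sum.inr i) = 1)

lemma noiseIncrement_noise (t : ℝ≥0) (m : ℕ) (n : Clocks) (η : Config) :
    noiseIncrement (noise t m n η) = increment n t m := rfl

lemma noiseConfig_noise (t : ℝ≥0) (m : ℕ) (n : Clocks) (η : Config) :
    noiseConfig (noise t m n η) = η := by
  funext i
  cases h : η i <;> simp [noiseConfig, noise, h]

lemma measurable_noiseIncrement_noiseConfig :
    Measurable fun y : (ClockIndex × ℕ) ⊕ ℤ → ℕ => (noiseIncrement y, noiseConfig y) := by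
  refine Measurable.prodMk ?_ ?_
  · exact measurable_pi_lambda _ fun e => measurable_pi_lambda _ fun k => measurable_pi_apply _
  · exact measurable_pi_lambda _ fun i =>
      (measurable_of_countable fun a : ℕ => decide (a = 1)).comp (measurable_pi_apply _)

section Input

variable {Ω : Type*} [MeasurableSpace Ω] {P : Measure Ω} [IsProbabilityMeasure P] {p q : ℝ≥0}
  {ρ : ℝ} {N : Ω → Clocks} {η₀ : Ω → Config}

omit [IsProbabilityMeasure P] in
lemma IsInput.measurable_noise {A : Set ℤ} (h : IsInput P p q ρ A N η₀) (t : ℝ≥0) (m : ℕ)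
    (x : (ClockIndex × ℕ) ⊕ ℤ) : Measurable fun ω => noise t m (N ω) (η₀ ω) x := by
  rcases x with ⟨e, k⟩ | i
  · exact (measurable_pi_apply k).comp ((measurable_pi_apply e).comp
      ((measurable_increment t m).comp h.measurable_clocks))
  · exact (measurable_of_countable fun b : Bool => if b then 1 else 0).comp
      ((measurable_pi_apply i).comp h.measurable_init)

omit [IsProbabilityMeasure P] in
lemma IsInput.iIndepFun_init (h : IsInput P p q ρ Set.univ N η₀) :
    iIndepFun (fun (i : ℤ) ω => η₀ ω i) P :=
  h.indep_init.precomp (g := fun i : ℤ => (⟨i, Set.mem_univ i⟩ : Set.univ))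
    fun _ _ hij => congrArg Subtype.val hij

omit [IsProbabilityMeasure P] in
lemma IsInput.iIndepFun_increment {A : Set ℤ} (h : IsInput P p q ρ A N η₀) (t : ℝ≥0) (m : ℕ) :
    iIndepFun (fun (x : ClockIndex × ℕ) ω => increment (N ω) t m x.1 x.2) P := by
  refine iIndepFun_uncurry' (X := fun e k ω => increment (N ω) t m e k) (fun e k => ?_) ?_ ?_
  · exact (h.poisson e).measurable_sub _ _
  · refine h.indep_clocks.comp (fun _ f k => f (grid t m (k + 1)) - f (grid t m k)) fun _ => ?_
    exact measurable_pi_lambda _ fun k => (measurable_pi_apply _).sub (measurable_pi_apply _)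
  · exact fun e => (h.poisson e).indep.nat (grid_mono t m)

omit [IsProbabilityMeasure P] in
-- Independence within each clock, among the clocks, and between clocks and initial state combine
-- into one independent family, so that independence statements reduce to disjointness of index
-- sets.
lemma IsInput.iIndepFun_noise (h : IsInput P p q ρ Set.univ N η₀) (t : ℝ≥0) (m : ℕ) :
    iIndepFun (fun x ω => noise t m (N ω) (η₀ ω) x) P := by
  have h1 : iIndepFun (fun (i : ℤ) ω => if η₀ ω i then 1 else 0) P :=
    h.iIndepFun_init.comp (fun _ b => if b then 1 else 0) fun _ => measurable_of_countable _
  have h2 : IndepFun (fun ω (x : ClockIndex × ℕ) => increment (N ω) t m x.1 x.2)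
      (fun ω (i : ℤ) => if η₀ ω i then 1 else 0) P := by
    refine h.indep.comp (φ := fun n (x : ClockIndex × ℕ) => increment n t m x.1 x.2)
      (ψ := fun η (i : ℤ) => if η i then 1 else 0) ?_ ?_
    · exact measurable_pi_lambda _ fun x => (measurable_pi_apply x.2).comp
        ((measurable_pi_apply x.1).comp (measurable_increment t m))
    · exact measurable_pi_lambda _ fun i =>
        (measurable_of_countable fun b : Bool => if b then 1 else 0).comp (measurable_pi_apply i)
  convert iIndepFun_sumElim (h.iIndepFun_increment t m) h1 h2 using 1
  funext x ω
  rcases x with x | i <;> rfl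

omit [IsProbabilityMeasure P] in
lemma measurable_gridConfig_comp {A : Set ℤ} (h : IsInput P p q ρ A N η₀) (K : ℕ) (t : ℝ≥0)
    (m k : ℕ) : Measurable fun ω => gridConfig K (increment (N ω) t m) k (η₀ ω) :=
  (measurable_gridConfig K k).comp
    (((measurable_increment t m).comp h.measurable_clocks).prodMk h.measurable_init)

omit [IsProbabilityMeasure P] in
lemma measurable_gridCurrent_comp {A : Set ℤ} (h : IsInput P p q ρ A N η₀) (K : ℕ) (t : ℝ≥0)
    (m k : ℕ) : Measurable fun ω => gridCurrent K (increment (N ω) t m) k (η₀ ω) :=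
  (measurable_gridCurrent K k).comp
    (((measurable_increment t m).comp h.measurable_clocks).prodMk h.measurable_init)

/-- The probability that the clock `e` is the only one to ring in an interval of the grid. -/
noncomputable def onlyProb (p q : ℝ≥0) (K : ℕ) (t : ℝ≥0) (m : ℕ) (e : ClockIndex) : ℝ :=
  (Real.exp (rate p q e * (t / m)) - 1) *
    ∏ e' ∈ ringClocks K, Real.exp (-(rate p q e' * (t / m)))

/-- All clocks except `e` are silent and `e` is not. Writing `1 - exp (-r)` as `(exp r - 1) * exp
(-r)` lets the product run over all clocks of the ring. -/
lemma IsInput.real_only {A : Set ℤ} (h : IsInput P p q ρ A N η₀) (K : ℕ) (t : ℝ≥0) (m k : ℕ)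
    {e : ClockIndex} (he : e ∈ ringClocks K) :
    P.real {ω | Only (ringClocks K) (fun e => increment (N ω) t m e k) e} =
      onlyProb p q K t m e := by
  classical
  have hmeas : ∀ e', Measurable fun ω => increment (N ω) t m e' k := fun e' =>
    (h.poisson e').measurable_sub _ _
  have hind := (h.iIndepFun_increment t m).precomp (g := fun e' : ClockIndex => (e', k))
    fun _ _ hab => (Prod.mk.inj hab).1
  have hset : {ω | Only (ringClocks K) (fun e => increment (N ω) t m e k) e} =
      ⋂ e' ∈ ringClocks K, (fun ω => increment (N ω) t m e' k) ⁻¹'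
        (if e' = e then Set.Ioi 0 else {0}) := by
    ext ω
    simp only [Only, he, true_and, Set.mem_ofPred_eq, Set.mem_iInter, Set.mem_preimage]
    constructor
    · rintro ⟨h1, h2⟩ e' he'
      split_ifs with hc
      · exact hc ▸ h1
      · exact h2 e' he' hc
    · intro hall
      refine ⟨by simpa using hall e he, fun e' he' hne => ?_⟩
      simpa [hne] using hall e' he'
  have hprod := hind.measure_inter_preimage_eq_mul (ringClocks K)
    (sets := fun e' => if e' = e then Set.Ioi 0 else {0})
    (fun e' _ => by split_ifs; exacts [measurableSet_Ioi, measurableSet_singleton 0])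
  have hreal : ∀ e' ∈ ringClocks K, (P ((fun ω => increment (N ω) t m e' k) ⁻¹'
      (if e' = e then Set.Ioi 0 else {0}))).toReal =
      (if e' = e then Real.exp (rate p q e * (t / m)) - 1 else 1) *
        Real.exp (-(rate p q e' * (t / m))) := by
    intro e' _
    have h0 := h.real_increment_eq_zero t m k e'
    split_ifs with hc
    · subst hc
      have : (fun ω => increment (N ω) t m e' k) ⁻¹' Set.Ioi 0 =
          {ω | increment (N ω) t m e' k = 0}ᶜ := by
        ext ω; simp [Nat.pos_iff_ne_zero]
      have hms : MeasurableSet {ω | increment (N ω) t m e' k = 0} :=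
        hmeas e' (measurableSet_singleton 0)
      rw [this, ← measureReal_def, probReal_compl_eq_one_sub hms, h0, sub_mul, ← Real.exp_add]
      simp
    · rw [one_mul, ← h0]; rfl
  rw [measureReal_def, hset]
  refine (congrArg ENNReal.toReal hprod).trans ?_
  rw [ENNReal.toReal_prod, Finset.prod_congr rfl hreal, Finset.prod_mul_distrib, onlyProb]
  congr 1
  rw [Finset.prod_ite_eq' (ringClocks K) e, if_pos he]

/-- The rings in an interval are independent of the past. -/
lemma IsInput.integral_only_mul (h : IsInput P p q ρ Set.univ N η₀) (K : ℕ) (t : ℝ≥0)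
    (m k : ℕ) {e : ClockIndex} (he : e ∈ ringClocks K) {g : Config → ℝ} (hg : Measurable g) :
    ∫ ω, ({ω | Only (ringClocks K) (fun e => increment (N ω) t m e k) e}.indicator 1 ω : ℝ) *
      g (gridConfig K (increment (N ω) t m) k (η₀ ω)) ∂P =
    onlyProb p q K t m e * ∫ ω, g (gridConfig K (increment (N ω) t m) k (η₀ ω)) ∂P := by
  set Φ : ((ClockIndex × ℕ) ⊕ ℤ → ℕ) → ℝ := fun y =>
    {f : ClockIndex → ℕ | Only (ringClocks K) f e}.indicator 1 fun e => noiseIncrement y e k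
  set Ψ : ((ClockIndex × ℕ) ⊕ ℤ → ℕ) → ℝ := fun y =>
    g (gridConfig K (noiseIncrement y) k (noiseConfig y))
  have hΦ : Measurable Φ := (measurable_one.indicator (measurableSet_only _ e)).comp
    (measurable_pi_lambda _ fun e => measurable_pi_apply _)
  have hΨ : Measurable Ψ :=
    (hg.comp (measurable_gridConfig K k)).comp measurable_noiseIncrement_noiseConfig
  -- The step uses the `k`th increments; the state after `k` steps uses the initial configuration
  -- and increments of smaller index.
  have hind := indepFun_of_dependsOn (h.iIndepFun_noise t m) (h.measurable_noise t m) hΦ hΨ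
    (S := {x | ∃ e', x = Sum.inl (e', k)})
    (T := {x | ∀ e', x ≠ Sum.inl (e', k)})
    (fun x y hxy => by
      have : (fun e => noiseIncrement x e k) = fun e => noiseIncrement y e k :=
        funext fun e => hxy _ ⟨e, rfl⟩
      simp only [Φ, this])
    (fun x y hxy => by
      have h1 : noiseConfig x = noiseConfig y := by
        funext i
        simp only [noiseConfig]
        rw [hxy (Sum.inr i) (by simp)]
      have h2 : gridList (ringClocks K) (noiseIncrement x) k =
          gridList (ringClocks K) (noiseIncrement y) k :=
        gridList_congr fun e _ j hj => hxy _ fun e' he' => by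
          have := (Prod.mk.inj (Sum.inl.inj he')).2
          omega
      simp only [Ψ, gridConfig, h1, h2])
    (by
      rw [Set.disjoint_left]
      rintro x ⟨e', he'⟩ hx
      exact hx e' he')
  simp only [Φ, Ψ, noiseIncrement_noise, noiseConfig_noise] at hind
  have hn : Measurable fun ω => noise t m (N ω) (η₀ ω) :=
    measurable_pi_lambda _ (h.measurable_noise t m)
  have hmul := hind.integral_fun_mul_eq_mul_integral
    (hΦ.comp hn).aestronglyMeasurable
    ((hg.comp (measurable_gridConfig_comp h K t m k)).aestronglyMeasurable)
  refine hmul.trans (congrArg₂ _ ?_ rfl)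
  have hs : MeasurableSet {ω | Only (ringClocks K) (fun e => increment (N ω) t m e k) e} :=
    (measurable_pi_lambda _ fun e' => (h.poisson e').measurable_sub _ _ :
      Measurable fun ω e => increment (N ω) t m e k) (measurableSet_only _ e)
  rw [← h.real_only K t m k he, ← integral_indicator_one hs]
  rfl

/-! ### Stationarity of the Bernoulli measure on the ring. -/

omit [IsProbabilityMeasure P] in
/-- The law of a random bit is determined by the probability that it is `true`. -/
lemma map_bool_eq {Ω' : Type*} [MeasurableSpace Ω'] {P' : Measure Ω'} [IsProbabilityMeasure P]
    [IsProbabilityMeasure P'] {X : Ω → Bool} {X' : Ω' → Bool} (hX : Measurable X)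
    (hX' : Measurable X') (h : P {ω | X ω = true} = P' {ω | X' ω = true}) :
    P.map X = P'.map X' := by
  have := Measure.isProbabilityMeasure_map (μ := P) hX.aemeasurable
  have := Measure.isProbabilityMeasure_map (μ := P') hX'.aemeasurable
  have htrue : P.map X {true} = P'.map X' {true} := by
    rw [Measure.map_apply hX (measurableSet_singleton _),
      Measure.map_apply hX' (measurableSet_singleton _)]
    exact h
  refine Measure.ext_of_singleton fun b => ?_
  cases b
  · have hc : ({false} : Set Bool) = {true}ᶜ := by ext b; cases b <;> simp
    rw [hc, prob_compl_eq_one_sub (measurableSet_singleton _),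
      prob_compl_eq_one_sub (measurableSet_singleton _), htrue]
  · exact htrue

/-- The law of the initial configuration is invariant under permutations of the sites. -/
lemma IsInput.integral_comp_perm (h : IsInput P p q ρ Set.univ N η₀) (σ : Equiv.Perm ℤ)
    {f : Config → ℝ} (hf : Measurable f) :
    ∫ ω, f (fun i => η₀ ω (σ i)) ∂P = ∫ ω, f (η₀ ω) ∂P := by
  have hm : ∀ i, Measurable fun ω => η₀ ω i := fun i => (measurable_pi_apply i).comp h.measurable_init
  have hlaw : ∀ i, P.map (fun ω => η₀ ω (σ i)) = P.map (fun ω => η₀ ω i) := by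
    intro i
    exact map_bool_eq (hm _) (hm _)
      ((h.mean_init _ (Set.mem_univ _)).trans (h.mean_init _ (Set.mem_univ _)).symm)
  have h1 := h.iIndepFun_init.map_fun_eq_infinitePi_map hm
  have h2 := (h.iIndepFun_init.precomp σ.injective).map_fun_eq_infinitePi_map fun i => hm (σ i)
  have hσ : Measurable fun ω i => η₀ ω (σ i) := measurable_pi_lambda _ fun i => hm (σ i)
  rw [← integral_map (f := f) hσ.aemeasurable hf.aestronglyMeasurable,
    ← integral_map (f := f) h.measurable_init.aemeasurable hf.aestronglyMeasurable]
  congr 1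
  refine h2.trans (Eq.trans ?_ h1.symm)
  congr 1
  funext i
  exact hlaw i

/-- An allowed jump exchanges the values at source and target, so a product law, which is invariant
under exchanges, can be brought to bear. -/
lemma configJump_eq_swap (v : ClockIndex → ℤ) (e : ClockIndex) (η : Config) (f : Config → ℝ) :
    f (configJump v e η) - f η =
      occ η e.1 * (1 - occ η (v e)) * (f (fun i => η (Equiv.swap e.1 (v e) i)) - f η) := by
  unfold configJump
  by_cases h : η e.1 = true ∧ η (v e) = false
  · rw [if_pos h]
    have hne : e.1 ≠ v e := fun hc => by rw [hc] at h; simp [h.2] at h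
    have : Function.update (Function.update η (v e) true) e.1 false =
        fun i => η (Equiv.swap e.1 (v e) i) := by
      funext i
      rw [Equiv.swap_apply_def]
      simp only [Function.update_apply]
      split_ifs <;> simp_all
    rw [this]
    simp [occ, h.1, h.2]
  · rw [if_neg h]
    have : occ η e.1 * (1 - occ η (v e)) = 0 := by
      simp only [occ]
      cases h1 : η e.1 <;> cases h2 : η (v e) <;> simp_all
    rw [this]; ring

lemma integrable_of_abs_le {f : Ω → ℝ} (hf : Measurable f) {C : ℝ} (hC : ∀ ω, |f ω| ≤ C) :
    Integrable f P :=
  Integrable.of_bound hf.aestronglyMeasurable C (ae_of_all _ hC)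

/-- Exchange invariance turns the gain term into `E[η_v (1 - η_e) f]`; subtracting the loss term
`E[η_e (1 - η_v) f]` cancels the quadratic parts and leaves the discrete gradient `η_v - η_e`. -/
lemma IsInput.integral_configJump_sub (h : IsInput P p q ρ Set.univ N η₀) (v : ClockIndex → ℤ)
    (e : ClockIndex) {f : Config → ℝ} (hf : Measurable f) {C : ℝ} (hC : ∀ η, |f η| ≤ C) :
    ∫ ω, (f (configJump v e (η₀ ω)) - f (η₀ ω)) ∂P =
      ∫ ω, (occ (η₀ ω) (v e) - occ (η₀ ω) e.1) * f (η₀ ω) ∂P := by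
  have ho := measurable_occ
  have hC0 : 0 ≤ C := (abs_nonneg _).trans (hC fun _ => false)
  have hocc : ∀ η i j, |occ η i * (1 - occ η j)| ≤ 1 := fun η i j => by
    unfold occ; split_ifs <;> norm_num
  have hb : ∀ η i j, |occ η i * (1 - occ η j) * f η| ≤ C := fun η i j => by
    rw [abs_mul]
    exact (mul_le_mul (hocc η i j) (hC η) (abs_nonneg _) zero_le_one).trans (one_mul C).le
  have hm : ∀ i j, Measurable fun η => occ η i * (1 - occ η j) * f η := fun i j =>
    ((ho i).mul (measurable_const.sub (ho j))).mul hf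
  have hi : ∀ i j, Integrable (fun ω => occ (η₀ ω) i * (1 - occ (η₀ ω) j) * f (η₀ ω)) P :=
    fun i j => integrable_of_abs_le ((hm i j).comp h.measurable_init) fun ω => hb (η₀ ω) i j
  set σ := Equiv.swap e.1 (v e)
  have hswap := h.integral_comp_perm σ (hm (v e) e.1)
  have hσ1 : σ (v e) = e.1 := Equiv.swap_apply_right _ _
  have hσ2 : σ e.1 = v e := Equiv.swap_apply_left _ _
  have hσm : Measurable fun ω i => η₀ ω (σ i) :=
    measurable_pi_lambda _ fun i => (measurable_pi_apply _).comp h.measurable_init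
  have hocc1 : ∀ ω, occ (fun i => η₀ ω (σ i)) (v e) = occ (η₀ ω) e.1 := fun ω => by
    simp only [occ, hσ1]
  have hocc2 : ∀ ω, occ (fun i => η₀ ω (σ i)) e.1 = occ (η₀ ω) (v e) := fun ω => by
    simp only [occ, hσ2]
  simp only [hocc1, hocc2] at hswap
  have hi' : Integrable (fun ω => occ (η₀ ω) e.1 * (1 - occ (η₀ ω) (v e)) *
      f (fun i => η₀ ω (σ i))) P := by
    have := integrable_of_abs_le (P := P) ((hm (v e) e.1).comp hσm)
      fun ω => hb (fun i => η₀ ω (σ i)) (v e) e.1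
    simpa only [Function.comp_def, hocc1, hocc2] using this
  calc ∫ ω, (f (configJump v e (η₀ ω)) - f (η₀ ω)) ∂P
      = ∫ ω, (occ (η₀ ω) e.1 * (1 - occ (η₀ ω) (v e)) * f (fun i => η₀ ω (σ i)) -
          occ (η₀ ω) e.1 * (1 - occ (η₀ ω) (v e)) * f (η₀ ω)) ∂P := by
        refine integral_congr_ae (ae_of_all _ fun ω => ?_)
        simp only
        rw [configJump_eq_swap]; ring
    _ = ∫ ω, (occ (η₀ ω) (v e) * (1 - occ (η₀ ω) e.1) * f (η₀ ω) -
          occ (η₀ ω) e.1 * (1 - occ (η₀ ω) (v e)) * f (η₀ ω)) ∂P := by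
        rw [integral_sub hi' (hi _ _), integral_sub (hi _ _) (hi _ _), hswap]
    _ = _ := by
        refine integral_congr_ae (ae_of_all _ fun ω => ?_)
        simp only
        ring

/-- The sum over the sites of the ring of the values at the neighbours. -/
lemma sum_ringTarget (K : ℕ) (d : Bool) (g : ℤ → ℝ) :
    ∑ i ∈ Finset.Icc (-(K : ℤ)) K, g (ringTarget K (i, d)) = ∑ i ∈ Finset.Icc (-(K : ℤ)) K, g i := by
  refine Finset.sum_bij' (fun i _ => ringTarget K (i, d)) (fun i _ => ringTarget K (i, !d)) ?_ ?_ ?_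
    ?_ (fun _ _ => rfl) <;>
  · intro i hi
    rw [Finset.mem_Icc] at hi
    cases d <;>
    · simp only [ringTarget, target, Finset.mem_Icc, Prod.mk.injEq, Bool.not_false, Bool.not_true,
        Bool.true_eq_false, Bool.false_eq_true, and_false, and_true, if_false, if_true]
      split_ifs <;> omega

/-- The weight of a clock depends only on its direction, and for each direction the targets permute
the sites of the ring, so the gradients sum to zero. -/
lemma sum_onlyProb_mul (p q : ℝ≥0) (K : ℕ) (t : ℝ≥0) (m : ℕ) (g : ℤ → ℝ) :
    ∑ e ∈ ringClocks K, onlyProb p q K t m e * (g (ringTarget K e) - g e.1) = 0 := by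
  rw [ringClocks, Finset.sum_product_right]
  refine Finset.sum_eq_zero fun d _ => ?_
  have : ∀ i, onlyProb p q K t m (i, d) = onlyProb p q K t m (0, d) := fun i => rfl
  simp only [this]
  rw [← Finset.mul_sum, Finset.sum_sub_distrib, sum_ringTarget, sub_self, mul_zero]

/-- The Bernoulli measure is stationary for the discretized dynamics on the ring. -/
lemma IsInput.integral_gridConfig (h : IsInput P p q ρ Set.univ N η₀) (K : ℕ) (t : ℝ≥0)
    (m k : ℕ) {f : Config → ℝ} (hf : Measurable f) {C : ℝ} (hC : ∀ η, |f η| ≤ C) :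
    ∫ ω, f (gridConfig K (increment (N ω) t m) k (η₀ ω)) ∂P = ∫ ω, f (η₀ ω) ∂P := by
  classical
  induction k generalizing f C with
  | zero => rfl
  | succ k ih =>
    have hg : ∀ e, Measurable fun η => f (configJump (ringTarget K) e η) - f η := fun e =>
      (hf.comp (measurable_configJump _ e)).sub hf
    have hgC : ∀ e η, |f (configJump (ringTarget K) e η) - f η| ≤ C + C := fun e η =>
      (abs_sub _ _).trans (add_le_add (hC _) (hC _))
    have hGm := measurable_gridConfig_comp h K t m k
    have hint0 : Integrable (fun ω => f (gridConfig K (increment (N ω) t m) k (η₀ ω))) P :=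
      integrable_of_abs_le (hf.comp hGm) fun ω => hC _
    have hOnly : ∀ e, MeasurableSet
        {ω | Only (ringClocks K) (fun e => increment (N ω) t m e k) e} := fun e =>
      (measurable_pi_lambda _ fun e' => (h.poisson e').measurable_sub _ _ :
        Measurable fun ω e => increment (N ω) t m e k) (measurableSet_only _ e)
    have hint1 : ∀ e, Integrable (fun ω =>
        ({ω | Only (ringClocks K) (fun e => increment (N ω) t m e k) e}.indicator 1 ω : ℝ) *
        (f (configJump (ringTarget K) e (gridConfig K (increment (N ω) t m) k (η₀ ω))) -
          f (gridConfig K (increment (N ω) t m) k (η₀ ω)))) P := fun e => by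
      refine integrable_of_abs_le (C := C + C)
        ((measurable_one.indicator (hOnly e)).mul ((hg e).comp hGm)) fun ω => ?_
      rw [abs_mul]
      refine (mul_le_mul_of_nonneg_right (c := 1) ?_ (abs_nonneg _)).trans ?_
      · rw [Set.indicator_apply]; split_ifs <;> simp
      · rw [one_mul]; exact hgC e _
    have hstep : ∀ ω, f (gridConfig K (increment (N ω) t m) (k + 1) (η₀ ω)) =
        f (gridConfig K (increment (N ω) t m) k (η₀ ω)) + ∑ e ∈ ringClocks K,
        ({ω | Only (ringClocks K) (fun e => increment (N ω) t m e k) e}.indicator 1 ω : ℝ) *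
        (f (configJump (ringTarget K) e (gridConfig K (increment (N ω) t m) k (η₀ ω))) -
          f (gridConfig K (increment (N ω) t m) k (η₀ ω))) := fun ω => by
      rw [gridConfig_succ (h := f)]
      refine congrArg₂ _ rfl (Finset.sum_congr rfl fun e _ => ?_)
      rw [Set.indicator_apply]
      rfl
    simp only [hstep]
    rw [integral_add hint0 (integrable_finsetSum _ fun e _ => hint1 e), ih hf hC,
      integral_finsetSum _ fun e _ => hint1 e]
    -- The ring in step `k` is independent of the present state, whose law is the initial one by
    -- induction.
    have : ∑ e ∈ ringClocks K, ∫ ω,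
        ({ω | Only (ringClocks K) (fun e => increment (N ω) t m e k) e}.indicator 1 ω : ℝ) *
        (f (configJump (ringTarget K) e (gridConfig K (increment (N ω) t m) k (η₀ ω))) -
          f (gridConfig K (increment (N ω) t m) k (η₀ ω))) ∂P =
        ∑ e ∈ ringClocks K, onlyProb p q K t m e *
          ∫ ω, (occ (η₀ ω) (ringTarget K e) - occ (η₀ ω) e.1) * f (η₀ ω) ∂P := by
      refine Finset.sum_congr rfl fun e he => ?_
      rw [h.integral_only_mul K t m k he (hg e), ih (hg e) (hgC e),
        h.integral_configJump_sub _ e hf hC]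
    rw [this]
    simp_rw [← integral_const_mul]
    rw [← integral_finsetSum]
    · have h0 : ∀ ω, ∑ e ∈ ringClocks K, onlyProb p q K t m e *
          ((occ (η₀ ω) (ringTarget K e) - occ (η₀ ω) e.1) * f (η₀ ω)) = 0 := fun ω => by
        simp_rw [← mul_assoc]
        rw [← Finset.sum_mul, sum_onlyProb_mul, zero_mul]
      simp only [h0, integral_zero, add_zero]
    · intro e _
      refine Integrable.const_mul (integrable_of_abs_le (C := C)
        (((((measurable_occ _).sub (measurable_occ _)).mul hf)).comp h.measurable_init)
        fun ω => ?_) _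
      rw [Function.comp_def]
      simp only [Pi.mul_apply, Pi.sub_apply]
      rw [abs_mul]
      refine (mul_le_mul_of_nonneg_right (c := 1) ?_ (abs_nonneg _)).trans ?_
      · unfold occ; split_ifs <;> norm_num
      · rw [one_mul]; exact hC _

/-- The mean current of the discretized dynamics on the ring, weighted with a conserved quantity. -/
lemma IsInput.integral_gridCurrent_mul (h : IsInput P p q ρ Set.univ N η₀) {K : ℕ} (hK : 1 ≤ K)
    (t : ℝ≥0) (m k : ℕ) {W : Config → ℝ} (hW : Measurable W) {C : ℝ} (hC : ∀ η, |W η| ≤ C)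
    (hcons : ∀ d k η, W (gridConfig K d k η) = W η) :
    ∫ ω, gridCurrent K (increment (N ω) t m) k (η₀ ω) * W (η₀ ω) ∂P =
      k * (onlyProb p q K t m (0, true) * ∫ ω, crossing (0, true) (η₀ ω) * W (η₀ ω) ∂P +
        onlyProb p q K t m (1, false) * ∫ ω, crossing (1, false) (η₀ ω) * W (η₀ ω) ∂P) := by
  classical
  have hfm : ∀ e, Measurable fun η => crossing e η * W η := fun e =>
    (measurable_crossing e).mul hW
  have hfC : ∀ e η, |crossing e η * W η| ≤ C := fun e η => by
    rw [abs_mul]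
    exact (mul_le_mul (abs_crossing_le e η) (hC η) (abs_nonneg _) zero_le_one).trans (one_mul C).le
  have hOnly : ∀ k e, MeasurableSet
      {ω | Only (ringClocks K) (fun e => increment (N ω) t m e k) e} := fun k e =>
    (measurable_pi_lambda _ fun e' => (h.poisson e').measurable_sub _ _ :
      Measurable fun ω e => increment (N ω) t m e k) (measurableSet_only _ e)
  have hint1 : ∀ k e, Integrable (fun ω =>
      ({ω | Only (ringClocks K) (fun e => increment (N ω) t m e k) e}.indicator 1 ω : ℝ) *
      (crossing e (gridConfig K (increment (N ω) t m) k (η₀ ω)) *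
        W (gridConfig K (increment (N ω) t m) k (η₀ ω)))) P := fun k e => by
    refine integrable_of_abs_le (C := C) ((measurable_one.indicator (hOnly k e)).mul
      ((hfm e).comp (measurable_gridConfig_comp h K t m k))) fun ω => ?_
    rw [abs_mul]
    refine (mul_le_mul_of_nonneg_right (c := 1) ?_ (abs_nonneg _)).trans ?_
    · rw [Set.indicator_apply]; split_ifs <;> simp
    · rw [one_mul]; exact hfC e _
  -- Conservation replaces `W (η₀ ω)` by `W` of the present state, so that the summand is a function
  -- of that state alone and stationarity applies.
  have hstep : ∀ k ω, gridCurrent K (increment (N ω) t m) (k + 1) (η₀ ω) * W (η₀ ω) =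
      gridCurrent K (increment (N ω) t m) k (η₀ ω) * W (η₀ ω) + ∑ e ∈ ringClocks K,
      ({ω | Only (ringClocks K) (fun e => increment (N ω) t m e k) e}.indicator 1 ω : ℝ) *
      (crossing e (gridConfig K (increment (N ω) t m) k (η₀ ω)) *
        W (gridConfig K (increment (N ω) t m) k (η₀ ω))) := fun k ω => by
    rw [gridCurrent_succ, add_mul, Finset.sum_mul, hcons]
    refine congrArg₂ _ rfl (Finset.sum_congr rfl fun e _ => ?_)
    rw [Set.indicator_apply, mul_assoc]
    rfl
  have hint0 : ∀ k, Integrable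
      (fun ω => gridCurrent K (increment (N ω) t m) k (η₀ ω) * W (η₀ ω)) P := by
    intro k
    induction k with
    | zero => simp [gridCurrent, gridList, crossings]
    | succ k ih =>
      simp only [hstep]
      exact ih.add (integrable_finsetSum _ fun e _ => hint1 k e)
  induction k with
  | zero => simp [gridCurrent, gridList, crossings]
  | succ k ih =>
    simp only [hstep]
    rw [integral_add (hint0 k) (integrable_finsetSum _ fun e _ => hint1 k e), ih,
      integral_finsetSum _ fun e _ => hint1 k e]
    have : ∑ e ∈ ringClocks K, ∫ ω,
        ({ω | Only (ringClocks K) (fun e => increment (N ω) t m e k) e}.indicator 1 ω : ℝ) *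
        (crossing e (gridConfig K (increment (N ω) t m) k (η₀ ω)) *
          W (gridConfig K (increment (N ω) t m) k (η₀ ω))) ∂P =
        ∑ e ∈ ringClocks K, onlyProb p q K t m e * ∫ ω, crossing e (η₀ ω) * W (η₀ ω) ∂P := by
      refine Finset.sum_congr rfl fun e he => ?_
      rw [h.integral_only_mul K t m k he (hfm e), h.integral_gridConfig K t m k (hfm e) (hfC e)]
    rw [this, Finset.sum_eq_add (0, true) (1, false) (by simp)]
    · push_cast; ring
    · rintro e _ ⟨h1, h2⟩
      simp [crossing, h1, h2]
    · intro hn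
      exact absurd (mem_ringClocks.2 (by constructor <;> simp)) hn
    · intro hn
      exact absurd (mem_ringClocks.2 ⟨by simp only; omega, by simp only; omega⟩) hn

end Input

/-! ### Functionals that are measurable at the good realizations of the clocks -/

/-- At the good realizations of the clocks, `F` agrees with a measurable functional. -/
def GoodMeasurable (F : Clocks → Config → ℝ) : Prop :=
  ∃ G : Clocks × Config → ℝ, Measurable G ∧ ∀ n, Good n → ∀ η, G (n, η) = F n η

namespace GoodMeasurable

variable {F F' : Clocks → Config → ℝ}

lemma of_measurable (h : Measurable fun x : Clocks × Config => F x.1 x.2) : GoodMeasurable F :=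
  ⟨_, h, fun _ _ _ => rfl⟩

/-- A `limsup` of measurable functions is measurable everywhere and equals the eventual value at
good clocks. -/
lemma of_eventually {F' : ℕ → Clocks → Config → ℝ} (h : ∀ m, GoodMeasurable (F' m))
    (hF : ∀ n, Good n → ∀ η, ∀ᶠ m in atTop, F' m n η = F n η) : GoodMeasurable F := by
  choose G hG hGF using h
  refine ⟨fun x => limsup (fun m => G m x) atTop, Measurable.limsup hG, fun n hn η => ?_⟩
  refine Tendsto.limsup_eq (tendsto_const_nhds.congr' ?_)
  filter_upwards [hF n hn η] with m hm
  rw [hGF m n hn η, hm]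

lemma sub (h : GoodMeasurable F) (h' : GoodMeasurable F') :
    GoodMeasurable fun n η => F n η - F' n η := by
  obtain ⟨G, hG, hGF⟩ := h
  obtain ⟨G', hG', hGF'⟩ := h'
  exact ⟨_, hG.sub hG', fun n hn η => by simp only [Pi.sub_apply, hGF n hn, hGF' n hn]⟩

lemma mul (h : GoodMeasurable F) (h' : GoodMeasurable F') :
    GoodMeasurable fun n η => F n η * F' n η := by
  obtain ⟨G, hG, hGF⟩ := h
  obtain ⟨G', hG', hGF'⟩ := h'
  exact ⟨_, hG.mul hG', fun n hn η => by simp only [Pi.mul_apply, hGF n hn, hGF' n hn]⟩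

lemma sum {ι : Type*} (I : Finset ι) {F : ι → Clocks → Config → ℝ}
    (h : ∀ i, GoodMeasurable (F i)) : GoodMeasurable fun n η => ∑ i ∈ I, F i n η := by
  choose G hG hGF using h
  exact ⟨fun x => ∑ i ∈ I, G i x, Finset.measurable_fun_sum I fun i _ => hG i, fun n hn η =>
    Finset.sum_congr rfl fun i _ => hGF i n hn η⟩

lemma comp_config (h : GoodMeasurable F) {φ : Config → Config} (hφ : Measurable φ) :
    GoodMeasurable fun n η => F n (φ η) := by
  obtain ⟨G, hG, hGF⟩ := h
  exact ⟨fun x => G (x.1, φ x.2), hG.comp (measurable_fst.prodMk (hφ.comp measurable_snd)),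
    fun n hn η => hGF n hn _⟩

lemma occ_init (i : ℤ) : GoodMeasurable fun _ η => occ η i :=
  of_measurable ((measurable_occ i).comp measurable_snd)

lemma occ_ringConfig (K : ℕ) (t : ℝ≥0) (i : ℤ) : GoodMeasurable fun n η => occ (ringConfig K n η t) i :=
  of_eventually (F' := fun m n η => occ (gridConfig K (increment n t m) m η) i)
    (fun m => of_measurable ((measurable_occ i).comp ((measurable_gridConfig K m).comp
      (((measurable_increment t m).comp measurable_fst).prodMk measurable_snd))))
    fun n hn η => (eventually_gridConfig_eq hn K t η).mono fun m hm => by rw [hm]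

lemma ringCurrent (K : ℕ) (t : ℝ≥0) : GoodMeasurable fun n η => ringCurrent K n η t :=
  of_eventually (F' := fun m n η => gridCurrent K (increment n t m) m η)
    (fun m => of_measurable ((measurable_gridCurrent K m).comp
      (((measurable_increment t m).comp measurable_fst).prodMk measurable_snd)))
    fun _ hn η => eventually_gridCurrent_eq hn K t η

end GoodMeasurable

lemma eventually_ringConfig_eq {n : Clocks} (hn : Good n) (t : ℝ≥0) (η : Config) (I : Finset ℤ) :
    ∀ᶠ K in atTop, ∀ i ∈ I, ringConfig K n η t i = process n η t i := by
  obtain ⟨c, hc⟩ : ∃ c : ℕ, ∀ i ∈ I, |i| ≤ c := by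
    refine ⟨∑ i ∈ I, i.natAbs, fun i hi => ?_⟩
    rw [Int.abs_eq_natAbs]
    exact_mod_cast Finset.single_le_sum (f := Int.natAbs) (fun _ _ => Nat.zero_le _) hi
  obtain ⟨a, b, ha, hb, hba, hbb⟩ := exists_block hn t (-c) c
  filter_upwards [eventually_gt_atTop (a.natAbs + b.natAbs)] with K hK i hi
  have := abs_le.1 (hc i hi)
  exact (process_eq_ringConfig hn η hba hbb (by omega) (by omega) le_rfl (by omega)
    (by omega)).symm

lemma eventually_ringCurrent_eq {n : Clocks} (hn : Good n) (t : ℝ≥0) (η : Config) :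
    ∀ᶠ K in atTop, ringCurrent K n η t = current n η 0 t := by
  obtain ⟨K₀, hK₀⟩ := ringCurrent_eq_current hn t
  filter_upwards [eventually_ge_atTop K₀] with K hK
  exact hK₀ K hK η

namespace GoodMeasurable

lemma occ_process (t : ℝ≥0) (i : ℤ) : GoodMeasurable fun n η => occ (process n η t) i :=
  of_eventually (fun K => occ_ringConfig K t i) fun n hn η =>
    (eventually_ringConfig_eq hn t η {i}).mono fun K hK => by
      simp only [occ, hK i (Finset.mem_singleton_self i)]

lemma current (t : ℝ≥0) : GoodMeasurable fun n η => (current n η 0 t : ℝ) :=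
  of_eventually (fun K => ringCurrent K t) fun _ hn η => eventually_ringCurrent_eq hn t η

end GoodMeasurable

/-- `m * (exp (r t / m) - 1)` tends to `r t`, while the probability that all clocks of the ring stay
silent in one interval tends to `1`. -/
lemma tendsto_mul_onlyProb (p q : ℝ≥0) (K : ℕ) (t : ℝ≥0) (e : ClockIndex) :
    Tendsto (fun m : ℕ => m * onlyProb p q K t m e) atTop (𝓝 (rate p q e * t)) := by
  have hinv : Tendsto (fun m : ℕ => (t : ℝ) / m) atTop (𝓝 0) :=
    tendsto_const_nhds.div_atTop tendsto_natCast_atTop_atTop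
  have h1 : Tendsto (fun m : ℕ => (m : ℝ) * (Real.exp (rate p q e * (t / m)) - 1)) atTop
      (𝓝 (rate p q e * t)) := by
    have hd : HasDerivAt (fun x : ℝ => Real.exp (rate p q e * t * x)) (rate p q e * t) 0 := by
      have := ((hasDerivAt_id (0 : ℝ)).const_mul (rate p q e * t : ℝ)).exp
      simpa using this
    have hs := hd.tendsto_slope_zero_right
    have hm : Tendsto (fun m : ℕ => ((m : ℝ))⁻¹) atTop (𝓝[>] 0) :=
      tendsto_inv_atTop_nhdsGT_zero.comp tendsto_natCast_atTop_atTop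
    refine (hs.comp hm).congr fun m => ?_
    simp only [Function.comp, zero_add, mul_zero, Real.exp_zero, inv_inv, smul_eq_mul]
    rw [div_eq_mul_inv, mul_assoc]
  have h2 : Tendsto (fun m : ℕ => ∏ e' ∈ ringClocks K, Real.exp (-(rate p q e' * ((t : ℝ) / m))))
      atTop (𝓝 1) := by
    have : Tendsto (fun m : ℕ => ∏ e' ∈ ringClocks K,
        Real.exp (-(rate p q e' * ((t : ℝ) / m)))) atTop (𝓝 (∏ e' ∈ ringClocks K,
          Real.exp (-(rate p q e' * (0 : ℝ))))) :=
      tendsto_finsetProd _ fun e' _ => (Real.continuous_exp.tendsto _).comp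
        ((hinv.const_mul _).neg)
    simpa using this
  have := h1.mul h2
  rw [mul_one] at this
  exact this.congr fun m => by rw [onlyProb, mul_assoc]

section Input

variable {Ω : Type*} [MeasurableSpace Ω] {P : Measure Ω} [IsProbabilityMeasure P] {p q : ℝ≥0}
  {ρ : ℝ} {A : Set ℤ} {N : Ω → Clocks} {η₀ : Ω → Config}

lemma GoodMeasurable.aemeasurable {F : Clocks → Config → ℝ} (hF : GoodMeasurable F)
    (h : IsInput P p q ρ A N η₀) (hpq : p + q = 1) :
    AEMeasurable (fun ω => F (N ω) (η₀ ω)) P := by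
  obtain ⟨G, hG, hGF⟩ := hF
  refine ⟨fun ω => G (N ω, η₀ ω), hG.comp (h.measurable_clocks.prodMk h.measurable_init), ?_⟩
  filter_upwards [h.ae_good hpq] with ω hω
  exact (hGF _ hω _).symm

lemma GoodMeasurable.integrable {F : Clocks → Config → ℝ} (hF : GoodMeasurable F)
    (h : IsInput P p q ρ A N η₀) (hpq : p + q = 1) {C : ℝ} (hC : ∀ n η, |F n η| ≤ C) :
    Integrable (fun ω => F (N ω) (η₀ ω)) P :=
  Integrable.of_bound (hF.aemeasurable h hpq).aestronglyMeasurable C (ae_of_all _ fun _ => hC _ _)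

lemma GoodMeasurable.memLp_two {F : Clocks → Config → ℝ} (hF : GoodMeasurable F)
    (h : IsInput P p q ρ A N η₀) (hpq : p + q = 1) {C : ℝ} (hC : ∀ n η, |F n η| ≤ C) :
    MemLp (fun ω => F (N ω) (η₀ ω)) 2 P :=
  MemLp.of_bound (hF.aemeasurable h hpq).aestronglyMeasurable C (ae_of_all _ fun _ => hC _ _)

lemma IsInput.aemeasurable_process (h : IsInput P p q ρ A N η₀) (hpq : p + q = 1) (t : ℝ≥0) :
    AEMeasurable (fun ω => process (N ω) (η₀ ω) t) P := by
  refine aemeasurable_pi_iff.2 fun i => ?_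
  have h1 := (GoodMeasurable.occ_process t i).aemeasurable h hpq
  have h2 : Measurable fun x : ℝ => decide (x = 1) :=
    measurable_to_bool (by
      have : (fun x : ℝ => decide (x = 1)) ⁻¹' {true} = {1} := by ext; simp
      rw [this]; exact measurableSet_singleton 1)
  convert h2.comp_aemeasurable h1 using 1
  funext ω
  cases h : process (N ω) (η₀ ω) t i <;> simp [occ, h]

lemma IsInput.integrable_bondRings (h : IsInput P p q ρ A N η₀) (t : ℝ≥0) :
    Integrable (fun ω => bondRings (N ω) t) P := (h.memLp_bondRings t).integrable one_le_two

lemma IsInput.integrable_of_le_bondRings (h : IsInput P p q ρ A N η₀) (hpq : p + q = 1)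
    {F : Clocks → Config → ℝ} (hF : GoodMeasurable F) {t : ℝ≥0}
    (hb : ∀ n, Good n → ∀ η, |F n η| ≤ bondRings n t) {φ : Config → Config} (hφ : Measurable φ) :
    Integrable (fun ω => F (N ω) (φ (η₀ ω))) P := by
  refine (h.integrable_bondRings t).mono'
    ((hF.comp_config hφ).aemeasurable h hpq).aestronglyMeasurable ?_
  filter_upwards [h.ae_good hpq] with ω hω
  exact hb _ hω _

lemma IsInput.memLp_of_le_bondRings (h : IsInput P p q ρ A N η₀) (hpq : p + q = 1)
    {F : Clocks → Config → ℝ} (hF : GoodMeasurable F) {t : ℝ≥0}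
    (hb : ∀ n, Good n → ∀ η, |F n η| ≤ bondRings n t) :
    MemLp (fun ω => F (N ω) (η₀ ω)) 2 P := by
  refine (h.memLp_bondRings t).mono (hF.aemeasurable h hpq).aestronglyMeasurable ?_
  filter_upwards [h.ae_good hpq] with ω hω
  rw [Real.norm_eq_abs, Real.norm_of_nonneg (bondRings_nonneg _ _)]
  exact hb _ hω _

/-! ### Passage to the limit -/

lemma IsInput.integral_ringConfig (h : IsInput P p q ρ Set.univ N η₀) (hpq : p + q = 1) (K : ℕ)
    (t : ℝ≥0) {f : Config → ℝ} (hf : Measurable f) {C : ℝ} (hC : ∀ η, |f η| ≤ C) :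
    ∫ ω, f (ringConfig K (N ω) (η₀ ω) t) ∂P = ∫ ω, f (η₀ ω) ∂P := by
  have hlim := tendsto_integral_of_dominated_convergence (μ := P)
    (F := fun m ω => f (gridConfig K (increment (N ω) t m) m (η₀ ω)))
    (f := fun ω => f (ringConfig K (N ω) (η₀ ω) t)) (fun _ => C)
    (fun m => (hf.comp (measurable_gridConfig_comp h K t m m)).aestronglyMeasurable)
    (integrable_const C) (fun m => ae_of_all _ fun ω => hC _) (by
      filter_upwards [h.ae_good hpq] with ω hω
      exact tendsto_const_nhds.congr' ((eventually_gridConfig_eq hω K t (η₀ ω)).mono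
        fun m hm => by simp only [hm]))
  refine tendsto_nhds_unique hlim ?_
  simp only [h.integral_gridConfig K t _ _ hf hC]
  exact tendsto_const_nhds

/-- The Bernoulli measure is stationary. -/
lemma IsInput.integral_process (h : IsInput P p q ρ Set.univ N η₀) (hpq : p + q = 1) (t : ℝ≥0)
    {f : Config → ℝ} (hf : Measurable f) {C : ℝ} (hC : ∀ η, |f η| ≤ C) {I : Finset ℤ}
    (hI : ∀ η ζ : Config, (∀ i ∈ I, η i = ζ i) → f η = f ζ) :
    ∫ ω, f (process (N ω) (η₀ ω) t) ∂P = ∫ ω, f (η₀ ω) ∂P := by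
  have hG : ∀ K, GoodMeasurable fun n η => f (ringConfig K n η t) := fun K =>
    GoodMeasurable.of_eventually (F' := fun m n η => f (gridConfig K (increment n t m) m η))
      (fun m => GoodMeasurable.of_measurable (hf.comp ((measurable_gridConfig K m).comp
        (((measurable_increment t m).comp measurable_fst).prodMk measurable_snd))))
      fun n hn η => (eventually_gridConfig_eq hn K t η).mono fun m hm => by rw [hm]
  have hlim := tendsto_integral_of_dominated_convergence (μ := P)
    (F := fun K ω => f (ringConfig K (N ω) (η₀ ω) t))
    (f := fun ω => f (process (N ω) (η₀ ω) t)) (fun _ => C)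
    (fun K => ((hG K).aemeasurable h hpq).aestronglyMeasurable)
    (integrable_const C) (fun m => ae_of_all _ fun ω => hC _) (by
      filter_upwards [h.ae_good hpq] with ω hω
      -- Large rings agree with the line only on finite sets of sites, hence the restriction to
      -- functions of the sites in `I`.
      exact tendsto_const_nhds.congr' ((eventually_ringConfig_eq hω t (η₀ ω) I).mono
        fun m hm => (hI _ _ hm).symm))
  refine tendsto_nhds_unique hlim ?_
  simp only [h.integral_ringConfig hpq _ t hf hC]
  exact tendsto_const_nhds

lemma sum_occ_ringConserved (K : ℕ) (d : ClockIndex → ℕ → ℕ) (k : ℕ) (η : Config) (ρ : ℝ) :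
    ∑ i ∈ Finset.Icc (-(K : ℤ)) K, (occ (gridConfig K d k η) i - ρ) =
      ∑ i ∈ Finset.Icc (-(K : ℤ)) K, (occ η i - ρ) := by
  rw [Finset.sum_sub_distrib, Finset.sum_sub_distrib, sum_occ_gridConfig]

lemma IsInput.integral_ringCurrent_mul (h : IsInput P p q ρ Set.univ N η₀) (hpq : p + q = 1)
    {K : ℕ} (hK : 1 ≤ K) (t : ℝ≥0) {W : Config → ℝ} (hW : Measurable W) {C : ℝ}
    (hC : ∀ η, |W η| ≤ C) (hcons : ∀ d k η, W (gridConfig K d k η) = W η) :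
    ∫ ω, ringCurrent K (N ω) (η₀ ω) t * W (η₀ ω) ∂P =
      t * (p * ∫ ω, crossing (0, true) (η₀ ω) * W (η₀ ω) ∂P +
        q * ∫ ω, crossing (1, false) (η₀ ω) * W (η₀ ω) ∂P) := by
  -- The grids have `m + 1` intervals because the bound by `bondRings` fails to be available for an
  -- empty grid.
  have hlim := tendsto_integral_of_dominated_convergence (μ := P)
    (F := fun m ω => gridCurrent K (increment (N ω) t (m + 1)) (m + 1) (η₀ ω) * W (η₀ ω))
    (f := fun ω => ringCurrent K (N ω) (η₀ ω) t * W (η₀ ω)) (fun ω => bondRings (N ω) t * C)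
    (fun m => ((measurable_gridCurrent_comp h K t (m + 1) (m + 1)).mul
      (hW.comp h.measurable_init)).aestronglyMeasurable)
    ((h.integrable_bondRings t).mul_const C) (fun m => by
      filter_upwards [h.ae_good hpq] with ω hω
      rw [Real.norm_eq_abs, abs_mul]
      exact mul_le_mul (abs_gridCurrent_le hω K t m.succ_ne_zero _) (hC _) (abs_nonneg _)
        (bondRings_nonneg _ _)) (by
      filter_upwards [h.ae_good hpq] with ω hω
      refine tendsto_const_nhds.congr' (((tendsto_add_atTop_nat 1).eventually
        (eventually_gridCurrent_eq hω K t (η₀ ω))).mono fun m hm => ?_)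
      simp only [hm])
  refine tendsto_nhds_unique hlim ?_
  simp only [h.integral_gridCurrent_mul hK t _ _ hW hC hcons]
  set a := ∫ ω, crossing (0, true) (η₀ ω) * W (η₀ ω) ∂P
  set b := ∫ ω, crossing (1, false) (η₀ ω) * W (η₀ ω) ∂P
  have h1 := (tendsto_mul_onlyProb p q K t (0, true)).comp (tendsto_add_atTop_nat 1)
  have h2 := (tendsto_mul_onlyProb p q K t (1, false)).comp (tendsto_add_atTop_nat 1)
  have h3 := (h1.mul_const a).add (h2.mul_const b)
  have hlimeq : (t : ℝ) * (p * a + q * b) =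
      rate p q (0, true) * t * a + rate p q (1, false) * t * b := by
    simp only [rate, if_true, Bool.false_eq_true, if_false]; ring
  rw [hlimeq]
  refine h3.congr fun m => ?_
  simp only [Function.comp]
  ring

/-! ### Bernoulli moments and conditioning on one occupation variable -/

omit [IsProbabilityMeasure P] in
lemma IsInput.integral_occ (h : IsInput P p q ρ A N η₀) (hρ : 0 ≤ ρ) {i : ℤ} (hi : i ∈ A) :
    ∫ ω, occ (η₀ ω) i ∂P = ρ := by
  have hm : MeasurableSet {ω | η₀ ω i = true} :=
    ((measurable_pi_apply i).comp h.measurable_init) (measurableSet_singleton true)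
  have : ∀ ω, occ (η₀ ω) i = {ω | η₀ ω i = true}.indicator 1 ω := fun ω => by
    simp only [occ, Set.indicator_apply, Set.mem_ofPred_eq, Pi.one_apply]
  simp only [this]
  rw [integral_indicator_one hm, measureReal_def, h.mean_init i hi, ENNReal.toReal_ofReal hρ]

lemma measurable_update_config (k : ℤ) (b : Bool) :
    Measurable fun η : Config => Function.update η k b :=
  measurable_update'.comp (measurable_id.prodMk measurable_const)

/-- The covariance with an initial occupation variable is the effect of adding a particle. -/
lemma IsInput.integral_mul_occ_sub (h : IsInput P p q ρ Set.univ N η₀) (hpq : p + q = 1)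
    (hρ : 0 ≤ ρ) {F : Clocks → Config → ℝ} (hF : GoodMeasurable F) (k : ℤ)
    (hint : ∀ b, Integrable (fun ω => F (N ω) (Function.update (η₀ ω) k b)) P) :
    ∫ ω, F (N ω) (η₀ ω) * (occ (η₀ ω) k - ρ) ∂P =
      ρ * (1 - ρ) * ∫ ω, (F (N ω) (Function.update (η₀ ω) k true) -
        F (N ω) (Function.update (η₀ ω) k false)) ∂P := by
  obtain ⟨G, hG, hGF⟩ := hF
  have hη := h.measurable_init
  have hX : Measurable fun ω => η₀ ω k := (measurable_pi_apply k).comp hη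
  have hY : Measurable fun ω => Function.update (η₀ ω) k false :=
    (measurable_update_config k false).comp hη
  have h1 : IndepFun (fun ω => η₀ ω k) (fun ω => Function.update (η₀ ω) k false) P :=
    indepFun_of_dependsOn h.iIndepFun_init (fun i => (measurable_pi_apply i).comp hη)
      (Φ := fun η : Config => η k) (Ψ := fun η : Config => Function.update η k false)
      (measurable_pi_apply k) (measurable_update_config k false) (S := {k}) (T := {k}ᶜ)
      (fun x y hxy => hxy k rfl)
      (fun x y hxy => by
        funext i
        by_cases hi : i = k
        · subst hi; simp
        · simp only [Function.update_of_ne hi]; exact hxy i hi)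
      disjoint_compl_right
  have h2 : IndepFun N (fun ω => (η₀ ω k, Function.update (η₀ ω) k false)) P :=
    h.indep.comp measurable_id ((measurable_pi_apply k).prodMk (measurable_update_config k false))
  have h3 := indepFun_prod_of_indepFun hX hY h.measurable_clocks h1 h2
  have hg : ∀ b, Measurable fun x : Clocks × Config => G (x.1, Function.update x.2 k b) := fun b =>
    hG.comp (measurable_fst.prodMk ((measurable_update_config k b).comp measurable_snd))
  have hbool : Measurable fun b : Bool => if b then (1 : ℝ) else 0 := measurable_of_countable _
  have hgood : ∀ b, (fun ω => F (N ω) (Function.update (η₀ ω) k b)) =ᵐ[P]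
      fun ω => G (N ω, Function.update (η₀ ω) k b) := fun b => by
    filter_upwards [h.ae_good hpq] with ω hω
    exact (hGF _ hω _).symm
  have hgi : ∀ b, Integrable (fun ω => G (N ω, Function.update (η₀ ω) k b)) P := fun b =>
    (hint b).congr (hgood b)
  have hprod : ∀ b, ∫ ω, occ (η₀ ω) k * G (N ω, Function.update (η₀ ω) k b) ∂P =
      ρ * ∫ ω, G (N ω, Function.update (η₀ ω) k b) ∂P := fun b => by
    have := (h3.comp hbool (hg b)).integral_fun_mul_eq_mul_integral
      (hbool.comp hX).aestronglyMeasurable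
      ((hg b).comp (h.measurable_clocks.prodMk hY)).aestronglyMeasurable
    simp only [Function.comp_def, Function.update_idem] at this
    rw [← h.integral_occ hρ (Set.mem_univ k)]
    exact this
  have hpi : ∀ b, Integrable (fun ω => occ (η₀ ω) k * G (N ω, Function.update (η₀ ω) k b)) P :=
    fun b => (hgi b).bdd_mul (c := 1) ((measurable_occ k).comp hη).aestronglyMeasurable
      (ae_of_all _ fun ω => by
        rw [Real.norm_of_nonneg (occ_nonneg _ _)]; exact occ_le_one _ _)
  -- Splitting according to the bit at `k` expresses the product through functionals that do not
  -- read that bit, times `occ (η₀ ω) k` or a constant.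
  have hpt : (fun ω => F (N ω) (η₀ ω) * (occ (η₀ ω) k - ρ)) =ᵐ[P] fun ω =>
      ((1 - ρ) * (occ (η₀ ω) k * G (N ω, Function.update (η₀ ω) k true)) +
        ρ * (occ (η₀ ω) k * G (N ω, Function.update (η₀ ω) k false))) -
        ρ * G (N ω, Function.update (η₀ ω) k false) := by
    filter_upwards [h.ae_good hpq] with ω hω
    rw [← hGF _ hω]
    cases hk : η₀ ω k
    · have : Function.update (η₀ ω) k false = η₀ ω := by rw [← hk, Function.update_eq_self]
      simp [occ, hk, this]; ring
    · have : Function.update (η₀ ω) k true = η₀ ω := by rw [← hk, Function.update_eq_self]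
      simp [occ, hk, this]; ring
  have hsum : Integrable (fun ω =>
      (1 - ρ) * (occ (η₀ ω) k * G (N ω, Function.update (η₀ ω) k true)) +
        ρ * (occ (η₀ ω) k * G (N ω, Function.update (η₀ ω) k false))) P :=
    ((hpi true).const_mul _).add ((hpi false).const_mul _)
  rw [integral_congr_ae hpt, integral_sub hsum ((hgi false).const_mul _), integral_add ((hpi true).const_mul _) ((hpi false).const_mul _),
    integral_const_mul, integral_const_mul, integral_const_mul, hprod, hprod,
    integral_sub (hint true) (hint false), integral_congr_ae (hgood true),
    integral_congr_ae (hgood false)]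
  ring

lemma IsInput.covariance_occ (h : IsInput P p q ρ A N η₀) (hρ : 0 ≤ ρ) {X : Ω → ℝ}
    (hX : Integrable X P) {k : ℤ} (hk : k ∈ A) :
    covariance X (fun ω => occ (η₀ ω) k) P = ∫ ω, X ω * (occ (η₀ ω) k - ρ) ∂P := by
  have hocc : Measurable fun ω => occ (η₀ ω) k - ρ :=
    ((measurable_occ k).comp h.measurable_init).sub measurable_const
  have hb : ∀ ω, ‖occ (η₀ ω) k - ρ‖ ≤ 1 + ρ := fun ω => by
    rw [Real.norm_eq_abs, abs_le]
    have := occ_nonneg (η₀ ω) k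
    have := occ_le_one (η₀ ω) k
    constructor <;> linarith
  have hi : Integrable (fun ω => occ (η₀ ω) k - ρ) P :=
    Integrable.of_bound hocc.aestronglyMeasurable _ (ae_of_all _ hb)
  have hXi : Integrable (fun ω => X ω * (occ (η₀ ω) k - ρ)) P :=
    hX.mul_bdd (c := 1 + ρ) hocc.aestronglyMeasurable (ae_of_all _ hb)
  have h0 : ∫ ω, (occ (η₀ ω) k - ρ) ∂P = 0 := by
    rw [integral_sub _ (integrable_const _), h.integral_occ hρ hk]
    · simp
    · exact (hi.add (integrable_const ρ)).congr (ae_of_all _ fun ω => by simp)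
  rw [covariance, h.integral_occ hρ hk]
  simp only [sub_mul]
  rw [integral_sub hXi (hi.const_mul _), integral_const_mul, h0, mul_zero, sub_zero]

end Input

/-! ### Uniqueness of the law of the input -/

section Law

variable {Ω Ω' : Type*} [MeasurableSpace Ω] [MeasurableSpace Ω'] {P : Measure Ω} {P' : Measure Ω'}
  [IsProbabilityMeasure P] [IsProbabilityMeasure P']

/-- A finite set of times is contained in the range of a monotone sequence that starts at `0`. -/
lemma exists_monotone_seq (I : Finset ℝ≥0) :
    ∃ τ : ℕ → ℝ≥0, Monotone τ ∧ τ 0 = 0 ∧ ∀ s ∈ I, ∃ k, τ k = s := by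
  set J := insert 0 I
  have hJ : 0 < J.card := Finset.card_pos.2 ⟨0, Finset.mem_insert_self _ _⟩
  refine ⟨fun k => J.orderEmbOfFin rfl ⟨min k (J.card - 1), by omega⟩, ?_, ?_, ?_⟩
  · intro k l hkl
    refine (J.orderEmbOfFin rfl).monotone ?_
    simp only [Fin.mk_le_mk]
    omega
  · simp only [Nat.zero_min]
    rw [Finset.orderEmbOfFin_zero rfl hJ]
    exact le_antisymm (Finset.min'_le _ _ (Finset.mem_insert_self _ _)) (zero_le)
  · intro s hs
    have : s ∈ Set.range (J.orderEmbOfFin rfl) := by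
      rw [Finset.range_orderEmbOfFin]
      exact Finset.mem_coe.2 (Finset.mem_insert_of_mem hs)
    obtain ⟨⟨k, hk⟩, rfl⟩ := this
    exact ⟨k, congrArg _ (Fin.ext (by simp only; omega))⟩

omit [IsProbabilityMeasure P] in
-- The values at finitely many times are partial sums of independent Poisson increments along an
-- increasing sequence from `0`.
lemma IsPoissonProcess.map_restrict {r : ℝ≥0} {X : ℝ≥0 → Ω → ℕ} (h : IsPoissonProcess P r X)
    {I : Finset ℝ≥0} {τ : ℕ → ℝ≥0} (hτ : Monotone τ) (h0 : τ 0 = 0) {κ : I → ℕ}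
    (hκ : ∀ s, τ (κ s) = s) :
    P.map (fun ω => I.restrict (X · ω)) =
      (Measure.infinitePi fun k => poissonMeasure (r * (τ (k + 1) - τ k))).map
        fun y s => ∑ j ∈ Finset.range (κ s), y j := by
  have hm : ∀ k, Measurable fun ω => X (τ (k + 1)) ω - X (τ k) ω := fun k => h.measurable_sub _ _
  have hlaw := (h.indep.nat hτ).map_fun_eq_infinitePi_map hm
  simp only [h.increments _ _ (hτ (Nat.le_succ _))] at hlaw
  rw [← hlaw, Measure.map_map (measurable_pi_lambda _ fun s => Finset.measurable_fun_sum _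
    fun j _ => measurable_pi_apply j) (measurable_pi_lambda _ hm)]
  refine Measure.map_congr ?_
  filter_upwards [h.zero, h.monotone] with ω hω0 hω
  funext s
  simp only [Function.comp, Finset.restrict]
  rw [Finset.sum_range_tsub (f := fun j => X (τ j) ω) (fun i j hij => hω (hτ hij)), h0, hω0, hκ]
  rfl

omit [IsProbabilityMeasure P] in
/-- The law of a Poisson process is determined by its rate. -/
lemma IsPoissonProcess.map_eq {r : ℝ≥0} {X : ℝ≥0 → Ω → ℕ} {X' : ℝ≥0 → Ω' → ℕ}
    (h : IsPoissonProcess P r X) (h' : IsPoissonProcess P' r X') :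
    P.map (fun ω t => X t ω) = P'.map fun ω t => X' t ω := by
  have h1 := isProjectiveLimit_map (P := P) (X := X)
    (measurable_pi_lambda _ h.measurable).aemeasurable
  have h2 := isProjectiveLimit_map (P := P') (X := X')
    (measurable_pi_lambda _ h'.measurable).aemeasurable
  have heq : (fun I : Finset ℝ≥0 => P.map fun ω => I.restrict (X · ω)) =
      fun I : Finset ℝ≥0 => P'.map fun ω => I.restrict (X' · ω) := by
    funext I
    obtain ⟨τ, hτ, h0, hI⟩ := exists_monotone_seq I
    choose κ hκ using fun s : I => hI s s.2
    rw [h.map_restrict hτ h0 hκ, h'.map_restrict hτ h0 hκ]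
  rw [heq] at h1
  exact h1.unique h2

variable {p q : ℝ≥0} {ρ : ℝ} {A B : Set ℤ} {N : Ω → Clocks} {η₀ : Ω → Config} {N' : Ω' → Clocks}
  {η₀' : Ω' → Config}

/-- The law of the input is determined by the parameters. -/
lemma IsInput.map_eq (h : IsInput P p q ρ B N η₀) (h' : IsInput P' p q ρ A N' η₀') (hAB : A ⊆ B) :
    P.map (fun ω => (N ω, fun i : A => η₀ ω i)) = P'.map fun ω => (N' ω, fun i : A => η₀' ω i) := by
  have hr : Measurable fun (η : Config) (i : A) => η i :=
    measurable_pi_lambda _ fun i => measurable_pi_apply (i : ℤ)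
  have hN : P.map N = P'.map N' := by
    have h1 := h.indep_clocks.map_fun_eq_infinitePi_map h.measurable_clock
    have h2 := h'.indep_clocks.map_fun_eq_infinitePi_map h'.measurable_clock
    refine h1.trans (Eq.trans ?_ h2.symm)
    congr 1
    funext e
    exact (h.poisson e).map_eq (h'.poisson e)
  have hη : P.map (fun ω (i : A) => η₀ ω i) = P'.map fun ω (i : A) => η₀' ω i := by
    have hm : ∀ i : A, Measurable fun ω => η₀ ω i := fun i =>
      (measurable_pi_apply (i : ℤ)).comp h.measurable_init
    have hm' : ∀ i : A, Measurable fun ω => η₀' ω i := fun i =>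
      (measurable_pi_apply (i : ℤ)).comp h'.measurable_init
    have hind : iIndepFun (fun (i : A) ω => η₀ ω i) P :=
      h.indep_init.precomp (g := fun i : A => (⟨i, hAB i.2⟩ : B))
        fun _ _ hij => Subtype.ext (congrArg (Subtype.val (p := (· ∈ B))) hij)
    refine (hind.map_fun_eq_infinitePi_map hm).trans
      (Eq.trans ?_ (h'.indep_init.map_fun_eq_infinitePi_map hm').symm)
    congr 1
    funext i
    exact map_bool_eq (hm i) (hm' i)
      ((h.mean_init i (hAB i.2)).trans (h'.mean_init i i.2).symm)
  have hr1 : Measurable fun ω (i : A) => η₀ ω i := hr.comp h.measurable_init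
  have hr2 : Measurable fun ω (i : A) => η₀' ω i := hr.comp h'.measurable_init
  have h1 : IndepFun N (fun ω (i : A) => η₀ ω i) P := h.indep.comp measurable_id hr
  have h2 : IndepFun N' (fun ω (i : A) => η₀' ω i) P' := h'.indep.comp measurable_id hr
  rw [(indepFun_iff_map_prod_eq_prod_map_map h.measurable_clocks.aemeasurable
    hr1.aemeasurable).1 h1, (indepFun_iff_map_prod_eq_prod_map_map
    h'.measurable_clocks.aemeasurable hr2.aemeasurable).1 h2, hN]
  exact congrArg _ hη

/-- Functionals that read the configuration only on `A`, with the other sites filled in by `ext`,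
have equal means under both inputs. Taking for `A` the complement of the origin connects the
stationary process with the second class particle. -/
lemma GoodMeasurable.integral_eq_of_restrict {F : Clocks → Config → ℝ} (hF : GoodMeasurable F)
    (h : IsInput P p q ρ B N η₀) (h' : IsInput P' p q ρ A N' η₀') (hAB : A ⊆ B) (hpq : p + q = 1)
    {ext : (A → Bool) → Config} (hext : Measurable ext) :
    ∫ ω, F (N ω) (ext fun i => η₀ ω i) ∂P = ∫ ω, F (N' ω) (ext fun i => η₀' ω i) ∂P' := by
  obtain ⟨G, hG, hGF⟩ := hF
  have hr : Measurable fun (η : Config) (i : A) => η i :=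
    measurable_pi_lambda _ fun i => measurable_pi_apply (i : ℤ)
  have hG' : Measurable fun x : Clocks × (A → Bool) => G (x.1, ext x.2) :=
    hG.comp (measurable_fst.prodMk (hext.comp measurable_snd))
  have h1 := integral_map (μ := P)
    (h.measurable_clocks.prodMk (hr.comp h.measurable_init)).aemeasurable hG'.aestronglyMeasurable
  have h2 := integral_map (μ := P')
    (h'.measurable_clocks.prodMk (hr.comp h'.measurable_init)).aemeasurable hG'.aestronglyMeasurable
  have hmap := h.map_eq h' hAB
  simp only [Function.comp_def] at h1 h2
  rw [hmap, h2] at h1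
  refine Eq.trans ?_ (h1.symm.trans ?_)
  · refine integral_congr_ae ?_
    filter_upwards [h.ae_good hpq] with ω hω
    exact (hGF _ hω _).symm
  · refine integral_congr_ae ?_
    filter_upwards [h'.ae_good hpq] with ω hω
    exact hGF _ hω _

lemma GoodMeasurable.integral_eq {F : Clocks → Config → ℝ} (hF : GoodMeasurable F)
    (h : IsInput P p q ρ Set.univ N η₀) (h' : IsInput P' p q ρ Set.univ N' η₀') (hpq : p + q = 1) :
    ∫ ω, F (N ω) (η₀ ω) ∂P = ∫ ω, F (N' ω) (η₀' ω) ∂P' :=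
  hF.integral_eq_of_restrict h h' subset_rfl hpq
    (ext := fun f i => f ⟨i, Set.mem_univ i⟩)
    (measurable_pi_lambda _ fun _ => measurable_pi_apply _)

lemma GoodMeasurable.integral_update_eq {F : Clocks → Config → ℝ} (hF : GoodMeasurable F)
    (h : IsInput P p q ρ Set.univ N η₀) (h' : IsInput P' p q ρ {0}ᶜ N' η₀') (hpq : p + q = 1)
    (b : Bool) :
    ∫ ω, F (N ω) (Function.update (η₀ ω) 0 b) ∂P =
      ∫ ω, F (N' ω) (Function.update (η₀' ω) 0 b) ∂P' := by
  have hext : Measurable fun (f : ({0}ᶜ : Set ℤ) → Bool) (i : ℤ) =>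
      if hi : i ∈ ({0}ᶜ : Set ℤ) then f ⟨i, hi⟩ else b := by
    refine measurable_pi_lambda _ fun i => ?_
    split_ifs with hi
    · exact measurable_pi_apply _
    · exact measurable_const
  have heq : ∀ η : Config, (fun i : ℤ => if hi : i ∈ ({0}ᶜ : Set ℤ) then η i else b) =
      Function.update η 0 b := fun η => by
    funext i
    by_cases hi : i = 0 <;> simp [hi]
  have := hF.integral_eq_of_restrict h h' (Set.subset_univ _) hpq hext
  simpa only [heq] using this

end Law

/-! ### Translations -/

/-- The clocks seen from the site `k`. -/
def shiftClocks (k : ℤ) (n : Clocks) : Clocks := fun e => n (e.1 + k, e.2)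

/-- The configuration seen from the site `k`. -/
def shiftConfig (k : ℤ) (η : Config) : Config := fun i => η (i + k)

/-- The labelled configuration seen from the site `k`. -/
def shiftLabelled (k : ℤ) (S : Labelled) : Labelled := fun i => (S (i + k)).map (· - k)

lemma barrier_shiftClocks {n : Clocks} {T : ℝ≥0} {k b : ℤ} :
    Barrier (shiftClocks k n) T b ↔ Barrier n T (b + k) := by
  simp only [Barrier, shiftClocks, add_right_comm b 1 k]

lemma Good.shiftClocks {n : Clocks} (hn : Good n) (k : ℤ) : Good (shiftClocks k n) where
  zero e := hn.zero _
  mono e := hn.mono _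
  right_cont e := hn.right_cont _
  disjoint e e' hne t := hn.disjoint _ _ (fun h => hne (by
    have := Prod.mk.inj h
    exact Prod.ext (by omega) this.2)) t
  right_barrier T x := by
    obtain ⟨b, hb, hB⟩ := hn.right_barrier T (x + k)
    exact ⟨b - k, by omega, barrier_shiftClocks.2 (by rwa [sub_add_cancel])⟩
  left_barrier T x := by
    obtain ⟨b, hb, hB⟩ := hn.left_barrier T (x + k)
    exact ⟨b - k, by omega, barrier_shiftClocks.2 (by rwa [sub_add_cancel])⟩

lemma shiftLabelled_move (k : ℤ) (e : ClockIndex) (S : Labelled) :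
    shiftLabelled k (move (e.1 + k, e.2) S) = move e (shiftLabelled k S) := by
  have ht : target (e.1 + k, e.2) = target e + k := by
    unfold target; split_ifs <;> ring
  funext i
  by_cases h : (S (e.1 + k)).isSome ∧ S (target e + k) = none
  · have h' : (shiftLabelled k S e.1).isSome ∧ shiftLabelled k S (target e) = none := by
      simpa only [shiftLabelled, Option.isSome_map, Option.map_eq_none_iff] using h
    have hl : move (e.1 + k, e.2) S =
        Function.update (Function.update S (target e + k) (S (e.1 + k))) (e.1 + k) none := by
      rw [move, ht, if_pos h]
    rw [hl, show move e (shiftLabelled k S) = _ from if_pos h']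
    simp only [shiftLabelled, Function.update_apply, add_left_inj]
    split_ifs <;> rfl
  · have h' : ¬((shiftLabelled k S e.1).isSome ∧ shiftLabelled k S (target e) = none) := by
      simpa only [shiftLabelled, Option.isSome_map, Option.map_eq_none_iff] using h
    have hl : move (e.1 + k, e.2) S = S := by rw [move, ht, if_neg h]
    rw [hl, show move e (shiftLabelled k S) = _ from if_neg h']

/-- The translated path obeys the translated clocks, with labels translated as well because they are
initial sites; uniqueness does the rest. -/
lemma path_shift {n : Clocks} (hn : Good n) (k : ℤ) (η : Config) (t : ℝ≥0) :
    path (shiftClocks k n) (shiftConfig k η) t = shiftLabelled k (path n η t) := by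
  have h := path_spec hn η
  have hS : IsGraphicalPath (shiftClocks k n) (labelled (shiftConfig k η))
      fun s => shiftLabelled k (path n η s) := by
    refine ⟨?_, fun s i => ?_, fun s hs => ?_⟩
    · simp only [h.init]
      funext i
      by_cases hi : η (i + k) = true
      · have hi' : shiftConfig k η i = true := hi
        rw [shiftLabelled, labelled, labelled, if_pos hi, if_pos hi']
        simp
      · have hi' : ¬shiftConfig k η i = true := hi
        rw [shiftLabelled, labelled, labelled, if_neg hi, if_neg hi']
        simp
    · filter_upwards [h.right s (i + k)] with u hu
      simp only [shiftLabelled, hu]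
    · obtain ⟨L, hL, hr, hnr⟩ := h.left s hs
      refine ⟨shiftLabelled k L, fun i => ?_, fun e he => ?_, fun hno => ?_⟩
      · filter_upwards [hL (i + k)] with u hu
        simp only [shiftLabelled, hu]
      · simp only [hr _ he, shiftLabelled_move]
      · simp only [hnr fun e he => hno (e.1 - k, e.2) (by simpa [shiftClocks] using he)]
  exact congrFun ((existsUnique_isGraphicalPath (hn.shiftClocks k) _).unique
    (path_spec (hn.shiftClocks k) _) hS) t

lemma process_shift {n : Clocks} (hn : Good n) (k : ℤ) (η : Config) (t : ℝ≥0) (i : ℤ) :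
    process (shiftClocks k n) (shiftConfig k η) t i = process n η t (i + k) := by
  simp only [process, path_shift hn, shiftLabelled, Option.isSome_map]

lemma measurable_shiftClocks (k : ℤ) : Measurable (shiftClocks k) :=
  measurable_pi_lambda _ fun _ => measurable_pi_apply _

lemma measurable_shiftConfig (k : ℤ) : Measurable (shiftConfig k) :=
  measurable_pi_lambda _ fun _ => measurable_pi_apply _

lemma shiftConfig_update (k i : ℤ) (b : Bool) (η : Config) :
    shiftConfig k (Function.update η i b) = Function.update (shiftConfig k η) (i - k) b := by
  funext j
  simp only [shiftConfig, Function.update_apply, eq_sub_iff_add_eq]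

lemma GoodMeasurable.shift {F : Clocks → Config → ℝ} (hF : GoodMeasurable F) (k : ℤ) :
    GoodMeasurable fun n η => F (shiftClocks k n) (shiftConfig k η) := by
  obtain ⟨G, hG, hGF⟩ := hF
  exact ⟨fun x => G (shiftClocks k x.1, shiftConfig k x.2),
    hG.comp (((measurable_shiftClocks k).comp measurable_fst).prodMk
      ((measurable_shiftConfig k).comp measurable_snd)),
    fun n hn η => hGF _ (hn.shiftClocks k) _⟩

lemma sum_Ioc_shift (f : ℤ → ℝ) (a b : ℤ) :
    ∑ i ∈ Finset.Ioc 0 (b - a), f (i + a) = ∑ i ∈ Finset.Ioc a b, f i :=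
  Finset.sum_bij' (fun i _ => i + a) (fun i _ => i - a)
    (fun i hi => by simp only [Finset.mem_Ioc] at hi ⊢; omega)
    (fun i hi => by simp only [Finset.mem_Ioc] at hi ⊢; omega)
    (fun i _ => by simp) (fun i _ => by simp) fun _ _ => rfl

lemma sum_Ioc_add (f : ℤ → ℝ) {a b c : ℤ} (hab : a ≤ b) (hbc : b ≤ c) :
    ∑ i ∈ Finset.Ioc a b, f i + ∑ i ∈ Finset.Ioc b c, f i = ∑ i ∈ Finset.Ioc a c, f i := by
  rw [← Finset.sum_union (Finset.disjoint_left.2 fun i hi hi' => by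
    rw [Finset.mem_Ioc] at hi hi'; omega)]
  refine Finset.sum_congr ?_ fun _ _ => rfl
  ext i
  simp only [Finset.mem_union, Finset.mem_Ioc]
  omega

/-- The current through the bond between `M` and `M + 1`. -/
noncomputable def bondCurrent (M : ℤ) (t : ℝ≥0) (n : Clocks) (η : Config) : ℝ :=
  current (shiftClocks M n) (shiftConfig M η) 0 t

lemma bondCurrent_eq {n : Clocks} (hn : Good n) (η : Config) {t : ℝ≥0} {M b : ℤ}
    (hb : Barrier n t b) (hMb : M ≤ b) :
    bondCurrent M t n η =
      ∑ i ∈ Finset.Ioc M b, occ (process n η t) i - ∑ i ∈ Finset.Ioc M b, occ η i := by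
  rw [bondCurrent, current_eq (hn.shiftClocks M) _ (b := b - M)
    (barrier_shiftClocks.2 (by rwa [sub_add_cancel])) (by omega) (by omega),
    ← sum_Ioc_shift _ M b, ← sum_Ioc_shift _ M b]
  simp only [occ, process_shift hn, shiftConfig]
  rfl

lemma exists_barrier_ge {n : Clocks} (hn : Good n) (t : ℝ≥0) (I : Finset ℤ) :
    ∃ b, (∀ i ∈ I, i ≤ b) ∧ Barrier n t b := by
  obtain ⟨c, hc⟩ := I.bddAbove
  obtain ⟨b, hb, hB⟩ := hn.right_barrier t c
  exact ⟨b, fun i hi => (hc hi).trans hb, hB⟩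

/-- Split the particle numbers in `current_eq` at `M`: the part beyond `M` is the current through
`M|M + 1`. -/
lemma current_eq_bondCurrent_add {n : Clocks} (hn : Good n) (η : Config) (t : ℝ≥0) {z M : ℤ}
    (hz : z ≤ M) (h0 : 0 ≤ M) :
    (current n η z t : ℝ) = bondCurrent M t n η + (∑ i ∈ Finset.Ioc z M, occ (process n η t) i -
      ∑ i ∈ Finset.Ioc 0 M, occ η i) := by
  obtain ⟨b, hb, hB⟩ := exists_barrier_ge hn t {z, M, 0}
  simp only [Finset.mem_insert, Finset.mem_singleton, forall_eq_or_imp, forall_eq] at hb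
  rw [current_eq hn η hB hb.2.2 hb.1, bondCurrent_eq hn η hB hb.2.1, ← sum_Ioc_add _ hz hb.2.1,
    ← sum_Ioc_add _ h0 hb.2.1]
  ring

lemma current_eq_add_bondCurrent {n : Clocks} (hn : Good n) (η : Config) (t : ℝ≥0) {z M : ℤ}
    (hz : M ≤ z) (h0 : M ≤ 0) :
    (current n η z t : ℝ) = (∑ k ∈ Finset.Ioc M 0, occ η k -
      ∑ k ∈ Finset.Ioc M z, occ (process n η t) k) + bondCurrent M t n η := by
  obtain ⟨b, hb, hB⟩ := exists_barrier_ge hn t {z, M, 0}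
  simp only [Finset.mem_insert, Finset.mem_singleton, forall_eq_or_imp, forall_eq] at hb
  rw [current_eq hn η hB hb.2.2 hb.1, bondCurrent_eq hn η hB hb.2.1, ← sum_Ioc_add _ hz hb.1,
    ← sum_Ioc_add _ h0 hb.2.2]
  ring

/-- Measuring at the fixed bond `z|z + 1` differs from `current` only by initial occupation
variables between `0` and `z`. -/
lemma current_eq_bondCurrent_self {n : Clocks} (hn : Good n) (η : Config) (t : ℝ≥0) (z : ℤ) :
    (current n η z t : ℝ) = bondCurrent z t n η + (∑ k ∈ Finset.Ioc z 0, occ η k -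
      ∑ k ∈ Finset.Ioc 0 z, occ η k) := by
  rcases le_total z 0 with h | h
  · have := current_eq_add_bondCurrent hn η t le_rfl h
    rw [this, Finset.Ioc_self, Finset.Ioc_eq_empty_of_le h]
    simp; ring
  · have := current_eq_bondCurrent_add hn η t le_rfl h
    rw [this, Finset.Ioc_self, Finset.Ioc_eq_empty_of_le h]
    simp

lemma bondCurrent_zero (t : ℝ≥0) (n : Clocks) (η : Config) :
    bondCurrent 0 t n η = current n η 0 t := by
  have h1 : shiftClocks 0 n = n := by funext e; simp [shiftClocks]
  have h2 : shiftConfig 0 η = η := by funext i; simp [shiftConfig]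
  rw [bondCurrent, h1, h2]

lemma bondCurrent_shift (M k : ℤ) (t : ℝ≥0) (n : Clocks) (η : Config) :
    bondCurrent M t (shiftClocks k n) (shiftConfig k η) = bondCurrent (M + k) t n η := by
  have h1 : shiftClocks M (shiftClocks k n) = shiftClocks (M + k) n := by
    funext e; simp only [shiftClocks, add_assoc]
  have h2 : shiftConfig M (shiftConfig k η) = shiftConfig (M + k) η := by
    funext i; simp only [shiftConfig, add_assoc]
  rw [bondCurrent, h1, h2, bondCurrent]

lemma GoodMeasurable.bondCurrent (M : ℤ) (t : ℝ≥0) : GoodMeasurable (bondCurrent M t) :=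
  (GoodMeasurable.current t).shift M

section Input

variable {Ω : Type*} [MeasurableSpace Ω] {P : Measure Ω} [IsProbabilityMeasure P] {p q : ℝ≥0}
  {ρ : ℝ} {N : Ω → Clocks} {η₀ : Ω → Config}

omit [IsProbabilityMeasure P] in
lemma IsInput.shift (h : IsInput P p q ρ Set.univ N η₀) (k : ℤ) :
    IsInput P p q ρ Set.univ (fun ω => shiftClocks k (N ω)) fun ω => shiftConfig k (η₀ ω) where
  poisson e := h.poisson (e.1 + k, e.2)
  indep_clocks := h.indep_clocks.precomp (g := fun e : ClockIndex => (e.1 + k, e.2))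
    fun e e' he => by
      have := Prod.mk.inj he
      exact Prod.ext (by omega) this.2
  measurable_init := (measurable_shiftConfig k).comp h.measurable_init
  mean_init i _ := h.mean_init (i + k) (Set.mem_univ _)
  indep_init := h.iIndepFun_init.precomp (g := fun i : (Set.univ : Set ℤ) => (i : ℤ) + k)
    fun _ _ hij => Subtype.ext (add_right_cancel hij)
  indep := h.indep.comp (measurable_shiftClocks k) (measurable_shiftConfig k)

/-- The law of the input is invariant under translations. -/
lemma GoodMeasurable.integral_shift {F : Clocks → Config → ℝ} (hF : GoodMeasurable F)
    (h : IsInput P p q ρ Set.univ N η₀) (hpq : p + q = 1) (k : ℤ) :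
    ∫ ω, F (shiftClocks k (N ω)) (shiftConfig k (η₀ ω)) ∂P = ∫ ω, F (N ω) (η₀ ω) ∂P :=
  hF.integral_eq (h.shift k) h hpq

end Input

/-! ### The effect of an added particle -/

lemma GoodMeasurable.const (c : ℝ) : GoodMeasurable fun _ _ => c :=
  .of_measurable measurable_const

lemma plus_update_false (η : Config) : plus (Function.update η 0 false) = plus η := by
  simp only [plus, Function.update_idem]

lemma update_zero_false {η : Config} (h : η 0 = false) : Function.update η 0 false = η := by
  rw [← h, Function.update_eq_self]

lemma isAddParticle_plus {η : Config} (h : η 0 = false) : IsAddParticle η (plus η) 0 := ⟨h, rfl⟩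

/-- The position is the sum of `j` times the discrepancy at `j`, and truncations of this sum are
eventually exact. Vacating the origin makes the discrepancy exist for every configuration. -/
lemma GoodMeasurable.secondClass (t : ℝ≥0) :
    GoodMeasurable fun n η => (secondClass n (Function.update η 0 false) t : ℝ) := by
  refine .of_eventually (F' := fun J n η => ∑ j ∈ Finset.Icc (-(J : ℤ)) J, (j : ℝ) *
    (occ (process n (Function.update η 0 true) t) j -
      occ (process n (Function.update η 0 false) t) j)) (fun J => ?_) fun n hn η => ?_
  · exact .sum _ fun j => (GoodMeasurable.const j).mul
      (((GoodMeasurable.occ_process t j).comp_config (measurable_update_config 0 true)).sub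
        ((GoodMeasurable.occ_process t j).comp_config (measurable_update_config 0 false)))
  · have h := isAddParticle_secondClass hn (η₀ := Function.update η 0 false)
      (Function.update_self _ _ _) t
    rw [plus_update_false] at h
    set Q := ASEP.secondClass n (Function.update η 0 false) t
    filter_upwards [eventually_ge_atTop Q.natAbs] with J hJ
    have hocc := h.occ_sub
    unfold plus at hocc
    simp only [hocc, mul_ite, mul_one, mul_zero]
    rw [Finset.sum_ite_eq, if_pos (Finset.mem_Icc.2 (by omega))]

/-- The change of the current through the bond `-k|-k + 1` when a particle is added at the
origin and the second class particle is at `x`. -/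
noncomputable def bondGain (k x : ℤ) : ℝ := (if 0 < x + k then 1 else 0) - if 0 < k then 1 else 0

/-- The current is a final minus an initial particle number, so the added particle contributes
whether `Q` ends to the right of `-k`, minus whether `0` lies there. -/
lemma bondCurrent_plus_sub {n : Clocks} (hn : Good n) {η : Config} (h0 : η 0 = false) (t : ℝ≥0)
    (k : ℤ) :
    bondCurrent (-k) t n (plus η) - bondCurrent (-k) t n η = bondGain k (secondClass n η t) := by
  have h := (isAddParticle_secondClass hn h0 t).occ_sub
  have h' := (isAddParticle_plus h0).occ_sub
  set Q := secondClass n η t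
  obtain ⟨b, hb, hB⟩ := exists_barrier_ge hn t {-k, Q, 0}
  simp only [Finset.mem_insert, Finset.mem_singleton, forall_eq_or_imp, forall_eq] at hb
  rw [bondCurrent_eq hn _ hB hb.1, bondCurrent_eq hn _ hB hb.1, sub_sub_sub_comm,
    ← Finset.sum_sub_distrib, ← Finset.sum_sub_distrib]
  simp only [h, h', Finset.sum_ite_eq, Finset.mem_Ioc, bondGain]
  congr 2 <;> (refine propext ⟨fun hx => ?_, fun hx => ?_⟩ <;> omega)

/-- Exactly the `|x|` bonds between the origin and `x` are affected, each by the sign of `x`. -/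
lemma hasSum_bondGain (x : ℤ) : HasSum (fun k => bondGain k x) x := by
  have h : ∀ k ∉ Finset.Ioc (-x) 0 ∪ Finset.Ioc 0 (-x), bondGain k x = 0 := by
    intro k hk
    simp only [Finset.mem_union, Finset.mem_Ioc] at hk
    unfold bondGain
    split_ifs <;> first | omega | simp
  have hs := hasSum_sum_of_ne_finset_zero (L := .unconditional ℤ) h
  convert hs using 1
  rcases le_total 0 x with hx | hx
  · rw [Finset.Ioc_eq_empty_of_le (by omega : -x ≤ 0), Finset.union_empty,
      Finset.sum_congr rfl (g := fun _ => (1 : ℝ))]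
    · rw [Finset.sum_const, Int.card_Ioc, nsmul_one, zero_sub, neg_neg, ← Int.cast_natCast,
        Int.toNat_of_nonneg hx]
    · intro k hk
      rw [Finset.mem_Ioc] at hk
      unfold bondGain
      rw [if_pos (by omega), if_neg (by omega), sub_zero]
  · rw [Finset.Ioc_eq_empty_of_le (by omega : 0 ≤ -x), Finset.empty_union,
      Finset.sum_congr rfl (g := fun _ => (-1 : ℝ))]
    · rw [Finset.sum_const, Int.card_Ioc, sub_zero, nsmul_eq_mul, ← Int.cast_natCast,
        Int.toNat_of_nonneg (by omega)]
      push_cast; ring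
    · intro k hk
      rw [Finset.mem_Ioc] at hk
      unfold bondGain
      rw [if_neg (by omega), if_pos (by omega), zero_sub]

lemma covariance_congr_ae {Ω : Type*} [MeasurableSpace Ω] {P : Measure Ω} {X X' Y Y' : Ω → ℝ}
    (hX : X =ᵐ[P] X') (hY : Y =ᵐ[P] Y') : covariance X Y P = covariance X' Y' P := by
  rw [covariance, covariance, integral_congr_ae hX, integral_congr_ae hY]
  refine integral_congr_ae ?_
  filter_upwards [hX, hY] with ω h1 h2
  rw [h1, h2]

section Input

variable {Ω Ω' : Type*} [MeasurableSpace Ω] {P : Measure Ω} [IsProbabilityMeasure P] {p q : ℝ≥0}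
  {ρ : ℝ} {N : Ω → Clocks} {η₀ : Ω → Config} [MeasurableSpace Ω'] {P' : Measure Ω'}
  [IsProbabilityMeasure P'] {N' : Ω' → Clocks} {η₀' : Ω' → Config}

/-- Forcing the bit at the origin of the stationary input to either value reproduces the pair of
coupled initial states. -/
lemma GoodMeasurable.integral_plus_sub {F : Clocks → Config → ℝ} (hF : GoodMeasurable F)
    (h : IsInput P p q ρ Set.univ N η₀) (h' : IsInput P' p q ρ {0}ᶜ N' η₀') (hpq : p + q = 1)
    (hzero : ∀ᵐ ω ∂P', η₀' ω 0 = false) :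
    ∫ ω, (F (N ω) (Function.update (η₀ ω) 0 true) - F (N ω) (Function.update (η₀ ω) 0 false)) ∂P =
      ∫ ω, (F (N' ω) (plus (η₀' ω)) - F (N' ω) (η₀' ω)) ∂P' := by
  have := ((hF.comp_config (measurable_update_config 0 true)).sub
    (hF.comp_config (measurable_update_config 0 false))).integral_update_eq h h' hpq false
  simp only [Function.update_idem] at this
  rw [this]
  refine integral_congr_ae ?_
  filter_upwards [hzero] with ω hω
  rw [update_zero_false hω]
  rfl

lemma IsInput.aemeasurable_secondClass (h' : IsInput P' p q ρ {0}ᶜ N' η₀') (hpq : p + q = 1)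
    (hzero : ∀ᵐ ω ∂P', η₀' ω 0 = false) (t : ℝ≥0) :
    AEMeasurable (fun ω => (secondClass (N' ω) (η₀' ω) t : ℝ)) P' := by
  refine ((GoodMeasurable.secondClass t).aemeasurable h' hpq).congr ?_
  filter_upwards [hzero] with ω hω
  rw [update_zero_false hω]

lemma IsInput.aemeasurable_secondClass_comp (h' : IsInput P' p q ρ {0}ᶜ N' η₀')
    (hpq : p + q = 1) (hzero : ∀ᵐ ω ∂P', η₀' ω 0 = false) (t : ℝ≥0) (f : ℤ → ℝ) :
    AEMeasurable (fun ω => f (secondClass (N' ω) (η₀' ω) t)) P' := by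
  have : Measurable fun x : ℝ => f ⌊x⌋ := (measurable_of_countable f).comp Int.measurable_floor
  simpa only [Function.comp_def, Int.floor_intCast] using
    this.comp_aemeasurable (h'.aemeasurable_secondClass hpq hzero t)

lemma IsInput.nullMeasurableSet_secondClass (h' : IsInput P' p q ρ {0}ᶜ N' η₀')
    (hpq : p + q = 1) (hzero : ∀ᵐ ω ∂P', η₀' ω 0 = false) (t : ℝ≥0) (j : ℤ) :
    NullMeasurableSet {ω | secondClass (N' ω) (η₀' ω) t = j} P' := by
  have := (h'.aemeasurable_secondClass hpq hzero t).nullMeasurableSet_preimage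
    (measurableSet_singleton (j : ℝ))
  convert this using 1
  ext ω
  simp

/-- The space-time covariance is the transition probability of the second class particle. -/
lemma IsInput.covariance_process (h : IsInput P p q ρ Set.univ N η₀)
    (h' : IsInput P' p q ρ {0}ᶜ N' η₀') (hpq : p + q = 1) (hρ : 0 ≤ ρ)
    (hzero : ∀ᵐ ω ∂P', η₀' ω 0 = false) (t : ℝ≥0) (j : ℤ) :
    covariance (fun ω => occ (process (N ω) (η₀ ω) t) j) (fun ω => occ (η₀ ω) 0) P =
      ρ * (1 - ρ) * P'.real {ω | secondClass (N' ω) (η₀' ω) t = j} := by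
  have hF := GoodMeasurable.occ_process t j
  have hb : ∀ n η, |occ (process n η t) j| ≤ 1 := fun n η => by
    rw [abs_of_nonneg (occ_nonneg _ _)]; exact occ_le_one _ _
  rw [h.covariance_occ hρ (hF.integrable h hpq hb) (Set.mem_univ 0),
    h.integral_mul_occ_sub hpq hρ hF 0 fun b =>
      (hF.comp_config (measurable_update_config 0 b)).integrable h hpq fun n η => hb n _,
    hF.integral_plus_sub h h' hpq hzero]
  congr 1
  have hs := h'.nullMeasurableSet_secondClass hpq hzero t j
  have : (fun ω => occ (process (N' ω) (plus (η₀' ω)) t) j - occ (process (N' ω) (η₀' ω) t) j)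
      =ᵐ[P'] {ω | secondClass (N' ω) (η₀' ω) t = j}.indicator fun _ => 1 := by
    filter_upwards [h'.ae_good hpq, hzero] with ω hω h0
    rw [(isAddParticle_secondClass hω h0 t).occ_sub, Set.indicator_apply]
    rfl
  rw [integral_congr_ae this, integral_indicator₀ hs]
  simp

lemma GoodMeasurable.covariance_shift {F F' : Clocks → Config → ℝ} (hF : GoodMeasurable F)
    (hF' : GoodMeasurable F') (h : IsInput P p q ρ Set.univ N η₀) (hpq : p + q = 1) (k : ℤ) :
    covariance (fun ω => F (shiftClocks k (N ω)) (shiftConfig k (η₀ ω)))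
      (fun ω => F' (shiftClocks k (N ω)) (shiftConfig k (η₀ ω))) P =
    covariance (fun ω => F (N ω) (η₀ ω)) (fun ω => F' (N ω) (η₀ ω)) P := by
  rw [covariance, covariance, hF.integral_shift h hpq k, hF'.integral_shift h hpq k]
  exact ((hF.sub (GoodMeasurable.const _)).mul
    (hF'.sub (GoodMeasurable.const _))).integral_shift h hpq k

lemma IsInput.covariance_process_shift (h : IsInput P p q ρ Set.univ N η₀)
    (h' : IsInput P' p q ρ {0}ᶜ N' η₀') (hpq : p + q = 1) (hρ : 0 ≤ ρ)
    (hzero : ∀ᵐ ω ∂P', η₀' ω 0 = false) (t : ℝ≥0) (i k : ℤ) :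
    covariance (fun ω => occ (process (N ω) (η₀ ω) t) i) (fun ω => occ (η₀ ω) k) P =
      ρ * (1 - ρ) * P'.real {ω | secondClass (N' ω) (η₀' ω) t = i - k} := by
  have hs := (GoodMeasurable.occ_process t (i - k)).covariance_shift
    (F' := fun _ η => occ η 0) (GoodMeasurable.occ_init 0) h hpq k
  rw [← h.covariance_process h' hpq hρ hzero, ← hs]
  refine covariance_congr_ae ?_ (ae_of_all _ fun ω => ?_)
  · filter_upwards [h.ae_good hpq] with ω hω
    simp only [occ, process_shift hω, sub_add_cancel]
  · simp only [occ, shiftConfig, zero_add]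

lemma abs_bondCurrent_zero_le {n : Clocks} (hn : Good n) (t : ℝ≥0) (η : Config) :
    |bondCurrent 0 t n η| ≤ bondRings n t := by
  rw [bondCurrent_zero]
  exact abs_current_le hn t η

/-- The covariance of the current with an initial occupation variable. -/
lemma IsInput.integral_bondCurrent_mul_occ_sub (h : IsInput P p q ρ Set.univ N η₀)
    (h' : IsInput P' p q ρ {0}ᶜ N' η₀') (hpq : p + q = 1) (hρ : 0 ≤ ρ)
    (hzero : ∀ᵐ ω ∂P', η₀' ω 0 = false) (t : ℝ≥0) (k : ℤ) :
    ∫ ω, bondCurrent 0 t (N ω) (η₀ ω) * (occ (η₀ ω) k - ρ) ∂P =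
      ρ * (1 - ρ) * ∫ ω, bondGain k (secondClass (N' ω) (η₀' ω) t) ∂P' := by
  have hF := GoodMeasurable.bondCurrent 0 t
  have hF' := GoodMeasurable.bondCurrent (-k) t
  have hint : ∀ b, Integrable
      (fun ω => bondCurrent 0 t (N ω) (Function.update (η₀ ω) k b)) P := fun b =>
    h.integrable_of_le_bondRings (F := bondCurrent 0 t) (φ := fun η => Function.update η k b) hpq hF
      (fun n hn η => abs_bondCurrent_zero_le hn t η) (measurable_update_config k b)
  refine (h.integral_mul_occ_sub hpq hρ hF k hint).trans ?_
  refine congrArg (ρ * (1 - ρ) * ·) ?_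
  -- The translation takes site `k` to the origin and the bond `0|1` to `-k|-k + 1`.
  have hD := ((hF'.comp_config (measurable_update_config 0 true)).sub
    (hF'.comp_config (measurable_update_config 0 false))).integral_shift h hpq k
  have hsh : ∀ n η b, bondCurrent (-k) t (shiftClocks k n)
      (Function.update (shiftConfig k η) 0 b) = bondCurrent 0 t n (Function.update η k b) :=
    fun n η b => by
      have := shiftConfig_update k k b η
      rw [sub_self] at this
      rw [← this, bondCurrent_shift, neg_add_cancel]
  simp only [hsh] at hD
  rw [hD, hF'.integral_plus_sub h h' hpq hzero]
  refine integral_congr_ae ?_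
  filter_upwards [h'.ae_good hpq, hzero] with ω hω h0
  exact bondCurrent_plus_sub hω h0 t k

/-! ### Decay of the covariance of the current with the initial configuration -/

lemma measurableSet_no_barrier (T : ℝ≥0) (I : Finset ℤ) :
    MeasurableSet {n : Clocks | ∀ b ∈ I, ¬ Barrier n T b} := by
  have : {n : Clocks | ∀ b ∈ I, ¬ Barrier n T b} = ⋂ b ∈ I, {n | Barrier n T b}ᶜ := by
    ext n; simp
  rw [this]
  exact Finset.measurableSet_biInter _ fun b _ => (measurableSet_barrier T b).compl

/-- On a ring, site `k` can influence the bond `0|1` from two sides, so a barrier is needed on each: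
one between the bond and `k`, the other anywhere on the opposite arc. -/
lemma ringCurrent_update_eq {n : Clocks} (hn : Good n) {K : ℕ} {t : ℝ≥0} {k : ℤ} (hk : k.natAbs ≤ K)
    (hR : ∃ b ∈ Finset.Ico 0 (if 0 < k then k else K), Barrier n t b)
    (hL : ∃ b ∈ Finset.Icc (if 0 < k then -(K : ℤ) else k) 0, Barrier n t b) (η : Config) :
    ringCurrent K n (Function.update η k true) t =
      ringCurrent K n (Function.update η k false) t := by
  obtain ⟨b, hb, hBb⟩ := hR
  obtain ⟨a, ha, hBa⟩ := hL
  rw [Finset.mem_Ico] at hb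
  rw [Finset.mem_Icc] at ha
  refine ringCurrent_congr hn (a := a + 1) (by rwa [add_sub_cancel_right]) hBb (by omega) hb.1
    ?_ ?_ fun i hi1 hi2 => ?_
  · split_ifs at ha hb <;> omega
  · split_ifs at ha hb <;> omega
  · have : i ≠ k := by rintro rfl; split_ifs at ha hb <;> omega
    rw [Function.update_of_ne this, Function.update_of_ne this]

/-- Changing the bit at `k` matters only if one of two arcs, each with at least `|k|` bonds, lacks a
barrier; this has probability at most `2 (1 - exp (-t)) ^ |k|`. The bound is uniform in `K`, which
later permits dominated convergence of the sum over `k`. -/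
lemma IsInput.abs_integral_ringCurrent_mul_le (h : IsInput P p q ρ Set.univ N η₀)
    (hpq : p + q = 1) (hρ : 0 ≤ ρ) (hρ1 : ρ ≤ 1) {t : ℝ≥0} (ht : 0 < t) {K : ℕ} {k : ℤ}
    (hk : k.natAbs ≤ K) :
    |∫ ω, ringCurrent K (N ω) (η₀ ω) t * (occ (η₀ ω) k - ρ) ∂P| ≤
      (∫ ω, bondRings (N ω) t ^ 2 ∂P + 2) * √(1 - Real.exp (-t)) ^ k.natAbs := by
  have hF := GoodMeasurable.ringCurrent K t
  have hint := fun b => h.integrable_of_le_bondRings hpq hF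
    (fun n hn η => abs_ringCurrent_le hn K t η) (measurable_update_config k b)
  rw [h.integral_mul_occ_sub hpq hρ hF k hint]
  have hx0 : 0 < 1 - Real.exp (-t) := by
    rw [sub_pos, Real.exp_lt_one_iff]; simpa using ht
  have hx1 : 1 - Real.exp (-t) ≤ 1 := by linarith [Real.exp_pos (-(t : ℝ))]
  set x := 1 - Real.exp (-t)
  -- The square root balances the two terms of the estimate below: `ε` times the second moment, and
  -- `ε⁻¹` times probabilities of order `ε ^ 2`.
  set ε := √x ^ k.natAbs with hε
  have hε0 : 0 < ε := pow_pos (Real.sqrt_pos.2 hx0) _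
  have hεx : x ^ k.natAbs = ε * ε := by rw [hε, ← mul_pow, Real.mul_self_sqrt hx0.le]
  set IR := Finset.Ico 0 (if 0 < k then k else K) with hIR
  set IL := Finset.Icc (if 0 < k then -(K : ℤ) else k) 0 with hIL
  have hcR : k.natAbs ≤ IR.card := by
    rw [hIR, Int.card_Ico]; split_ifs <;> omega
  have hcL : k.natAbs ≤ IL.card := by
    rw [hIL, Int.card_Icc]; split_ifs <;> omega
  set BR := {ω | ∀ b ∈ IR, ¬ Barrier (N ω) t b} with hBR
  set BL := {ω | ∀ b ∈ IL, ¬ Barrier (N ω) t b} with hBL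
  have hmR : MeasurableSet BR := h.measurable_clocks (measurableSet_no_barrier t IR)
  have hmL : MeasurableSet BL := h.measurable_clocks (measurableSet_no_barrier t IL)
  have hPR : P.real BR ≤ ε * ε := by
    rw [hBR, h.real_no_barrier hpq, ← hεx]
    exact pow_le_pow_of_le_one hx0.le hx1 hcR
  have hPL : P.real BL ≤ ε * ε := by
    rw [hBL, h.real_no_barrier hpq, ← hεx]
    exact pow_le_pow_of_le_one hx0.le hx1 hcL
  have hb2 : Integrable (fun ω => bondRings (N ω) t ^ 2) P := (h.memLp_bondRings t).integrable_sq
  have hiR : Integrable (BR.indicator (1 : Ω → ℝ)) P := (integrable_const 1).indicator hmR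
  have hiL : Integrable (BL.indicator (1 : Ω → ℝ)) P := (integrable_const 1).indicator hmL
  have hdom : Integrable (fun ω => ε * bondRings (N ω) t ^ 2 +
      ε⁻¹ * (BR.indicator 1 ω + BL.indicator 1 ω)) P :=
    (hb2.const_mul ε).add ((hiR.add hiL).const_mul ε⁻¹)
  have hpt : ∀ᵐ ω ∂P, |ringCurrent K (N ω) (Function.update (η₀ ω) k true) t -
      ringCurrent K (N ω) (Function.update (η₀ ω) k false) t| ≤
      ε * bondRings (N ω) t ^ 2 + ε⁻¹ * (BR.indicator 1 ω + BL.indicator 1 ω) := by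
    filter_upwards [h.ae_good hpq] with ω hω
    have hnn : ∀ B : Set Ω, 0 ≤ B.indicator (1 : Ω → ℝ) ω := fun B =>
      Set.indicator_nonneg (fun _ _ => zero_le_one) _
    by_cases hbad : ω ∈ BR ∪ BL
    · have hge : 1 ≤ BR.indicator (1 : Ω → ℝ) ω + BL.indicator 1 ω := by
        rcases hbad with hb | hb
        · rw [Set.indicator_of_mem hb]; have := hnn BL; simp only [Pi.one_apply]; linarith
        · rw [Set.indicator_of_mem hb]; have := hnn BR; simp only [Pi.one_apply]; linarith
      have h1 := abs_ringCurrent_le hω K t (Function.update (η₀ ω) k true)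
      have h2 := abs_ringCurrent_le hω K t (Function.update (η₀ ω) k false)
      have h3 := abs_sub (ringCurrent K (N ω) (Function.update (η₀ ω) k true) t)
        (ringCurrent K (N ω) (Function.update (η₀ ω) k false) t)
      have h4 : 2 * bondRings (N ω) t ≤ ε * bondRings (N ω) t ^ 2 + ε⁻¹ := by
        have : 0 ≤ ε⁻¹ * (ε * bondRings (N ω) t - 1) ^ 2 := by positivity
        have he : ε⁻¹ * (ε * bondRings (N ω) t - 1) ^ 2 =
            ε * bondRings (N ω) t ^ 2 - 2 * bondRings (N ω) t + ε⁻¹ := by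
          field_simp; ring
        linarith
      have h5 : ε⁻¹ * 1 ≤ ε⁻¹ * (BR.indicator 1 ω + BL.indicator 1 ω) :=
        mul_le_mul_of_nonneg_left hge (inv_pos.2 hε0).le
      linarith
    · have hR : ∃ b ∈ IR, Barrier (N ω) t b := by
        by_contra! hc; exact hbad (Or.inl hc)
      have hL : ∃ b ∈ IL, Barrier (N ω) t b := by
        by_contra! hc; exact hbad (Or.inr hc)
      rw [ringCurrent_update_eq hω hk hR hL, sub_self, abs_zero]
      have := hnn BR
      have := hnn BL
      positivity
  have hI : |∫ ω, (ringCurrent K (N ω) (Function.update (η₀ ω) k true) t -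
      ringCurrent K (N ω) (Function.update (η₀ ω) k false) t) ∂P| ≤
      (∫ ω, bondRings (N ω) t ^ 2 ∂P + 2) * ε := by
    rw [← Real.norm_eq_abs]
    refine (norm_integral_le_of_norm_le hdom (f := fun ω =>
      ringCurrent K (N ω) (Function.update (η₀ ω) k true) t -
      ringCurrent K (N ω) (Function.update (η₀ ω) k false) t) hpt).trans ?_
    have hRL : Integrable (fun ω => ε⁻¹ * (BR.indicator (1 : Ω → ℝ) ω + BL.indicator 1 ω)) P :=
      (hiR.add hiL).const_mul ε⁻¹
    rw [integral_add (hb2.const_mul ε) hRL, integral_const_mul,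
      integral_const_mul, integral_add hiR hiL, integral_indicator_one hmR,
      integral_indicator_one hmL]
    have : ε⁻¹ * (P.real BR + P.real BL) ≤ ε⁻¹ * (ε * ε + ε * ε) :=
      mul_le_mul_of_nonneg_left (add_le_add hPR hPL) (inv_pos.2 hε0).le
    have he : ε⁻¹ * (ε * ε + ε * ε) = 2 * ε := by field_simp; ring
    rw [add_mul]
    linarith [mul_comm ε (∫ ω, bondRings (N ω) t ^ 2 ∂P)]
  rw [abs_mul]
  refine (mul_le_mul_of_nonneg_right ?_ (abs_nonneg _)).trans ((one_mul _).trans_le hI)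
  rw [abs_of_nonneg (by nlinarith)]
  nlinarith

lemma summable_pow_natAbs {r : ℝ} (h0 : 0 ≤ r) (h1 : r < 1) :
    Summable fun k : ℤ => r ^ k.natAbs :=
  Summable.of_nat_of_neg (by simpa using summable_geometric_of_lt_one h0 h1)
    (by simpa using summable_geometric_of_lt_one h0 h1)

lemma IsInput.tendsto_integral_ringCurrent_mul (h : IsInput P p q ρ Set.univ N η₀)
    (hpq : p + q = 1) (t : ℝ≥0) {W : Config → ℝ} (hW : Measurable W) {C : ℝ}
    (hC : ∀ η, |W η| ≤ C) :
    Tendsto (fun K => ∫ ω, ringCurrent K (N ω) (η₀ ω) t * W (η₀ ω) ∂P) atTop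
      (𝓝 (∫ ω, bondCurrent 0 t (N ω) (η₀ ω) * W (η₀ ω) ∂P)) := by
  refine tendsto_integral_of_dominated_convergence (fun ω => bondRings (N ω) t * C)
    (fun K => (((GoodMeasurable.ringCurrent K t).aemeasurable h hpq).mul
      (hW.comp h.measurable_init).aemeasurable).aestronglyMeasurable)
    ((h.integrable_bondRings t).mul_const C) (fun K => ?_) ?_
  · filter_upwards [h.ae_good hpq] with ω hω
    rw [Real.norm_eq_abs, abs_mul]
    exact mul_le_mul (abs_ringCurrent_le hω K t _) (hC _) (abs_nonneg _) (bondRings_nonneg _ _)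
  · filter_upwards [h.ae_good hpq] with ω hω
    refine tendsto_const_nhds.congr' ((eventually_ringCurrent_eq hω t (η₀ ω)).mono fun K hK => ?_)
    simp only [hK, bondCurrent_zero]

lemma measurable_occ_sub (k : ℤ) (ρ : ℝ) : Measurable fun η : Config => occ η k - ρ :=
  (measurable_occ k).sub measurable_const

lemma abs_occ_sub_le {ρ : ℝ} (hρ : 0 ≤ ρ) (hρ1 : ρ ≤ 1) (η : Config) (k : ℤ) :
    |occ η k - ρ| ≤ 1 := by
  have := occ_nonneg η k
  have := occ_le_one η k
  rw [abs_le]; constructor <;> linarith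

lemma IsInput.abs_integral_bondCurrent_mul_le (h : IsInput P p q ρ Set.univ N η₀)
    (hpq : p + q = 1) (hρ : 0 ≤ ρ) (hρ1 : ρ ≤ 1) {t : ℝ≥0} (ht : 0 < t) (k : ℤ) :
    |∫ ω, bondCurrent 0 t (N ω) (η₀ ω) * (occ (η₀ ω) k - ρ) ∂P| ≤
      (∫ ω, bondRings (N ω) t ^ 2 ∂P + 2) * √(1 - Real.exp (-t)) ^ k.natAbs := by
  refine le_of_tendsto (h.tendsto_integral_ringCurrent_mul hpq t
    (measurable_occ_sub k ρ) fun η => abs_occ_sub_le hρ hρ1 η k).abs ?_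
  filter_upwards [eventually_ge_atTop k.natAbs] with K hK
  exact h.abs_integral_ringCurrent_mul_le hpq hρ hρ1 ht hK

lemma IsInput.summable_bound (t : ℝ≥0) (C : ℝ) :
    Summable fun k : ℤ => C * √(1 - Real.exp (-t)) ^ k.natAbs := by
  refine (summable_pow_natAbs (Real.sqrt_nonneg _) ?_).mul_left _
  rw [Real.sqrt_lt' one_pos, one_pow]
  linarith [Real.exp_pos (-(t : ℝ))]

/-! ### The mean of the current and its covariance with the number of particles -/

lemma IsInput.integral_crossing (h : IsInput P p q ρ Set.univ N η₀) (hpq : p + q = 1)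
    (hρ : 0 ≤ ρ) {i j : ℤ} (hij : i ≠ j) :
    ∫ ω, occ (η₀ ω) i * (1 - occ (η₀ ω) j) ∂P = ρ * (1 - ρ) := by
  have hF : GoodMeasurable fun _ η => occ η i := GoodMeasurable.occ_init i
  have hi : Integrable (fun ω => occ (η₀ ω) i) P := hF.integrable h hpq (C := 1) fun _ η => by
    rw [abs_of_nonneg (occ_nonneg _ _)]; exact occ_le_one _ _
  have h1 := h.covariance_occ hρ hi (Set.mem_univ j)
  have h2 := h.integral_mul_occ_sub hpq hρ hF j fun b =>
    (hF.comp_config (measurable_update_config j b)).integrable h hpq (C := 1) fun _ η => by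
      rw [abs_of_nonneg (occ_nonneg _ _)]; exact occ_le_one _ _
  have hu : ∀ η : Config, ∀ b, occ (Function.update η j b) i = occ η i := fun η b => by
    simp only [occ, Function.update_of_ne hij]
  simp only [hu, sub_self, integral_zero, mul_zero] at h2
  have hsplit : ∀ ω, occ (η₀ ω) i * (1 - occ (η₀ ω) j) =
      (1 - ρ) * occ (η₀ ω) i - occ (η₀ ω) i * (occ (η₀ ω) j - ρ) := fun ω => by ring
  simp only [hsplit]
  rw [integral_sub (hi.const_mul _), h2, integral_const_mul, h.integral_occ hρ (Set.mem_univ i)]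
  · ring
  · exact hi.mul_bdd (c := 1 + |ρ|) (((measurable_occ j).comp h.measurable_init).sub
      measurable_const).aestronglyMeasurable (ae_of_all _ fun ω => by
        refine (norm_sub_le _ _).trans (add_le_add ?_ le_rfl)
        rw [Real.norm_of_nonneg (occ_nonneg _ _)]; exact occ_le_one _ _)

/-- The covariance of a jump with the number of particles. -/
lemma IsInput.integral_crossing_mul_sum (h : IsInput P p q ρ Set.univ N η₀) (hpq : p + q = 1)
    (hρ : 0 ≤ ρ) {i j : ℤ} (hij : i ≠ j) {I : Finset ℤ} (hi : i ∈ I) (hj : j ∈ I) :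
    ∫ ω, occ (η₀ ω) i * (1 - occ (η₀ ω) j) * ∑ k ∈ I, (occ (η₀ ω) k - ρ) ∂P =
      ρ * (1 - ρ) * (1 - 2 * ρ) := by
  have hb : ∀ η : Config, |occ η i * (1 - occ η j)| ≤ 1 := fun η => by
    unfold occ; split_ifs <;> norm_num
  have hF : GoodMeasurable fun _ η => occ η i * (1 - occ η j) :=
    (GoodMeasurable.occ_init i).mul ((GoodMeasurable.const 1).sub (GoodMeasurable.occ_init j))
  have hFi := hF.integrable h hpq fun _ η => hb η
  have hterm : ∀ k, Integrable
      (fun ω => occ (η₀ ω) i * (1 - occ (η₀ ω) j) * (occ (η₀ ω) k - ρ)) P := fun k =>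
    hFi.mul_bdd (c := 1 + |ρ|) (((measurable_occ k).comp h.measurable_init).sub
      measurable_const).aestronglyMeasurable (ae_of_all _ fun ω => by
        refine (norm_sub_le _ _).trans (add_le_add ?_ le_rfl)
        rw [Real.norm_of_nonneg (occ_nonneg _ _)]; exact occ_le_one _ _)
  -- Changing the bit at `k` affects the product only for `k = i` and `k = j`.
  have hval : ∀ k, ∫ ω, occ (η₀ ω) i * (1 - occ (η₀ ω) j) * (occ (η₀ ω) k - ρ) ∂P =
      (if k = i then ρ * (1 - ρ) * (1 - ρ) else 0) +
        if k = j then -(ρ * (1 - ρ) * ρ) else 0 := fun k => by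
    rw [h.integral_mul_occ_sub hpq hρ hF k fun b =>
      (hF.comp_config (measurable_update_config k b)).integrable h hpq fun _ η => hb _]
    have hoi := fun l => (GoodMeasurable.occ_init l).integrable h hpq (C := 1) fun _ η => by
      rw [abs_of_nonneg (occ_nonneg _ _)]; exact occ_le_one _ _
    have hself : ∀ (η : Config) (l : ℤ) b, occ (Function.update η l b) l = if b then 1 else 0 :=
      fun η l b => by simp only [occ, Function.update_self]
    have hne : ∀ (η : Config) {l l' : ℤ} b, l' ≠ l → occ (Function.update η l b) l' = occ η l' :=
      fun η l l' b hl => by simp only [occ, Function.update_of_ne hl]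
    by_cases hki : k = i
    · subst hki
      simp only [hself, hne _ _ hij.symm, if_true, if_neg hij, Bool.false_eq_true, if_false,
        one_mul, zero_mul, sub_zero, add_zero]
      rw [integral_sub (integrable_const _) (hoi j), h.integral_occ hρ (Set.mem_univ j)]
      simp
    · by_cases hkj : k = j
      · subst hkj
        simp only [hself, hne _ _ hij, if_true, if_neg hij.symm, Bool.false_eq_true, if_false,
          sub_self, mul_zero, sub_zero, mul_one, zero_sub, zero_add]
        rw [integral_neg, h.integral_occ hρ (Set.mem_univ i)]
        ring
      · simp only [hne _ _ (Ne.symm hki), hne _ _ (Ne.symm hkj), sub_self, integral_zero, mul_zero,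
          if_neg hki, if_neg hkj, add_zero]
  simp only [Finset.mul_sum]
  rw [integral_finsetSum _ fun k _ => hterm k]
  simp only [hval, Finset.sum_add_distrib, Finset.sum_ite_eq', if_pos hi, if_pos hj]
  ring

/-- The constant `1` is a conserved quantity, so the weighted formula on the ring gives the mean. -/
lemma IsInput.integral_bondCurrent (h : IsInput P p q ρ Set.univ N η₀) (hpq : p + q = 1)
    (hρ : 0 ≤ ρ) (t : ℝ≥0) :
    ∫ ω, bondCurrent 0 t (N ω) (η₀ ω) ∂P = flux p q ρ * t := by
  have hlim := h.tendsto_integral_ringCurrent_mul hpq t (W := fun _ => 1) measurable_const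
    (C := 1) fun _ => by simp
  have heq : ∀ᶠ K in atTop, ∫ ω, ringCurrent K (N ω) (η₀ ω) t * 1 ∂P = flux p q ρ * t := by
    filter_upwards [eventually_ge_atTop 1] with K hK
    have := h.integral_ringCurrent_mul hpq hK t (W := fun _ => 1) measurable_const (C := 1)
      (fun _ => by simp) fun _ _ _ => rfl
    rw [this]
    have h1 := h.integral_crossing hpq hρ (i := 0) (j := 1) (by norm_num)
    have h2 := h.integral_crossing hpq hρ (i := 1) (j := 0) (by norm_num)
    simp only [crossing, mul_one, if_true, Prod.mk.injEq, Bool.false_eq_true, if_false,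
      one_ne_zero, and_self]
    rw [integral_neg, h1, h2, flux]
    ring
  simp only [mul_one] at hlim heq
  exact tendsto_nhds_unique (hlim.congr' heq) tendsto_const_nhds |>.symm ▸ rfl

/-- Summed over the sites of a ring, the covariances become the covariance with the conserved total
number, which stationarity evaluates exactly. The result does not depend on the ring, and the
uniform geometric bound passes it to the limit. -/
lemma IsInput.hasSum_integral_bondCurrent_mul (h : IsInput P p q ρ Set.univ N η₀)
    (hpq : p + q = 1) (hρ : 0 ≤ ρ) (hρ1 : ρ ≤ 1) {t : ℝ≥0} (ht : 0 < t) :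
    HasSum (fun k => ∫ ω, bondCurrent 0 t (N ω) (η₀ ω) * (occ (η₀ ω) k - ρ) ∂P)
      (ρ * (1 - ρ) * (((p : ℝ) - q) * (1 - 2 * ρ) * t)) := by
  set g : ℤ → ℝ := fun k => ∫ ω, bondCurrent 0 t (N ω) (η₀ ω) * (occ (η₀ ω) k - ρ) ∂P with hg
  set bound : ℤ → ℝ := fun k =>
    (∫ ω, bondRings (N ω) t ^ 2 ∂P + 2) * √(1 - Real.exp (-t)) ^ k.natAbs with hbound
  have hbs : Summable bound := IsInput.summable_bound t _
  have hgs : Summable g :=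
    .of_norm_bounded hbs fun k => h.abs_integral_bondCurrent_mul_le hpq hρ hρ1 ht k
  -- Extension by zero beyond the ring puts the finite sums into the form of dominated convergence
  -- for series.
  set f : ℕ → ℤ → ℝ := fun K k => if k.natAbs ≤ K then
    ∫ ω, ringCurrent K (N ω) (η₀ ω) t * (occ (η₀ ω) k - ρ) ∂P else 0 with hf
  have hlim : Tendsto (fun K => ∑' k, f K k) atTop (𝓝 (∑' k, g k)) := by
    refine tendsto_tsum_of_dominated_convergence hbs (fun k => ?_) (Eventually.of_forall
      fun K k => ?_)
    · refine (h.tendsto_integral_ringCurrent_mul hpq t (measurable_occ_sub k ρ)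
        fun η => abs_occ_sub_le hρ hρ1 η k).congr' ?_
      filter_upwards [eventually_ge_atTop k.natAbs] with K hK
      simp only [hf, if_pos hK]
    · simp only [hf]
      split_ifs with hk
      · exact h.abs_integral_ringCurrent_mul_le hpq hρ hρ1 ht hk
      · rw [norm_zero]
        have : 0 ≤ ∫ ω, bondRings (N ω) t ^ 2 ∂P := integral_nonneg fun ω => sq_nonneg _
        positivity
  have hsum : ∀ᶠ K in atTop, ∑' k, f K k = ρ * (1 - ρ) * (((p : ℝ) - q) * (1 - 2 * ρ) * t) := by
    filter_upwards [eventually_ge_atTop 1] with K hK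
    have hcl : ∀ k, k.natAbs ≤ K ↔ k ∈ Finset.Icc (-(K : ℤ)) K := fun k => by
      rw [Finset.mem_Icc]; omega
    have h1 : ∑' k, f K k = ∑ k ∈ Finset.Icc (-(K : ℤ)) K,
        ∫ ω, ringCurrent K (N ω) (η₀ ω) t * (occ (η₀ ω) k - ρ) ∂P := by
      rw [tsum_eq_sum (s := Finset.Icc (-(K : ℤ)) K) fun k hk => by
        simp only [hf, hcl, if_neg hk]]
      exact Finset.sum_congr rfl fun k hk => by simp only [hf, hcl, if_pos hk]
    have hR : Integrable (fun ω => ringCurrent K (N ω) (η₀ ω) t) P :=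
      h.integrable_of_le_bondRings hpq (GoodMeasurable.ringCurrent K t)
        (fun n hn η => abs_ringCurrent_le hn K t η) measurable_id
    have hterm : ∀ k, Integrable
        (fun ω => ringCurrent K (N ω) (η₀ ω) t * (occ (η₀ ω) k - ρ)) P := fun k => hR.mul_bdd (c := 1)
      ((measurable_occ_sub k ρ).comp h.measurable_init).aestronglyMeasurable
      (ae_of_all _ fun ω => abs_occ_sub_le hρ hρ1 (η₀ ω) k)
    rw [h1, ← integral_finsetSum _ fun k _ => hterm k]
    simp only [← Finset.mul_sum]
    rw [h.integral_ringCurrent_mul hpq hK t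
      (W := fun η => ∑ k ∈ Finset.Icc (-(K : ℤ)) K, (occ η k - ρ))
      (Finset.measurable_fun_sum _ fun k _ => (measurable_occ k).sub measurable_const)
      (C := ∑ k ∈ Finset.Icc (-(K : ℤ)) K, 1)
      (fun η => (Finset.abs_sum_le_sum_abs _ _).trans
        (Finset.sum_le_sum fun k _ => abs_occ_sub_le hρ hρ1 η k))
      fun d k η => sum_occ_ringConserved K d k η ρ]
    have m0 : (0 : ℤ) ∈ Finset.Icc (-(K : ℤ)) K := by rw [Finset.mem_Icc]; omega
    have m1 : (1 : ℤ) ∈ Finset.Icc (-(K : ℤ)) K := by rw [Finset.mem_Icc]; omega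
    have e1 := h.integral_crossing_mul_sum hpq hρ (i := 0) (j := 1) (by norm_num) m0 m1
    have e2 := h.integral_crossing_mul_sum hpq hρ (i := 1) (j := 0) (by norm_num) m1 m0
    simp only [crossing, if_true, Prod.mk.injEq, Bool.false_eq_true, if_false,
      one_ne_zero, and_self, neg_mul]
    rw [integral_neg, e1, e2]
    ring
  rw [tendsto_nhds_unique (hlim.congr' hsum) tendsto_const_nhds |>.symm]
  exact hgs.hasSum

end Input

/-! ### The mean of the second class particle -/

section SecondClass

variable {Ω Ω' : Type*} [MeasurableSpace Ω] {P : Measure Ω} [IsProbabilityMeasure P] {p q : ℝ≥0}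
  {ρ : ℝ} {N : Ω → Clocks} {η₀ : Ω → Config} [MeasurableSpace Ω'] {P' : Measure Ω'}
  [IsProbabilityMeasure P'] {N' : Ω' → Clocks} {η₀' : Ω' → Config}

lemma abs_bondGain_le (k x : ℤ) : |bondGain k x| ≤ 1 := by
  unfold bondGain; split_ifs <;> norm_num

omit [IsProbabilityMeasure P'] in
-- For fixed `k` the gain has a constant sign, so absolute value and mean commute. Summability of
-- the means thereby becomes absolute summability.
lemma integral_norm_bondGain (Q : Ω' → ℤ) (k : ℤ) :
    ∫ ω, ‖bondGain k (Q ω)‖ ∂P' = |∫ ω, bondGain k (Q ω) ∂P'| := by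
  by_cases hk : 0 < k
  · have hle : ∀ x, bondGain k x ≤ 0 := fun x => by
      unfold bondGain; rw [if_pos hk]; split_ifs <;> norm_num
    rw [abs_of_nonpos (integral_nonpos fun ω => hle _), ← integral_neg]
    exact integral_congr_ae (ae_of_all _ fun ω => Real.norm_of_nonpos (hle _))
  · have hge : ∀ x, 0 ≤ bondGain k x := fun x => by
      unfold bondGain; rw [if_neg hk]; split_ifs <;> norm_num
    rw [abs_of_nonneg (integral_nonneg fun ω => hge _)]
    exact integral_congr_ae (ae_of_all _ fun ω => Real.norm_of_nonneg (hge _))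

lemma IsInput.integrable_bondGain (h' : IsInput P' p q ρ {0}ᶜ N' η₀') (hpq : p + q = 1)
    (hzero : ∀ᵐ ω ∂P', η₀' ω 0 = false) (t : ℝ≥0) (k : ℤ) :
    Integrable (fun ω => bondGain k (secondClass (N' ω) (η₀' ω) t)) P' :=
  .of_bound (h'.aemeasurable_secondClass_comp hpq hzero t (bondGain k)).aestronglyMeasurable 1
    (ae_of_all _ fun _ => abs_bondGain_le _ _)

lemma IsInput.hasSum_integral_bondGain (h : IsInput P p q ρ Set.univ N η₀)
    (h' : IsInput P' p q ρ {0}ᶜ N' η₀') (hpq : p + q = 1) (hρ : 0 < ρ) (hρ1 : ρ < 1)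
    (hzero : ∀ᵐ ω ∂P', η₀' ω 0 = false) {t : ℝ≥0} (ht : 0 < t) :
    HasSum (fun k => ∫ ω, bondGain k (secondClass (N' ω) (η₀' ω) t) ∂P')
      (((p : ℝ) - q) * (1 - 2 * ρ) * t) := by
  have hs := h.hasSum_integral_bondCurrent_mul hpq hρ.le hρ1.le ht
  simp only [h.integral_bondCurrent_mul_occ_sub h' hpq hρ.le hzero t] at hs
  have hc : ρ * (1 - ρ) ≠ 0 := (mul_pos hρ (sub_pos.2 hρ1)).ne'
  have := hs.mul_left (ρ * (1 - ρ))⁻¹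
  simpa only [inv_mul_cancel_left₀ hc] using this

lemma IsInput.summable_integral_norm_bondGain (h : IsInput P p q ρ Set.univ N η₀)
    (h' : IsInput P' p q ρ {0}ᶜ N' η₀') (hpq : p + q = 1) (hρ : 0 < ρ) (hρ1 : ρ < 1)
    (hzero : ∀ᵐ ω ∂P', η₀' ω 0 = false) {t : ℝ≥0} (ht : 0 < t) :
    Summable fun k => ∫ ω, ‖bondGain k (secondClass (N' ω) (η₀' ω) t)‖ ∂P' := by
  simp only [integral_norm_bondGain]
  exact (h.hasSum_integral_bondGain h' hpq hρ hρ1 hzero ht).summable.abs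

/-- The second class particle is integrable. -/
lemma IsInput.integrable_secondClass (h : IsInput P p q ρ Set.univ N η₀)
    (h' : IsInput P' p q ρ {0}ᶜ N' η₀') (hpq : p + q = 1) (hρ : 0 < ρ) (hρ1 : ρ < 1)
    (hzero : ∀ᵐ ω ∂P', η₀' ω 0 = false) {t : ℝ≥0} (ht : 0 < t) :
    Integrable (fun ω => (secondClass (N' ω) (η₀' ω) t : ℝ)) P' := by
  refine ⟨(h'.aemeasurable_secondClass hpq hzero t).aestronglyMeasurable, ?_⟩
  have hsum := h.summable_integral_norm_bondGain h' hpq hρ hρ1 hzero ht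
  -- `|Q|` is at most the sum of the absolute gains, because the gains sum to `Q`.
  have hle : ∀ ω, ‖(secondClass (N' ω) (η₀' ω) t : ℝ)‖ₑ ≤
      ∑' k, ‖bondGain k (secondClass (N' ω) (η₀' ω) t)‖ₑ := fun ω => by
    rw [← (hasSum_bondGain _).tsum_eq]
    exact enorm_tsum_le_tsum_enorm
  refine (lintegral_mono hle).trans_lt ?_
  rw [lintegral_tsum fun k =>
    (h'.aemeasurable_secondClass_comp hpq hzero t (bondGain k)).enorm]
  simp only [fun k => (ofReal_integral_norm_eq_lintegral_enorm
    (h'.integrable_bondGain hpq hzero t k)).symm]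
  exact hsum.tsum_ofReal_lt_top

/-- The mean of the second class particle. -/
lemma IsInput.integral_secondClass (h : IsInput P p q ρ Set.univ N η₀)
    (h' : IsInput P' p q ρ {0}ᶜ N' η₀') (hpq : p + q = 1) (hρ : 0 < ρ) (hρ1 : ρ < 1)
    (hzero : ∀ᵐ ω ∂P', η₀' ω 0 = false) {t : ℝ≥0} (ht : 0 < t) :
    ∫ ω, (secondClass (N' ω) (η₀' ω) t : ℝ) ∂P' = ((p : ℝ) - q) * (1 - 2 * ρ) * t := by
  have hsum := hasSum_integral_of_summable_integral_norm
    (h'.integrable_bondGain hpq hzero t)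
    (h.summable_integral_norm_bondGain h' hpq hρ hρ1 hzero ht)
  simp only [(hasSum_bondGain _).tsum_eq] at hsum
  exact hsum.unique (h.hasSum_integral_bondGain h' hpq hρ hρ1 hzero ht)

end SecondClass

/-! ### Locality of the discretized dynamics -/

lemma configJump_congr {v : ClockIndex → ℤ} {e : ClockIndex} {η ζ : Config} {B : Set ℤ}
    (h : ∀ i ∈ B, η i = ζ i) (he : e.1 ∈ B) (hv : v e ∈ B) :
    ∀ i ∈ B, configJump v e η i = configJump v e ζ i := by
  intro i hi
  unfold configJump
  rw [h _ he, h _ hv]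
  split_ifs
  · simp only [Function.update_apply, h i hi]
  · exact h i hi

lemma configRun_congr {v : ClockIndex → ℤ} {l : List ClockIndex} {η ζ : Config} {B : Set ℤ}
    (h : ∀ i ∈ B, η i = ζ i) (hl : ∀ e ∈ l, e.1 ∈ B ∧ v e ∈ B) :
    ∀ i ∈ B, configRun v l η i = configRun v l ζ i := by
  induction l with
  | nil => exact h
  | cons e l ih =>
    rw [List.forall_mem_cons] at hl
    exact configJump_congr (ih hl.2) hl.1.1 hl.1.2

lemma crossings_congr {v : ClockIndex → ℤ} {l : List ClockIndex} {η ζ : Config} {B : Set ℤ}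
    (h0 : 0 ∈ B) (h1 : 1 ∈ B) (h : ∀ i ∈ B, η i = ζ i) (hl : ∀ e ∈ l, e.1 ∈ B ∧ v e ∈ B) :
    crossings v l η = crossings v l ζ := by
  induction l with
  | nil => rfl
  | cons e l ih =>
    rw [List.forall_mem_cons] at hl
    have hr := configRun_congr h hl.2
    simp only [crossings, crossing, occ, hr 0 h0, hr 1 h1, ih hl.2]

lemma ringTarget_mem_Icc {K : ℕ} {e : ClockIndex} (he : e ∈ ringClocks K) :
    ringTarget K e ∈ Set.Icc (-(K : ℤ)) K := by
  rw [mem_ringClocks] at he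
  obtain ⟨i, d⟩ := e
  cases d <;>
  · simp only [ringTarget, target, Set.mem_Icc, Prod.mk.injEq, Bool.true_eq_false,
      Bool.false_eq_true, and_false, and_true, if_false, if_true] at he ⊢
    split_ifs <;> omega

/-- All jumps on the ring stay on its sites, so clocks and initial values elsewhere are irrelevant.
-/
lemma gridCurrent_congr {K : ℕ} (hK : 1 ≤ K) {d d' : ClockIndex → ℕ → ℕ} {m : ℕ} {η ζ : Config}
    (hd : ∀ e ∈ ringClocks K, ∀ j < m, d e j = d' e j)
    (h : ∀ i ∈ Set.Icc (-(K : ℤ)) K, η i = ζ i) :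
    gridCurrent K d m η = gridCurrent K d' m ζ := by
  rw [gridCurrent, gridCurrent, gridList_congr hd]
  refine crossings_congr (B := Set.Icc (-(K : ℤ)) K) (by rw [Set.mem_Icc]; omega)
    (by rw [Set.mem_Icc]; omega) h fun e he => ?_
  have := mem_of_mem_gridList he
  exact ⟨mem_ringClocks.1 this, ringTarget_mem_Icc this⟩

/-- The discretized current as a functional of the noise. -/
noncomputable def noiseCurrent (K m : ℕ) (y : (ClockIndex × ℕ) ⊕ ℤ → ℕ) : ℝ :=
  gridCurrent K (noiseIncrement y) m (noiseConfig y)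

/-- The translation of the indices of the noise. -/
def shiftIndex (L : ℤ) : (ClockIndex × ℕ) ⊕ ℤ → (ClockIndex × ℕ) ⊕ ℤ :=
  Sum.map (fun x => ((x.1.1 + L, x.1.2), x.2)) (· + L)

lemma measurable_noiseCurrent (K m : ℕ) : Measurable (noiseCurrent K m) :=
  (measurable_gridCurrent K m).comp measurable_noiseIncrement_noiseConfig

lemma dependsOn_noiseCurrent {K : ℕ} (hK : 1 ≤ K) (m : ℕ) :
    DependsOn (noiseCurrent K m)
      (Sum.elim (fun x => x.1.1 ∈ Set.Icc (-(K : ℤ)) K) (· ∈ Set.Icc (-(K : ℤ)) K)) := by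
  intro x y hxy
  refine gridCurrent_congr hK (fun e he j _ => hxy (Sum.inl (e, j)) (mem_ringClocks.1 he))
    fun i hi => ?_
  simp only [noiseConfig, hxy (Sum.inr i) hi]

lemma noiseCurrent_noise (K m : ℕ) (t : ℝ≥0) (n : Clocks) (η : Config) :
    noiseCurrent K m (noise t m n η) = gridCurrent K (increment n t m) m η := by
  rw [noiseCurrent, noiseIncrement_noise, noiseConfig_noise]

lemma noise_shift (t : ℝ≥0) (m : ℕ) (L : ℤ) (n : Clocks) (η : Config) :
    noise t m (shiftClocks L n) (shiftConfig L η) = fun x => noise t m n η (shiftIndex L x) := by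
  funext x
  rcases x with x | i <;> rfl

section Decay

variable {Ω : Type*} [MeasurableSpace Ω] {P : Measure Ω} [IsProbabilityMeasure P] {p q : ℝ≥0}
  {ρ : ℝ} {N : Ω → Clocks} {η₀ : Ω → Config}

/-- The discretized currents at distant bonds are independent. -/
lemma IsInput.indepFun_gridCurrent (h : IsInput P p q ρ Set.univ N η₀) {K : ℕ} (hK : 1 ≤ K)
    (t : ℝ≥0) (m : ℕ) {L : ℤ} (hL : 2 * (K : ℤ) < L) :
    IndepFun (fun ω => gridCurrent K (increment (N ω) t m) m (η₀ ω))
      (fun ω => gridCurrent K (increment (shiftClocks L (N ω)) t m) m (shiftConfig L (η₀ ω))) P := by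
  -- The two currents read only indices with sites in `[-K, K]` and `[L - K, L + K]`, which are
  -- disjoint as `L > 2K`.
  have hind := indepFun_of_dependsOn (h.iIndepFun_noise t m) (h.measurable_noise t m)
    (Φ := noiseCurrent K m) (Ψ := fun y => noiseCurrent K m fun x => y (shiftIndex L x))
    (measurable_noiseCurrent K m) ((measurable_noiseCurrent K m).comp
      (measurable_pi_lambda _ fun x => measurable_pi_apply _))
    (dependsOn_noiseCurrent hK m)
    (T := Sum.elim (fun x => x.1.1 - L ∈ Set.Icc (-(K : ℤ)) K)
      (fun i => i - L ∈ Set.Icc (-(K : ℤ)) K))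
    (fun x y hxy => dependsOn_noiseCurrent hK m fun i hi => hxy _ (by
      rcases i with i | i
      · change i.1.1 ∈ Set.Icc (-(K : ℤ)) K at hi
        change i.1.1 + L - L ∈ Set.Icc (-(K : ℤ)) K
        rwa [add_sub_cancel_right]
      · change i ∈ Set.Icc (-(K : ℤ)) K at hi
        change i + L - L ∈ Set.Icc (-(K : ℤ)) K
        rwa [add_sub_cancel_right]))
    (Set.disjoint_left.2 fun i hi hi' => by
      rcases i with i | i
      · change i.1.1 ∈ Set.Icc (-(K : ℤ)) K at hi
        change i.1.1 - L ∈ Set.Icc (-(K : ℤ)) K at hi'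
        rw [Set.mem_Icc] at hi hi'; omega
      · change i ∈ Set.Icc (-(K : ℤ)) K at hi
        change i - L ∈ Set.Icc (-(K : ℤ)) K at hi'
        rw [Set.mem_Icc] at hi hi'; omega)
  have h1 : ∀ ω, noiseCurrent K m (fun x => noise t m (N ω) (η₀ ω) (shiftIndex L x)) =
      gridCurrent K (increment (shiftClocks L (N ω)) t m) m (shiftConfig L (η₀ ω)) := fun ω => by
    rw [← noise_shift, noiseCurrent_noise]
  have h2 : ∀ ω, noiseCurrent K m (fun x => noise t m (N ω) (η₀ ω) x) =
      gridCurrent K (increment (N ω) t m) m (η₀ ω) := fun ω => noiseCurrent_noise K m t _ _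
  simpa only [h1, h2] using hind

lemma GoodMeasurable.gridCurrent (K m : ℕ) (t : ℝ≥0) :
    GoodMeasurable fun n η => gridCurrent K (increment n t m) m η :=
  .of_measurable ((measurable_gridCurrent K m).comp
    (((measurable_increment t m).comp measurable_fst).prodMk measurable_snd))

/-- Functionals dominated by the rings converge in mean square if they converge pointwise. -/
lemma IsInput.tendsto_integral_sq_sub {A : Set ℤ} (h : IsInput P p q ρ A N η₀) (hpq : p + q = 1)
    {F : ℕ → Clocks → Config → ℝ} {G : Clocks → Config → ℝ} {t : ℝ≥0}
    (hF : ∀ m, GoodMeasurable (F m)) (hG : GoodMeasurable G)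
    (hFb : ∀ m n, Good n → ∀ η, |F m n η| ≤ bondRings n t)
    (hGb : ∀ n, Good n → ∀ η, |G n η| ≤ bondRings n t)
    (hlim : ∀ n, Good n → ∀ η, ∀ᶠ m in atTop, F m n η = G n η) :
    Tendsto (fun m => ∫ ω, (G (N ω) (η₀ ω) - F m (N ω) (η₀ ω)) ^ 2 ∂P) atTop (𝓝 0) := by
  have := tendsto_integral_of_dominated_convergence (μ := P)
    (F := fun m ω => (G (N ω) (η₀ ω) - F m (N ω) (η₀ ω)) ^ 2) (f := fun _ => 0)
    (fun ω => 4 * bondRings (N ω) t ^ 2)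
    (fun m => (((hG.aemeasurable h hpq).sub ((hF m).aemeasurable h hpq)).pow_const
      2).aestronglyMeasurable)
    ((h.memLp_bondRings t).integrable_sq.const_mul 4) (fun m => by
      filter_upwards [h.ae_good hpq] with ω hω
      have h1 := abs_le.1 (hFb m _ hω (η₀ ω))
      have h2 := abs_le.1 (hGb _ hω (η₀ ω))
      rw [Real.norm_of_nonneg (sq_nonneg _)]
      nlinarith) (by
      filter_upwards [h.ae_good hpq] with ω hω
      refine tendsto_const_nhds.congr' ((hlim _ hω (η₀ ω)).mono fun m hm => ?_)
      simp only [hm, sub_self]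
      norm_num)
  simpa using this

/-- In mean square the current is close to one that reads finitely many sites: choose first the
ring, then the grid. Each error is below `ε / 4`, as `(a + b) ^ 2 ≤ 2 a ^ 2 + 2 b ^ 2`. -/
lemma IsInput.exists_gridCurrent_approx (h : IsInput P p q ρ Set.univ N η₀) (hpq : p + q = 1)
    (t : ℝ≥0) {ε : ℝ} (hε : 0 < ε) :
    ∃ K m : ℕ, 1 ≤ K ∧ m ≠ 0 ∧
      ∫ ω, (bondCurrent 0 t (N ω) (η₀ ω) - gridCurrent K (increment (N ω) t m) m (η₀ ω)) ^ 2 ∂P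
        ≤ ε := by
  have h1 := h.tendsto_integral_sq_sub hpq (t := t) (F := fun K n η => ringCurrent K n η t)
    (G := bondCurrent 0 t) (fun K => GoodMeasurable.ringCurrent K t)
    (GoodMeasurable.bondCurrent 0 t) (fun K n hn η => abs_ringCurrent_le hn K t η)
    (fun n hn η => abs_bondCurrent_zero_le hn t η) fun n hn η => by
      simp only [bondCurrent_zero]; exact eventually_ringCurrent_eq hn t η
  obtain ⟨K, hK, hK1⟩ :=
    ((h1.eventually (gt_mem_nhds (by positivity : 0 < ε / 4))).and (eventually_ge_atTop 1)).exists
  have h2 := h.tendsto_integral_sq_sub hpq (t := t)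
    (F := fun m n η => gridCurrent K (increment n t (m + 1)) (m + 1) η)
    (G := fun n η => ringCurrent K n η t) (fun m => GoodMeasurable.gridCurrent K (m + 1) t)
    (GoodMeasurable.ringCurrent K t)
    (fun m n hn η => abs_gridCurrent_le hn K t m.succ_ne_zero η)
    (fun n hn η => abs_ringCurrent_le hn K t η) fun n hn η =>
      (tendsto_add_atTop_nat 1).eventually (eventually_gridCurrent_eq hn K t η)
  obtain ⟨m, hm⟩ := (h2.eventually (gt_mem_nhds (by positivity : 0 < ε / 4))).exists
  refine ⟨K, m + 1, hK1, m.succ_ne_zero, ?_⟩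
  have hB := h.memLp_of_le_bondRings hpq (GoodMeasurable.bondCurrent 0 t)
    (fun n hn η => abs_bondCurrent_zero_le hn t η)
  have hR := h.memLp_of_le_bondRings hpq (GoodMeasurable.ringCurrent K t)
    (fun n hn η => abs_ringCurrent_le hn K t η)
  have hD := h.memLp_of_le_bondRings hpq (GoodMeasurable.gridCurrent K (m + 1) t)
    (fun n hn η => abs_gridCurrent_le hn K t m.succ_ne_zero η)
  have i1 : Integrable (fun ω => (bondCurrent 0 t (N ω) (η₀ ω) -
      ringCurrent K (N ω) (η₀ ω) t) ^ 2) P := (hB.sub hR).integrable_sq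
  have i2 : Integrable (fun ω => (ringCurrent K (N ω) (η₀ ω) t -
      gridCurrent K (increment (N ω) t (m + 1)) (m + 1) (η₀ ω)) ^ 2) P := (hR.sub hD).integrable_sq
  have i3 : Integrable (fun ω => (bondCurrent 0 t (N ω) (η₀ ω) -
      gridCurrent K (increment (N ω) t (m + 1)) (m + 1) (η₀ ω)) ^ 2) P := (hB.sub hD).integrable_sq
  have hle := integral_mono (μ := P) i3 ((i1.const_mul 2).add (i2.const_mul 2)) fun ω => by
    simp only [Pi.add_apply]
    nlinarith [sq_nonneg ((bondCurrent 0 t (N ω) (η₀ ω) - ringCurrent K (N ω) (η₀ ω) t) -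
      (ringCurrent K (N ω) (η₀ ω) t -
        gridCurrent K (increment (N ω) t (m + 1)) (m + 1) (η₀ ω)))]
  refine hle.trans ?_
  simp only [Pi.add_apply]
  rw [integral_add (i1.const_mul 2) (i2.const_mul 2), integral_const_mul, integral_const_mul]
  linarith

omit [IsProbabilityMeasure P] in
-- A weighted form of Cauchy–Schwarz; the free weight lets a small second moment compensate for a
-- merely bounded one.
lemma abs_covariance_le [IsProbabilityMeasure P] {X Y : Ω → ℝ} (hX : MemLp X 2 P)
    (hY : MemLp Y 2 P) {δ : ℝ} (hδ : 0 < δ) :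
    |covariance X Y P| ≤ (δ⁻¹ * ∫ ω, X ω ^ 2 ∂P + δ * ∫ ω, Y ω ^ 2 ∂P) / 2 := by
  have hvX := variance_le_expectation_sq (μ := P) hX.aestronglyMeasurable
  have hvY := variance_le_expectation_sq (μ := P) hY.aestronglyMeasurable
  rw [variance_eq_integral hX.aemeasurable] at hvX
  rw [variance_eq_integral hY.aemeasurable] at hvY
  simp only [Pi.pow_apply] at hvX hvY
  have hX' : Integrable (fun ω => (X ω - ∫ ω, X ω ∂P) ^ 2) P :=
    (hX.sub (memLp_const _)).integrable_sq
  have hY' : Integrable (fun ω => (Y ω - ∫ ω, Y ω ∂P) ^ 2) P :=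
    (hY.sub (memLp_const _)).integrable_sq
  have hle := norm_integral_le_of_norm_le (μ := P)
    (f := fun ω => (X ω - ∫ ω, X ω ∂P) * (Y ω - ∫ ω, Y ω ∂P))
    (((hX'.const_mul δ⁻¹).add (hY'.const_mul δ)).div_const 2) (ae_of_all _ fun ω => by
      simp only [Pi.add_apply]
      rw [Real.norm_eq_abs, abs_mul]
      set a := X ω - ∫ ω, X ω ∂P
      set b := Y ω - ∫ ω, Y ω ∂P
      have h1 : 0 ≤ δ⁻¹ * (|a| - δ * |b|) ^ 2 := by positivity
      have h2 : δ⁻¹ * (|a| - δ * |b|) ^ 2 = δ⁻¹ * |a| ^ 2 - 2 * (|a| * |b|) + δ * |b| ^ 2 := by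
        field_simp; ring
      rw [sq_abs, sq_abs] at h2
      linarith)
  refine hle.trans ?_
  simp only [Pi.add_apply]
  rw [integral_div, integral_add (hX'.const_mul δ⁻¹) (hY'.const_mul δ), integral_const_mul,
    integral_const_mul]
  gcongr

/-- The currents at distant bonds decorrelate. -/
lemma IsInput.tendsto_covariance_bondCurrent (h : IsInput P p q ρ Set.univ N η₀)
    (hpq : p + q = 1) (t : ℝ≥0) :
    Tendsto (fun L : ℤ => covariance (fun ω => bondCurrent 0 t (N ω) (η₀ ω))
      (fun ω => bondCurrent L t (N ω) (η₀ ω)) P) atTop (𝓝 0) := by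
  set B := ∫ ω, bondRings (N ω) t ^ 2 ∂P with hB
  have hB0 : 0 ≤ B := integral_nonneg fun ω => sq_nonneg _
  rw [Metric.tendsto_atTop]
  intro ε hε
  -- The two covariances below add up to at most `δ * (B + 1) = ε / 2`.
  set δ := ε / (2 * (B + 1)) with hδdef
  have hδ : 0 < δ := by positivity
  obtain ⟨K, m, hK, hm, happ⟩ := h.exists_gridCurrent_approx hpq t (ε := δ ^ 2) (by positivity)
  refine ⟨2 * K + 1, fun L hL => ?_⟩
  rw [dist_zero_right, Real.norm_eq_abs]
  have hbG := GoodMeasurable.bondCurrent 0 t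
  have hgG := GoodMeasurable.gridCurrent K m t
  have hbb : ∀ n, Good n → ∀ η, |bondCurrent 0 t n η| ≤ bondRings n t :=
    fun n hn η => abs_bondCurrent_zero_le hn t η
  have hgb : ∀ n, Good n → ∀ η, |gridCurrent K (increment n t m) m η| ≤ bondRings n t :=
    fun n hn η => abs_gridCurrent_le hn K t hm η
  set X : Ω → ℝ := fun ω => bondCurrent 0 t (N ω) (η₀ ω) with hXdef
  set D : Ω → ℝ := fun ω => gridCurrent K (increment (N ω) t m) m (η₀ ω) with hDdef
  set Y : Ω → ℝ := fun ω => bondCurrent 0 t (shiftClocks L (N ω)) (shiftConfig L (η₀ ω)) with hYdef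
  set D' : Ω → ℝ := fun ω =>
    gridCurrent K (increment (shiftClocks L (N ω)) t m) m (shiftConfig L (η₀ ω)) with hD'def
  have hYeq : (fun ω => bondCurrent L t (N ω) (η₀ ω)) = Y := by
    funext ω; simp only [hYdef, bondCurrent_shift, zero_add]
  have mX : MemLp X 2 P := h.memLp_of_le_bondRings hpq hbG hbb
  have mD : MemLp D 2 P := h.memLp_of_le_bondRings hpq hgG hgb
  have mY : MemLp Y 2 P := (h.shift L).memLp_of_le_bondRings hpq hbG hbb
  have mD' : MemLp D' 2 P := (h.shift L).memLp_of_le_bondRings hpq hgG hgb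
  have hind : covariance D D' P = 0 :=
    (h.indepFun_gridCurrent hK t m (by omega)).covariance_eq_zero mD mD'
  have hsq : ∀ {F : Clocks → Config → ℝ}, (∀ n, Good n → ∀ η, |F n η| ≤ bondRings n t) →
      GoodMeasurable F → ∫ ω, F (N ω) (η₀ ω) ^ 2 ∂P ≤ B := fun {F} hF hFm => by
    refine integral_mono_ae (h.memLp_of_le_bondRings hpq hFm hF).integrable_sq
      (h.memLp_bondRings t).integrable_sq ?_
    filter_upwards [h.ae_good hpq] with ω hω
    exact sq_le_sq' (abs_le.1 (hF _ hω _)).1 (abs_le.1 (hF _ hω _)).2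
  have hY2 : ∫ ω, Y ω ^ 2 ∂P ≤ B := by
    have := (hbG.mul hbG).integral_shift h hpq L
    simp only [← pow_two] at this
    rw [hYdef, this]
    exact hsq hbb hbG
  have hD2 : ∫ ω, D ω ^ 2 ∂P ≤ B := hsq hgb hgG
  have hYD : ∫ ω, (Y ω - D' ω) ^ 2 ∂P ≤ δ ^ 2 := by
    have := ((hbG.sub hgG).mul (hbG.sub hgG)).integral_shift h hpq L
    simp only [← pow_two] at this
    rw [hYdef, hD'def, this]
    exact happ
  -- The local approximations `D` and `D'` are independent, so each remaining term contains a small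
  -- approximation error.
  have hdecomp : covariance X Y P = covariance (X - D) Y P + covariance D (Y - D') P := by
    rw [covariance_sub_left mX mD mY, covariance_sub_right mD mY mD', hind]
    ring
  have h1 := abs_covariance_le (mX.sub mD) mY hδ
  have h2 := abs_covariance_le mD (mY.sub mD') (inv_pos.2 hδ)
  simp only [Pi.sub_apply, inv_inv] at h1 h2
  have e1 : δ⁻¹ * ∫ ω, (X ω - D ω) ^ 2 ∂P ≤ δ := by
    refine (mul_le_mul_of_nonneg_left happ (inv_pos.2 hδ).le).trans_eq ?_
    field_simp
  have e2 : δ⁻¹ * ∫ ω, (Y ω - D' ω) ^ 2 ∂P ≤ δ := by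
    refine (mul_le_mul_of_nonneg_left hYD (inv_pos.2 hδ).le).trans_eq ?_
    field_simp
  have e3 : δ * ∫ ω, Y ω ^ 2 ∂P ≤ δ * B := mul_le_mul_of_nonneg_left hY2 hδ.le
  have e4 : δ * ∫ ω, D ω ^ 2 ∂P ≤ δ * B := mul_le_mul_of_nonneg_left hD2 hδ.le
  have hfin : δ * (B + 1) = ε / 2 := by rw [hδdef]; field_simp
  rw [hYeq, hdecomp]
  refine (abs_add_le _ _).trans_lt ?_
  linarith

/-- The current decorrelates from the initial occupation of distant sites. -/
lemma IsInput.tendsto_covariance_bondCurrent_occ (h : IsInput P p q ρ Set.univ N η₀)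
    (hpq : p + q = 1) (hρ : 0 ≤ ρ) (hρ1 : ρ ≤ 1) {t : ℝ≥0} (ht : 0 < t) :
    Tendsto (fun k : ℤ => covariance (fun ω => bondCurrent 0 t (N ω) (η₀ ω))
      (fun ω => occ (η₀ ω) k) P) cofinite (𝓝 0) := by
  have hi := (h.memLp_of_le_bondRings hpq (GoodMeasurable.bondCurrent 0 t)
    (fun n hn η => abs_bondCurrent_zero_le hn t η)).integrable one_le_two
  simp only [fun k => h.covariance_occ hρ hi (Set.mem_univ k)]
  exact (h.hasSum_integral_bondCurrent_mul hpq hρ hρ1 ht).summable.tendsto_cofinite_zero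

end Decay

/-! ### The variance of the current -/

/-- The number of pairs of sites in the windows of size `M` around `z` and the origin whose
difference is `x`. -/
noncomputable def pairCount (z : ℤ) (M : ℕ) (x : ℤ) : ℝ :=
  ∑ i ∈ Finset.Ioc z M, ∑ k ∈ Finset.Ioc (-(M : ℤ)) 0, (if x = i - k then 1 else 0) +
    ∑ i ∈ Finset.Ioc 0 (M : ℤ), ∑ k ∈ Finset.Ioc (-(M : ℤ)) z, if x = k - i then 1 else 0

/-- Once `x` and `i` are given, the other site is determined; counting the admissible `i` gives two
intervals, which grow with `M` to those that make up `|x - z|`. -/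
lemma pairCount_eq (z : ℤ) (M : ℕ) (x : ℤ) :
    pairCount z M x = ((Finset.Ioc (max z (x - M)) (min M x)).card : ℝ) +
      (Finset.Ioc (max 0 (-M - x)) (min M (z - x))).card := by
  unfold pairCount
  have h1 : ∀ i : ℤ, ∑ k ∈ Finset.Ioc (-(M : ℤ)) 0, (if x = i - k then (1 : ℝ) else 0) =
      if i - x ∈ Finset.Ioc (-(M : ℤ)) 0 then 1 else 0 := fun i => by
    exact Eq.trans (Finset.sum_congr rfl fun k _ => if_congr (by omega) rfl rfl)
      (Finset.sum_ite_eq _ (i - x) fun _ => (1 : ℝ))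
  have h2 : ∀ i : ℤ, ∑ k ∈ Finset.Ioc (-(M : ℤ)) z, (if x = k - i then (1 : ℝ) else 0) =
      if x + i ∈ Finset.Ioc (-(M : ℤ)) z then 1 else 0 := fun i => by
    exact Eq.trans (Finset.sum_congr rfl fun k _ => if_congr (by omega) rfl rfl)
      (Finset.sum_ite_eq _ (x + i) fun _ => (1 : ℝ))
  rw [Finset.sum_congr rfl fun i _ => h1 i, Finset.sum_congr rfl fun i _ => h2 i,
    Finset.sum_boole, Finset.sum_boole]
  congr 3 <;>
  · ext i
    simp only [Finset.mem_filter, Finset.mem_Ioc]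
    omega

lemma pairCount_nonneg (z : ℤ) (M : ℕ) (x : ℤ) : 0 ≤ pairCount z M x := by
  rw [pairCount_eq]; positivity

lemma abs_sub_eq_card (z x : ℤ) :
    |(x : ℝ) - z| = ((Finset.Ioc z x).card : ℝ) + (Finset.Ioc 0 (z - x)).card := by
  suffices h : |x - z| = ((Finset.Ioc z x).card : ℤ) + (Finset.Ioc 0 (z - x)).card by
    exact_mod_cast congrArg (Int.cast : ℤ → ℝ) h
  rw [Int.card_Ioc, Int.card_Ioc]
  rcases le_total z x with h | h
  · rw [abs_of_nonneg (by omega)]; omega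
  · rw [abs_of_nonpos (by omega)]; omega

lemma pairCount_le (z : ℤ) (M : ℕ) (x : ℤ) : pairCount z M x ≤ |(x : ℝ) - z| := by
  rw [pairCount_eq, abs_sub_eq_card]
  gcongr <;> omega

lemma eventually_pairCount_eq (z x : ℤ) : ∀ᶠ M in atTop, pairCount z M x = |(x : ℝ) - z| := by
  filter_upwards [eventually_ge_atTop (z.natAbs + x.natAbs)] with M hM
  rw [pairCount_eq, abs_sub_eq_card, max_eq_left (by omega), min_eq_right (by omega),
    max_eq_left (by omega), min_eq_right (by omega)]

section Variance

variable {Ω Ω' : Type*} [MeasurableSpace Ω] {P : Measure Ω} [IsProbabilityMeasure P] {p q : ℝ≥0}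
  {ρ : ℝ} {N : Ω → Clocks} {η₀ : Ω → Config} [MeasurableSpace Ω'] {P' : Measure Ω'}
  [IsProbabilityMeasure P'] {N' : Ω' → Clocks} {η₀' : Ω' → Config}

lemma abs_occ_le (η : Config) (i : ℤ) : |occ η i| ≤ 1 := by
  rw [abs_of_nonneg (occ_nonneg _ _)]; exact occ_le_one _ _

lemma IsInput.memLp_occ (h : IsInput P p q ρ Set.univ N η₀) (hpq : p + q = 1) (i : ℤ) :
    MemLp (fun ω => occ (η₀ ω) i) 2 P :=
  (GoodMeasurable.occ_init i).memLp_two h hpq fun _ η => abs_occ_le η i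

lemma IsInput.memLp_occ_process (h : IsInput P p q ρ Set.univ N η₀) (hpq : p + q = 1) (t : ℝ≥0)
    (i : ℤ) : MemLp (fun ω => occ (process (N ω) (η₀ ω) t) i) 2 P :=
  (GoodMeasurable.occ_process t i).memLp_two h hpq fun _ _ => abs_occ_le _ i

lemma IsInput.memLp_bondCurrent (h : IsInput P p q ρ Set.univ N η₀) (hpq : p + q = 1) (t : ℝ≥0)
    (M : ℤ) : MemLp (fun ω => bondCurrent M t (N ω) (η₀ ω)) 2 P := by
  have := (h.shift M).memLp_of_le_bondRings hpq (GoodMeasurable.bondCurrent 0 t)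
    fun n hn η => abs_bondCurrent_zero_le hn t η
  simpa only [bondCurrent_shift, zero_add] using this

/-- The initial occupation variables are uncorrelated. -/
lemma IsInput.covariance_occ_occ (h : IsInput P p q ρ Set.univ N η₀) (hpq : p + q = 1) {i k : ℤ}
    (hik : i ≠ k) :
    covariance (fun ω => occ (η₀ ω) i) (fun ω => occ (η₀ ω) k) P = 0 := by
  have hbool : Measurable fun b : Bool => if b then (1 : ℝ) else 0 := measurable_of_countable _
  exact ((h.iIndepFun_init.indepFun hik).comp hbool hbool).covariance_eq_zero
    (h.memLp_occ hpq i) (h.memLp_occ hpq k)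

/-- The occupation variables at a fixed time are uncorrelated. -/
lemma IsInput.covariance_process_process (h : IsInput P p q ρ Set.univ N η₀) (hpq : p + q = 1)
    (t : ℝ≥0) {i k : ℤ} (hik : i ≠ k) :
    covariance (fun ω => occ (process (N ω) (η₀ ω) t) i)
      (fun ω => occ (process (N ω) (η₀ ω) t) k) P = 0 := by
  rw [← h.covariance_occ_occ hpq hik, covariance_eq_sub (h.memLp_occ_process hpq t i)
    (h.memLp_occ_process hpq t k), covariance_eq_sub (h.memLp_occ hpq i) (h.memLp_occ hpq k)]
  have h1 := fun j => h.integral_process hpq t (measurable_occ j) (fun η => abs_occ_le η j)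
    (I := {j}) fun η ζ hj => by simp only [occ, hj j (Finset.mem_singleton_self j)]
  have h2 := h.integral_process hpq t ((measurable_occ i).mul (measurable_occ k)) (C := 1)
    (fun η => by
      rw [Pi.mul_apply, abs_mul]
      exact mul_le_one₀ (abs_occ_le η i) (abs_nonneg _) (abs_occ_le η k))
    (I := {i, k}) fun η ζ hj => by
      simp only [Pi.mul_apply, occ, hj i (by simp), hj k (by simp)]
  simp only [Pi.mul_apply] at h2 ⊢
  rw [h1, h1, h2]

lemma IsInput.integral_pairCount (h' : IsInput P' p q ρ {0}ᶜ N' η₀') (hpq : p + q = 1)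
    (hzero : ∀ᵐ ω ∂P', η₀' ω 0 = false) (t : ℝ≥0) (z : ℤ) (M : ℕ) :
    ∫ ω, pairCount z M (secondClass (N' ω) (η₀' ω) t) ∂P' =
      ∑ i ∈ Finset.Ioc z M, ∑ k ∈ Finset.Ioc (-(M : ℤ)) 0,
        P'.real {ω | secondClass (N' ω) (η₀' ω) t = i - k} +
      ∑ i ∈ Finset.Ioc 0 (M : ℤ), ∑ k ∈ Finset.Ioc (-(M : ℤ)) z,
        P'.real {ω | secondClass (N' ω) (η₀' ω) t = k - i} := by
  have hval : ∀ j, ∫ ω, (if secondClass (N' ω) (η₀' ω) t = j then (1 : ℝ) else 0) ∂P' =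
      P'.real {ω | secondClass (N' ω) (η₀' ω) t = j} := fun j => by
    have := integral_indicator₀ (f := fun _ => (1 : ℝ))
      (h'.nullMeasurableSet_secondClass hpq hzero t j)
    rw [setIntegral_const, smul_eq_mul, mul_one] at this
    rw [← this]
    exact integral_congr_ae (ae_of_all _ fun ω => by
      simp only [Set.indicator_apply, Set.mem_ofPred_eq])
  have hint : ∀ j, Integrable
      (fun ω => if secondClass (N' ω) (η₀' ω) t = j then (1 : ℝ) else 0) P' := fun j =>
    .of_bound (h'.aemeasurable_secondClass_comp hpq hzero t
      fun x => if x = j then 1 else 0).aestronglyMeasurable 1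
      (ae_of_all _ fun ω => by split_ifs <;> simp)
  have hint1 : ∀ (I : Finset ℤ) (f : ℤ → ℤ), Integrable
      (fun ω => ∑ k ∈ I, if secondClass (N' ω) (η₀' ω) t = f k then (1 : ℝ) else 0) P' :=
    fun I f => integrable_finsetSum _ fun k _ => hint _
  unfold pairCount
  rw [integral_add (integrable_finsetSum _ fun i _ => hint1 _ _)
    (integrable_finsetSum _ fun i _ => hint1 _ _),
    integral_finsetSum _ fun i _ => hint1 _ _, integral_finsetSum _ fun i _ => hint1 _ _]
  simp only [fun (I : Finset ℤ) (f : ℤ → ℤ) => integral_finsetSum I fun k _ => hint (f k), hval]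

/-- The covariance of the changes of the numbers of particles in the windows on both sides. -/
lemma IsInput.covariance_windows (h : IsInput P p q ρ Set.univ N η₀)
    (h' : IsInput P' p q ρ {0}ᶜ N' η₀') (hpq : p + q = 1) (hρ : 0 ≤ ρ)
    (hzero : ∀ᵐ ω ∂P', η₀' ω 0 = false) (t : ℝ≥0) (z : ℤ) (M : ℕ) :
    covariance
      (fun ω => ∑ i ∈ Finset.Ioc z M, occ (process (N ω) (η₀ ω) t) i -
        ∑ i ∈ Finset.Ioc 0 (M : ℤ), occ (η₀ ω) i)
      (fun ω => ∑ k ∈ Finset.Ioc (-(M : ℤ)) 0, occ (η₀ ω) k -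
        ∑ k ∈ Finset.Ioc (-(M : ℤ)) z, occ (process (N ω) (η₀ ω) t) k) P =
      ρ * (1 - ρ) * ∫ ω, pairCount z M (secondClass (N' ω) (η₀' ω) t) ∂P' := by
  have m0 := h.memLp_occ hpq
  have mt := h.memLp_occ_process hpq t
  have s0 := fun I : Finset ℤ => memLp_finsetSum I fun i _ => m0 i
  have st := fun I : Finset ℤ => memLp_finsetSum I fun i _ => mt i
  rw [covariance_fun_sub_fun_sub (st _) (s0 _) (s0 _) (st _),
    covariance_fun_sum_fun_sum' (fun i _ => mt i) (fun i _ => m0 i),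
    covariance_fun_sum_fun_sum' (fun i _ => mt i) (fun i _ => mt i),
    covariance_fun_sum_fun_sum' (fun i _ => m0 i) (fun i _ => m0 i),
    covariance_fun_sum_fun_sum' (fun i _ => m0 i) (fun i _ => mt i)]
  -- The windows at time `t` lie on opposite sides of `z`, those at time `0` on opposite sides of
  -- the origin, so equal-time pairs are distinct sites and uncorrelated.
  have z1 : ∑ i ∈ Finset.Ioc z (M : ℤ), ∑ k ∈ Finset.Ioc (-(M : ℤ)) z,
      covariance (fun ω => occ (process (N ω) (η₀ ω) t) i)
        (fun ω => occ (process (N ω) (η₀ ω) t) k) P = 0 :=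
    Finset.sum_eq_zero fun i hi => Finset.sum_eq_zero fun k hk =>
      h.covariance_process_process hpq t (by rw [Finset.mem_Ioc] at hi hk; omega)
  have z2 : ∑ i ∈ Finset.Ioc 0 (M : ℤ), ∑ k ∈ Finset.Ioc (-(M : ℤ)) 0,
      covariance (fun ω => occ (η₀ ω) i) (fun ω => occ (η₀ ω) k) P = 0 :=
    Finset.sum_eq_zero fun i hi => Finset.sum_eq_zero fun k hk =>
      h.covariance_occ_occ hpq (by rw [Finset.mem_Ioc] at hi hk; omega)
  have hc := h.covariance_process_shift h' hpq hρ hzero t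
  have hc' : ∀ i k, covariance (fun ω => occ (η₀ ω) i)
      (fun ω => occ (process (N ω) (η₀ ω) t) k) P =
      ρ * (1 - ρ) * P'.real {ω | secondClass (N' ω) (η₀' ω) t = k - i} := fun i k => by
    rw [covariance_comm, hc]
  rw [z1, z2, h'.integral_pairCount hpq hzero t z M]
  simp only [hc, hc', ← Finset.mul_sum]
  ring

/-- The variance of the current is, up to the factor `ρ(1 - ρ)`, the mean distance of the second
class particle from the end point. -/
theorem IsInput.variance_current (h : IsInput P p q ρ Set.univ N η₀)
    (h' : IsInput P' p q ρ {0}ᶜ N' η₀') (hpq : p + q = 1) (hρ : 0 < ρ) (hρ1 : ρ < 1)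
    (hzero : ∀ᵐ ω ∂P', η₀' ω 0 = false) (z : ℤ) {t : ℝ≥0} (ht : 0 < t) :
    MemLp (fun ω => (current (N ω) (η₀ ω) z t : ℝ)) 2 P ∧
    variance (fun ω => (current (N ω) (η₀ ω) z t : ℝ)) P =
      ρ * (1 - ρ) * ∫ ω, |(secondClass (N' ω) (η₀' ω) t : ℝ) - z| ∂P' := by
  have hgood := h.ae_good hpq
  have m0 := h.memLp_occ hpq
  have mt := h.memLp_occ_process hpq t
  have mR := h.memLp_bondCurrent hpq t
  have s0 := fun I : Finset ℤ => memLp_finsetSum I fun i _ => m0 i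
  have st := fun I : Finset ℤ => memLp_finsetSum I fun i _ => mt i
  set J : Ω → ℝ := fun ω => (current (N ω) (η₀ ω) z t : ℝ) with hJ
  set R : ℤ → Ω → ℝ := fun M ω => bondCurrent M t (N ω) (η₀ ω) with hR
  set E : Ω → ℝ := fun ω => ∑ k ∈ Finset.Ioc z 0, occ (η₀ ω) k -
    ∑ k ∈ Finset.Ioc 0 z, occ (η₀ ω) k with hE
  have mE : MemLp E 2 P := (s0 _).sub (s0 _)
  have hJE : J =ᵐ[P] R z + E := by
    filter_upwards [hgood] with ω hω
    exact current_eq_bondCurrent_self hω (η₀ ω) t z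
  have mJ : MemLp J 2 P := ((mR z).add mE).ae_eq hJE.symm
  refine ⟨mJ, ?_⟩
  set r : ℤ → ℝ := fun L => covariance (R 0) (R L) P with hr
  have hr0 : Tendsto r atTop (𝓝 0) := h.tendsto_covariance_bondCurrent hpq t
  -- By translation invariance only the distance of the two bonds matters.
  have hRR : ∀ M L : ℤ, covariance (R M) (R L) P = r (L - M) := fun M L => by
    have := (GoodMeasurable.bondCurrent 0 t).covariance_shift
      (GoodMeasurable.bondCurrent (L - M) t) h hpq M
    simp only [bondCurrent_shift, zero_add, sub_add_cancel] at this
    exact this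
  have hRocc : ∀ M k : ℤ, covariance (R M) (fun ω => occ (η₀ ω) k) P =
      covariance (R 0) (fun ω => occ (η₀ ω) (k - M)) P := fun M k => by
    have := (GoodMeasurable.bondCurrent 0 t).covariance_shift (F' := fun _ η => occ η (k - M))
      (GoodMeasurable.occ_init (k - M)) h hpq M
    have ho : ∀ η : Config, occ (shiftConfig M η) (k - M) = occ η k := fun η => by
      simp only [occ, shiftConfig, sub_add_cancel]
    simp only [bondCurrent_shift, zero_add, ho] at this
    exact this
  have hocc0 := h.tendsto_covariance_bondCurrent_occ hpq hρ.le hρ1.le ht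
  have hRoccM : ∀ (f : ℕ → ℤ), Function.Injective f → ∀ k,
      Tendsto (fun M => covariance (R (f M)) (fun ω => occ (η₀ ω) k) P) atTop (𝓝 0) :=
    fun f hf k => by
      refine Tendsto.congr (fun M => (hRocc (f M) k).symm) ?_
      rw [← Nat.cofinite_eq_atTop]
      exact hocc0.comp (Function.Injective.tendsto_cofinite fun a b hab => hf (by
        simpa using hab))
  have hRE : ∀ (f : ℕ → ℤ), Function.Injective f →
      Tendsto (fun M => covariance (R (f M)) E P) atTop (𝓝 0) := fun f hf => by
    have hsplit : ∀ M, covariance (R (f M)) E P =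
        ∑ k ∈ Finset.Ioc z 0, covariance (R (f M)) (fun ω => occ (η₀ ω) k) P -
          ∑ k ∈ Finset.Ioc 0 z, covariance (R (f M)) (fun ω => occ (η₀ ω) k) P := fun M => by
      rw [hE, covariance_fun_sub_right (mR _) (s0 _) (s0 _),
        covariance_fun_sum_right' (fun i _ => m0 i) (mR _),
        covariance_fun_sum_right' (fun i _ => m0 i) (mR _)]
    simp only [hsplit]
    have := (tendsto_finsetSum (Finset.Ioc z 0) fun k _ => hRoccM f hf k).sub
      (tendsto_finsetSum (Finset.Ioc 0 z) fun k _ => hRoccM f hf k)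
    simpa using this
  have hRJ : ∀ M, covariance (R M) J P = covariance (R M) (R z) P + covariance (R M) E P :=
    fun M => by
      rw [covariance_congr_ae (ae_eq_refl _) hJE, covariance_add_right (mR M) (mR z) mE]
  have hcast : Tendsto (fun M : ℕ => (M : ℤ)) atTop atTop := tendsto_natCast_atTop_atTop
  have hRJ1 : Tendsto (fun M : ℕ => covariance (R M) J P) atTop (𝓝 0) := by
    have h1 : Tendsto (fun M : ℕ => covariance (R M) (R z) P) atTop (𝓝 0) := by
      simp only [covariance_comm (R _) (R z), hRR]
      exact hr0.comp (tendsto_atTop_add_const_right _ (-z) hcast)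
    simpa only [hRJ, add_zero] using h1.add (hRE (fun M => (M : ℤ)) Nat.cast_injective)
  have hRJ2 : Tendsto (fun M : ℕ => covariance (R (-M)) J P) atTop (𝓝 0) := by
    have h1 : Tendsto (fun M : ℕ => covariance (R (-M)) (R z) P) atTop (𝓝 0) := by
      simp only [hRR, sub_neg_eq_add]
      exact hr0.comp (tendsto_atTop_add_const_left _ z hcast)
    simpa only [hRJ, add_zero] using h1.add (hRE (fun M => -(M : ℤ))
      fun a b hab => Nat.cast_injective (neg_injective hab))
  have hRR0 : Tendsto (fun M : ℕ => covariance (R M) (R (-M)) P) atTop (𝓝 0) := by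
    simp only [covariance_comm (R _) (R (-_)), hRR, sub_neg_eq_add]
    exact hr0.comp (hcast.atTop_add_atTop hcast)
  -- `J = R M + X` is used in one argument of the covariance and `J = Y + R (-M)` in the other. The
  -- leftover covariance of `X` with `R (-M)` is rewritten through `J`, so that all error terms are
  -- known to vanish.
  have hdecomp : ∀ᶠ M : ℕ in atTop, variance J P =
      ρ * (1 - ρ) * ∫ ω, pairCount z M (secondClass (N' ω) (η₀' ω) t) ∂P' +
        covariance (R (-M)) J P - covariance (R M) (R (-M)) P + covariance (R M) J P := by
    filter_upwards [eventually_ge_atTop z.natAbs] with M hM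
    set X : Ω → ℝ := fun ω => ∑ i ∈ Finset.Ioc z M, occ (process (N ω) (η₀ ω) t) i -
        ∑ i ∈ Finset.Ioc 0 (M : ℤ), occ (η₀ ω) i with hX
    set Y : Ω → ℝ := fun ω => ∑ k ∈ Finset.Ioc (-(M : ℤ)) 0, occ (η₀ ω) k -
        ∑ k ∈ Finset.Ioc (-(M : ℤ)) z, occ (process (N ω) (η₀ ω) t) k with hY
    have mX : MemLp X 2 P := (st _).sub (s0 _)
    have mY : MemLp Y 2 P := (s0 _).sub (st _)
    have hJX : J =ᵐ[P] R M + X := by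
      filter_upwards [hgood] with ω hω
      exact current_eq_bondCurrent_add hω (η₀ ω) t (by omega) (by omega)
    have hJY : J =ᵐ[P] Y + R (-M) := by
      filter_upwards [hgood] with ω hω
      exact current_eq_add_bondCurrent hω (η₀ ω) t (by omega) (by omega)
    have hXJ : covariance X J P = covariance X Y P + covariance X (R (-M)) P := by
      rw [covariance_congr_ae (ae_eq_refl X) hJY, covariance_add_right mX mY (mR _)]
    have hJR : covariance J (R (-M)) P =
        covariance (R M) (R (-M)) P + covariance X (R (-M)) P := by
      rw [covariance_congr_ae hJX (ae_eq_refl _), covariance_add_left (mR _) mX (mR _)]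
    have hJJ : covariance J J P = covariance (R M) J P + covariance X J P := by
      rw [covariance_congr_ae hJX (ae_eq_refl J), covariance_add_left (mR _) mX mJ]
    have hXY : covariance X Y P =
        ρ * (1 - ρ) * ∫ ω, pairCount z M (secondClass (N' ω) (η₀' ω) t) ∂P' :=
      h.covariance_windows h' hpq hρ.le hzero t z M
    rw [← covariance_self mJ.aemeasurable, hJJ, hXJ, ← hXY, covariance_comm (R (-M)) J, hJR]
    ring
  have hQ := h.integrable_secondClass h' hpq hρ hρ1 hzero ht
  -- Integrability of the second class particle provides the dominating function `|Q - z|`.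
  have hdom : Tendsto (fun M : ℕ => ∫ ω, pairCount z M (secondClass (N' ω) (η₀' ω) t) ∂P') atTop
      (𝓝 (∫ ω, |(secondClass (N' ω) (η₀' ω) t : ℝ) - z| ∂P')) := by
    refine tendsto_integral_of_dominated_convergence
      (fun ω => |(secondClass (N' ω) (η₀' ω) t : ℝ) - z|)
      (fun M => (h'.aemeasurable_secondClass_comp hpq hzero t
        (pairCount z M)).aestronglyMeasurable) (hQ.sub (integrable_const _)).abs
      (fun M => ae_of_all _ fun ω => ?_) (ae_of_all _ fun ω => ?_)
    · rw [Real.norm_of_nonneg (pairCount_nonneg _ _ _)]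
      exact pairCount_le _ _ _
    · exact tendsto_const_nhds.congr' ((eventually_pairCount_eq z _).mono fun M hM => hM.symm)
  have hlim := (((hdom.const_mul (ρ * (1 - ρ))).add hRJ2).sub hRR0).add hRJ1
  rw [add_zero, sub_zero, add_zero] at hlim
  exact tendsto_nhds_unique (tendsto_const_nhds.congr' hdecomp) hlim

/-- The probability space is partitioned by the value of the second class particle. -/
lemma IsInput.hasSum_abs_sub_mul (h : IsInput P p q ρ Set.univ N η₀)
    (h' : IsInput P' p q ρ {0}ᶜ N' η₀') (hpq : p + q = 1) (hρ : 0 < ρ) (hρ1 : ρ < 1)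
    (hzero : ∀ᵐ ω ∂P', η₀' ω 0 = false) (z : ℤ) {t : ℝ≥0} (ht : 0 < t) :
    HasSum (fun j : ℤ => |(j : ℝ) - z| * P'.real {ω | secondClass (N' ω) (η₀' ω) t = j})
      (∫ ω, |(secondClass (N' ω) (η₀' ω) t : ℝ) - z| ∂P') := by
  have hQ := h.integrable_secondClass h' hpq hρ hρ1 hzero ht
  have hnull := h'.nullMeasurableSet_secondClass hpq hzero t
  have hU : ⋃ j : ℤ, {ω | secondClass (N' ω) (η₀' ω) t = j} = Set.univ := by
    ext ω; simp
  have hs := hasSum_integral_iUnion_ae (μ := P')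
    (f := fun ω => |(secondClass (N' ω) (η₀' ω) t : ℝ) - z|) hnull
    (fun i j hij => (Set.disjoint_left.2 fun ω h1 h2 => hij (h1.symm.trans h2)).aedisjoint)
    (hQ.sub (integrable_const _)).abs.integrableOn
  rw [hU, setIntegral_univ] at hs
  have hterm : ∀ j : ℤ, ∫ ω in {ω | secondClass (N' ω) (η₀' ω) t = j},
      |(secondClass (N' ω) (η₀' ω) t : ℝ) - z| ∂P' =
        |(j : ℝ) - z| * P'.real {ω | secondClass (N' ω) (η₀' ω) t = j} := fun j => by
    rw [setIntegral_congr_ae₀ (hnull j) (g := fun _ => |(j : ℝ) - z|)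
      (ae_of_all _ fun ω hω => by
        rw [show secondClass (N' ω) (η₀' ω) t = j from hω]), setIntegral_const, smul_eq_mul,
      mul_comm]
  simpa only [hterm] using hs

end Variance

/-! ### Flux and characteristic speed. -/

lemma hasDerivAt_flux (p q : ℝ≥0) (ρ : ℝ) :
    HasDerivAt (flux p q) (((p : ℝ) - q) * (1 - 2 * ρ)) ρ := by
  have h := ((hasDerivAt_id ρ).mul ((hasDerivAt_id ρ).const_sub 1)).const_mul ((p : ℝ) - q)
  exact h.congr_deriv (by simp only [id]; ring)

lemma speed_eq (p q : ℝ≥0) (ρ : ℝ) : speed p q ρ = ((p : ℝ) - q) * (1 - 2 * ρ) :=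
  (hasDerivAt_flux p q ρ).deriv

end ASEP

/-! ### The theorem. -/

theorem theorem4p1
    (p q : ℝ≥0) (hqp : q < p) (hpq : p + q = 1) (ρ : ℝ) (hρ0 : 0 < ρ) (hρ1 : ρ < 1)
    -- the stationary process: all initial occupation variables are i.i.d. Bernoulli
    {Ω : Type*} [MeasurableSpace Ω] (P : Measure Ω) [IsProbabilityMeasure P]
    (N : Ω → ASEP.Clocks) (η₀ : Ω → ASEP.Config)
    (hin : ASEP.IsInput P p q ρ Set.univ N η₀)
    -- the process with a second class particle started at the origin
    {Ω' : Type*} [MeasurableSpace Ω'] (P' : Measure Ω') [IsProbabilityMeasure P']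
    (N' : Ω' → ASEP.Clocks) (η₀' : Ω' → ASEP.Config)
    (hin' : ASEP.IsInput P' p q ρ {0}ᶜ N' η₀') (hzero : ∀ᵐ ω ∂P', η₀' ω 0 = false)
    (z : ℤ) (t : ℝ≥0) (ht : 0 < t) :
    -- the processes are almost surely well defined
    (∀ᵐ ω ∂P, ∃! S, ASEP.IsGraphicalPath (N ω) (ASEP.labelled (η₀ ω)) S) ∧
    (∀ s, AEMeasurable (fun ω => ASEP.process (N ω) (η₀ ω) s) P) ∧
    (∀ᵐ ω ∂P', ∃! S, ASEP.IsGraphicalPath (N' ω) (ASEP.labelled (η₀' ω)) S) ∧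
    (∀ᵐ ω ∂P', ∃! S, ASEP.IsGraphicalPath (N' ω) (ASEP.labelled (ASEP.plus (η₀' ω))) S) ∧
    (∀ᵐ ω ∂P', ∀ s, ASEP.IsAddParticle (ASEP.process (N' ω) (η₀' ω) s)
      (ASEP.process (N' ω) (ASEP.plus (η₀' ω)) s) (ASEP.secondClass (N' ω) (η₀' ω) s)) ∧
    -- the variance of the current
    MemLp (fun ω => (ASEP.current (N ω) (η₀ ω) z t : ℝ)) 2 P ∧
    HasSum
      (fun j : ℤ => |(j : ℝ) - z| *
        covariance (fun ω => ASEP.occ (ASEP.process (N ω) (η₀ ω) t) j)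
          (fun ω => ASEP.occ (ASEP.process (N ω) (η₀ ω) 0) 0) P)
      (variance (fun ω => (ASEP.current (N ω) (η₀ ω) z t : ℝ)) P) ∧
    -- the space-time covariance
    (∀ j : ℤ,
      covariance (fun ω => ASEP.occ (ASEP.process (N ω) (η₀ ω) t) j)
          (fun ω => ASEP.occ (ASEP.process (N ω) (η₀ ω) 0) 0) P =
        ρ * (1 - ρ) * P'.real {ω | ASEP.secondClass (N' ω) (η₀' ω) t = j}) ∧
    -- the mean of the second class particle; `H` is the flux of the stationary process
    Integrable (fun ω => (ASEP.secondClass (N' ω) (η₀' ω) t : ℝ)) P' ∧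
    ∫ ω, (ASEP.secondClass (N' ω) (η₀' ω) t : ℝ) ∂P' = ASEP.speed p q ρ * t ∧
    ASEP.speed p q ρ = ((p : ℝ) - q) * (1 - 2 * ρ) ∧
    ∫ ω, (ASEP.current (N ω) (η₀ ω) 0 t : ℝ) ∂P = ASEP.flux p q ρ * t ∧
    -- the variance of the current through the second class particle
    variance (fun ω => (ASEP.current (N ω) (η₀ ω) z t : ℝ)) P =
      ρ * (1 - ρ) * ∫ ω, |(ASEP.secondClass (N' ω) (η₀' ω) t : ℝ) - z| ∂P' := by
  have hgood := hin.ae_good hpq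
  have hgood' := hin'.ae_good hpq
  obtain ⟨hmem, hvar⟩ := hin.variance_current hin' hpq hρ0 hρ1 hzero z ht
  have hcov : ∀ j : ℤ, covariance (fun ω => ASEP.occ (ASEP.process (N ω) (η₀ ω) t) j)
      (fun ω => ASEP.occ (ASEP.process (N ω) (η₀ ω) 0) 0) P =
      ρ * (1 - ρ) * P'.real {ω | ASEP.secondClass (N' ω) (η₀' ω) t = j} := fun j => by
    rw [← hin.covariance_process hin' hpq hρ0.le hzero t j]
    refine ASEP.covariance_congr_ae (ae_eq_refl _) ?_
    filter_upwards [hgood] with ω hω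
    rw [ASEP.process_zero hω]
  refine ⟨hgood.mono fun ω hω => ASEP.existsUnique_isGraphicalPath hω _,
    hin.aemeasurable_process hpq, hgood'.mono fun ω hω => ASEP.existsUnique_isGraphicalPath hω _,
    hgood'.mono fun ω hω => ASEP.existsUnique_isGraphicalPath hω _, ?_, hmem, ?_, hcov,
    hin.integrable_secondClass hin' hpq hρ0 hρ1 hzero ht, ?_, ASEP.speed_eq p q ρ, ?_, hvar⟩
  · filter_upwards [hgood', hzero] with ω hω h0 s
    exact ASEP.isAddParticle_secondClass hω h0 s
  · rw [hvar]
    simp only [hcov, mul_left_comm _ (ρ * (1 - ρ))]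
    exact (hin.hasSum_abs_sub_mul hin' hpq hρ0 hρ1 hzero z ht).mul_left _
  · rw [hin.integral_secondClass hin' hpq hρ0 hρ1 hzero ht, ASEP.speed_eq]
  · rw [← hin.integral_bondCurrent hpq hρ0.le]
    simp only [ASEP.bondCurrent_zero]
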